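/- Conventions. Orbifolds are smooth, effective, Hausdorff and second countable. $O(4)$ acts on the unit sphere $\mathbb{S}^3\subset\mathbb{R}^4$, and for a finite subgroup $\Gamma\subset O(4)$ the quotient orbifold is denoted $\mathbb{S}^3//\Gamma$. Let $\mathcal{O}$ be a Riemannian 4-orbifold with metric $g$ and scalar curvature $R$, let $\varepsilon>0$, and put $\mathbb{I}=(-\varepsilon^{-1},\varepsilon^{-1})$. An $\varepsilon$-neck in $\mathcal{O}$ is a diffeomorphism of orbifolds $\psi:(\mathbb{S}^3//\Gamma)\times\mathbb{I}\to U$ onto an open subset $U\subset\mathcal{O}$, with $\Gamma$ a finite subgroup of $O(4)$, such that for some $x_0\in\psi(\mathbb{S}^3//\Gamma\times\{0\})$ the rescaled metric $R(x_0)\,\psi^*g$ is $\varepsilon$-close in $C^{[\varepsilon^{-1}]}$ to the standard product metric $\bar g=6g_{\mathbb{S}^3}+ds^2$ of scalar curvature $1$ (here $g_{\mathbb{S}^3}$ is the metric of the unit sphere), that is, $|\bar\nabla^j(R(x_0)\psi^*g-\bar g)|_{\bar g}<\varepsilon$ everywhere on $(\mathbb{S}^3//\Gamma)\times\mathbb{I}$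 for all integers $0\le j\le[\varepsilon^{-1}]$, where $\bar\nabla$ is the Levi-Civita connection of $\bar g$. **Lemma A.2.** There is a universal constant $\varepsilon_0>0$ such that the following holds for every $0<\varepsilon\le\varepsilon_0$. Let $\mathcal{O}$ be a Riemannian 4-orbifold, and let $\psi_i:(\mathbb{S}^3//\Gamma_i)\times(-\varepsilon^{-1},\varepsilon^{-1})\to U_i\subset\mathcal{O}$ $(i=1,2)$ be $\varepsilon$-necks, where $\Gamma_1,\Gamma_2$ are finite subgroups of $O(4)$. Let $\pi_1:U_1\to(-\varepsilon^{-1},\varepsilon^{-1})$ be the composition of $\psi_1^{-1}$ with the projection onto the second factor. If $U_1\cap U_2$ contains a point $y$ with $-0.9\,\varepsilon^{-1}\le\pi_1(y)\le 0.9\,\varepsilon^{-1}$, then $\Gamma_1$ and $\Gamma_2$ are conjugate in $O(4)$. -/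

import Mathlib

open Set
open scoped ContDiff

noncomputable section

namespace NeckOrbifold

universe u v

/-- The model space `ℝⁿ`. -/
abbrev E (n : ℕ) : Type := EuclideanSpace ℝ (Fin n)

/-! ### Smooth (effective) orbifolds, given by an atlas of uniformizing charts -/

/-- A uniformizing chart of dimension `n` on a space `X`: a connected open set `dom ⊆ ℝⁿ`, a
finite group `Grp` acting smoothly and effectively on `dom`, and a continuous open map
`dom → X` whose fibres are exactly the `Grp`-orbits (so that it induces a homeomorphism of
`dom / Grp` onto an open subset of `X`). -/
structure OrbifoldChart (n : ℕ) (X : Type u) [TopologicalSpace X] where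
  dom : Set (E n)
  isOpen_dom : IsOpen dom
  isPreconnected_dom : IsPreconnected dom
  Grp : Type
  [group : Group Grp]
  [finite : Finite Grp]
  /-- the action; only its values on `dom` matter -/
  act : Grp → E n → E n
  act_mem : ∀ g, ∀ w ∈ dom, act g w ∈ dom
  act_one : ∀ w ∈ dom, act 1 w = w
  act_mul : ∀ g h, ∀ w ∈ dom, act (g * h) w = act g (act h w)
  act_smooth : ∀ g, ContDiffOn ℝ ∞ (act g) dom
  act_effective : ∀ g, (∀ w ∈ dom, act g w = w) → dom.Nonempty → g = 1
  toFun : dom → X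
  continuous_toFun : Continuous toFun
  isOpenMap_toFun : IsOpenMap toFun
  toFun_eq_iff : ∀ w z : dom, toFun w = toFun z ↔ ∃ g, act g w = z

/-- `e` is a diffeomorphism between open subsets of the domains of the charts `c` (on `X`) and `d`
(on `Y`) which lifts the map `f : X → Y`. -/
structure IsLocalLift {n : ℕ} {X : Type u} {Y : Type v} [TopologicalSpace X] [TopologicalSpace Y]
    (c : OrbifoldChart n X) (d : OrbifoldChart n Y) (f : X → Y)
    (e : OpenPartialHomeomorph (E n) (E n)) : Prop where
  source_subset : e.source ⊆ c.dom
  target_subset : e.target ⊆ d.dom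
  smooth : ContDiffOn ℝ ∞ e e.source
  smooth_symm : ContDiffOn ℝ ∞ e.symm e.target
  comm : ∀ w (hw : w ∈ e.source),
    d.toFun ⟨e w, target_subset (e.map_source hw)⟩ = f (c.toFun ⟨w, source_subset hw⟩)

/-- A smooth `n`-orbifold structure on `X`: uniformizing charts which cover `X` and are pairwise
compatible, that is, whenever `w` and `z` are points of two charts over the same point of `X`,
there is a diffeomorphism from a neighbourhood of `w` to a neighbourhood of `z` that takes `w` to
`z` and lifts the identity of `X`. -/
structure OrbifoldAtlas (n : ℕ) (X : Type u) [TopologicalSpace X] where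
  charts : Set (OrbifoldChart n X)
  covers : ∀ x : X, ∃ c : OrbifoldChart n X, c ∈ charts ∧ ∃ w : c.dom, c.toFun w = x
  compatible : ∀ c ∈ charts, ∀ d ∈ charts, ∀ (w : c.dom) (z : d.dom), c.toFun w = d.toFun z →
    ∃ e : OpenPartialHomeomorph (E n) (E n),
      IsLocalLift c d id e ∧ (w : E n) ∈ e.source ∧ e w = z

/-- `f` is a diffeomorphism of the orbifold `X` onto an open suborbifold of `Y`: it is a
homeomorphism onto an open set, and it lifts locally to diffeomorphisms between the
uniformizing charts. -/
structure IsOrbifoldOpenEmbedding {n : ℕ} {X : Type u} {Y : Type v}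
    [TopologicalSpace X] [TopologicalSpace Y]
    (A : OrbifoldAtlas n X) (B : OrbifoldAtlas n Y) (f : X → Y) : Prop where
  isOpenEmbedding : Topology.IsOpenEmbedding f
  lifts : ∀ c ∈ A.charts, ∀ d ∈ B.charts, ∀ (w : c.dom) (z : d.dom),
    f (c.toFun w) = d.toFun z →
    ∃ e : OpenPartialHomeomorph (E n) (E n),
      IsLocalLift c d f e ∧ (w : E n) ∈ e.source ∧ e w = z

/-! ### Riemannian metrics on orbifolds -/

/-- A field of bilinear forms on `ℝⁿ`. -/
abbrev BilinField (n : ℕ) : Type := E n → E n →L[ℝ] E n →L[ℝ] ℝ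

/-- A smooth Riemannian metric on an orbifold: a smooth Riemannian metric on the domain of every
chart of the atlas, such that all local lifts of the identity (in particular the
elements of the chart groups and the changes of charts) are isometries. -/
structure OrbifoldMetric {n : ℕ} {X : Type u} [TopologicalSpace X] (A : OrbifoldAtlas n X) where
  form : OrbifoldChart n X → BilinField n
  smooth : ∀ c ∈ A.charts, ContDiffOn ℝ ∞ (form c) c.dom
  symm : ∀ c ∈ A.charts, ∀ w ∈ c.dom, ∀ a b, form c w a b = form c w b a
  pos : ∀ c ∈ A.charts, ∀ w ∈ c.dom, ∀ a, a ≠ 0 → 0 < form c w a a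
  isometric : ∀ c ∈ A.charts, ∀ d ∈ A.charts, ∀ e, IsLocalLift c d id e →
    ∀ w ∈ e.source, ∀ a b,
      form c w a b = form d (e w) (fderiv ℝ e w a) (fderiv ℝ e w b)

/-- `h` is the pulled back metric `f^* g`. -/
def IsPullbackMetric {n : ℕ} {X : Type u} {Y : Type v} [TopologicalSpace X] [TopologicalSpace Y]
    {A : OrbifoldAtlas n X} {B : OrbifoldAtlas n Y}
    (f : X → Y) (g : OrbifoldMetric B) (h : OrbifoldMetric A) : Prop :=
  ∀ c ∈ A.charts, ∀ d ∈ B.charts, ∀ e, IsLocalLift c d f e →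
    ∀ w ∈ e.source, ∀ a b,
      h.form c w a b = g.form d (e w) (fderiv ℝ e w a) (fderiv ℝ e w b)

/-! ### Tensor calculus in coordinates -/

/-- The `i`-th coordinate vector. -/
def basisVec {n : ℕ} (i : Fin n) : E n := EuclideanSpace.single i 1

/-- The partial derivative `∂ᵢ f`. -/
def partialDeriv {n : ℕ} (i : Fin n) (f : E n → ℝ) (x : E n) : ℝ := fderiv ℝ f x (basisVec i)

/-- The matrix `(g_{ij})`. -/
def metricMatrix {n : ℕ} (g : BilinField n) (x : E n) : Matrix (Fin n) (Fin n) ℝ :=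
  Matrix.of fun i j => g x (basisVec i) (basisVec j)

/-- The inverse matrix `(g^{ij})`. -/
def invMetric {n : ℕ} (g : BilinField n) (x : E n) : Matrix (Fin n) (Fin n) ℝ :=
  (metricMatrix g x)⁻¹

/-- The Christoffel symbol `Γ^k_{ij}` of the Levi-Civita connection of `g`. -/
def christoffel {n : ℕ} (g : BilinField n) (k i j : Fin n) (x : E n) : ℝ :=
  (1 / 2) * ∑ l, invMetric g x k l *
    (partialDeriv i (fun y => metricMatrix g y j l) x
      + partialDeriv j (fun y => metricMatrix g y i l) x
      - partialDeriv l (fun y => metricMatrix g y i j) x)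

/-- The Ricci curvature
`Ric_{jk} = ∂ᵢ Γ^i_{jk} - ∂ⱼ Γ^i_{ik} + Γ^i_{im} Γ^m_{jk} - Γ^i_{jm} Γ^m_{ik}`. -/
def ricci {n : ℕ} (g : BilinField n) (j k : Fin n) (x : E n) : ℝ :=
  ∑ i, (partialDeriv i (christoffel g i j k) x - partialDeriv j (christoffel g i i k) x
    + ∑ m, (christoffel g i i m x * christoffel g m j k x
      - christoffel g i j m x * christoffel g m i k x))

/-- The scalar curvature `g^{jk} Ric_{jk}`. -/
def scalarCurvature {n : ℕ} (g : BilinField n) (x : E n) : ℝ :=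
  ∑ j, ∑ k, invMetric g x j k * ricci g j k x

/-- The components of a covariant `r`-tensor field. -/
abbrev CoordTensor (n r : ℕ) : Type := E n → (Fin r → Fin n) → ℝ

/-- The covariant derivative
`(∇T)_{a i₁ … i_r} = ∂_a T_{i₁ … i_r} - ∑_s Γ^m_{a i_s} T_{i₁ … m … i_r}`
with respect to the Levi-Civita connection of `g`. -/
def covDeriv {n r : ℕ} (g : BilinField n) (T : CoordTensor n r) : CoordTensor n (r + 1) :=
  fun x I =>
    partialDeriv (I 0) (fun y => T y (Fin.tail I)) x
      - ∑ s : Fin r, ∑ m, christoffel g m (I 0) (Fin.tail I s) x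
          * T x (Function.update (Fin.tail I) s m)

/-- The iterated covariant derivative `∇ʲ T`. -/
def iterCovDeriv {n r : ℕ} (g : BilinField n) (T : CoordTensor n r) :
    (j : ℕ) → CoordTensor n (r + j)
  | 0 => T
  | j + 1 => covDeriv g (iterCovDeriv g T j)

/-- The pointwise norm `|T|_g`. -/
def tensorNorm {n r : ℕ} (g : BilinField n) (T : CoordTensor n r) (x : E n) : ℝ :=
  Real.sqrt (∑ I : Fin r → Fin n, ∑ J : Fin r → Fin n,
    (∏ s, invMetric g x (I s) (J s)) * T x I * T x J)

/-- The components of a field of bilinear forms. -/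
def bilinTensor {n : ℕ} (h : BilinField n) : CoordTensor n 2 :=
  fun x I => h x (basisVec (I 0)) (basisVec (I 1))

/-- `h` is `ε`-close to the metric `g` in the `C^k` norm on `D`: for all `j ≤ k`, the tensor
`∇ʲ(h - g)` has norm less than `ε` on `D` (norms and covariant derivatives with respect to `g`). -/
def IsCkClose {n : ℕ} (k : ℕ) (ε : ℝ) (D : Set (E n)) (h g : BilinField n) : Prop :=
  ∀ j ≤ k, ∀ x ∈ D, tensorNorm g (iterCovDeriv g (bilinTensor h - bilinTensor g) j) x < ε

/-- The scalar curvature of a Riemannian orbifold at a point `x`, computed in a chart at a point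
over `x`. By the invariance of the scalar curvature under isometries, the
choice of the chart and of the point does not matter. -/
def OrbifoldMetric.scalarCurvatureAt {n : ℕ} {X : Type u} [TopologicalSpace X]
    {A : OrbifoldAtlas n X} (g : OrbifoldMetric A) (x : X) : ℝ :=
  scalarCurvature (g.form (A.covers x).choose) ((A.covers x).choose_spec.2.choose : E n)

/-! ### The cylinders `𝕊³//Γ × (-L, L)` -/

/-- The orthogonal group `O(4)`, as the group of linear isometries of `ℝ⁴`. -/
abbrev O4 : Type := E 4 ≃ₗᵢ[ℝ] E 4

/-- The unit sphere of `ℝ⁴`. -/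
abbrev S3 : Type := Metric.sphere (0 : E 4) 1

/-- The orbit relation of `Γ ≤ O(4)` on `𝕊³`. -/
def sphereSetoid (Γ : Subgroup O4) : Setoid S3 where
  r p q := ∃ γ ∈ Γ, γ (p : E 4) = q
  iseqv :=
    { refl := fun p => ⟨1, Γ.one_mem, rfl⟩
      symm := by
        rintro p q ⟨γ, hγ, h⟩
        exact ⟨γ⁻¹, Γ.inv_mem hγ, by rw [← h]; exact γ.symm_apply_apply _⟩
      trans := by
        rintro p q r ⟨γ, hγ, h⟩ ⟨δ, hδ, h'⟩
        exact ⟨δ * γ, Γ.mul_mem hδ hγ, by rw [← h', ← h]; rfl⟩ }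

/-- The space underlying `𝕊³//Γ × (-L, L)`. -/
abbrev Cylinder (Γ : Subgroup O4) (L : ℝ) : Type := Quotient (sphereSetoid Γ) × Ioo (-L) L

/-- The second polar coordinate on `ℝ⁴ ∖ {0}`, that is, the coordinate along the axis of the
cylinder. -/
def axial (x : E 4) : ℝ := Real.sqrt 6 * Real.log ‖x‖

/-- The first polar coordinate on `ℝ⁴ ∖ {0}`, with values in the unit sphere. -/
def radial (x : E 4) : E 4 := ‖x‖⁻¹ • x

/-- The annulus of `ℝ⁴` that polar coordinates `x ↦ (radial x, axial x)` identify with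
`𝕊³ × (-L, L)`. -/
def annulus (L : ℝ) : Set (E 4) := {x | x ≠ 0 ∧ axial x ∈ Ioo (-L) L}

lemma radial_mem {x : E 4} (hx : x ≠ 0) : radial x ∈ Metric.sphere (0 : E 4) 1 := by
  simp [radial, norm_smul, hx]

/-- The point of `ℝ⁴` with given polar coordinates. -/
def unpolar (p : S3 × ℝ) : E 4 := Real.exp (p.2 / Real.sqrt 6) • (p.1 : E 4)

lemma norm_unpolar (p : S3 × ℝ) : ‖unpolar p‖ = Real.exp (p.2 / Real.sqrt 6) := by
  simp [unpolar, norm_smul]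

lemma unpolar_ne (p : S3 × ℝ) : unpolar p ≠ 0 := by
  rw [← norm_ne_zero_iff, norm_unpolar]; positivity

lemma axial_unpolar (p : S3 × ℝ) : axial (unpolar p) = p.2 := by
  rw [axial, norm_unpolar, Real.log_exp]; field_simp

lemma radial_unpolar (p : S3 × ℝ) : radial (unpolar p) = p.1 := by
  rw [radial, norm_unpolar, unpolar, smul_smul, inv_mul_cancel₀ (by positivity), one_smul]

lemma unpolar_polar {x : E 4} (hx : x ≠ 0) : unpolar (⟨radial x, radial_mem hx⟩, axial x) = x := by
  have h : 0 < ‖x‖ := norm_pos_iff.2 hx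
  have h6 : Real.sqrt 6 ≠ 0 := by positivity
  simp only [unpolar, axial, radial]
  rw [mul_div_cancel_left₀ _ h6, Real.exp_log h, smul_smul, mul_inv_cancel₀ h.ne', one_smul]

lemma continuous_unpolar : Continuous unpolar := by
  unfold unpolar; fun_prop

/-- Polar coordinates, as a homeomorphism of the annulus with `𝕊³ × (-L, L)`. -/
def polarHomeo (L : ℝ) : annulus L ≃ₜ S3 × Ioo (-L) L where
  toFun x := (⟨radial x, radial_mem x.2.1⟩, ⟨axial x, x.2.2⟩)
  invFun p := ⟨unpolar (p.1, p.2), unpolar_ne _, by rw [axial_unpolar]; exact p.2.2⟩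
  left_inv x := Subtype.ext (unpolar_polar x.2.1)
  right_inv p := Prod.ext (Subtype.ext (radial_unpolar _)) (Subtype.ext (axial_unpolar _))
  continuous_toFun := by
    have h0 : ∀ x : annulus L, ‖(x : E 4)‖ ≠ 0 := fun x => norm_ne_zero_iff.2 x.2.1
    have hn : Continuous fun x : annulus L => ‖(x : E 4)‖ := by fun_prop
    refine Continuous.prodMk (Continuous.subtype_mk ?_ _) (Continuous.subtype_mk ?_ _)
    · exact (hn.inv₀ h0).smul continuous_subtype_val
    · exact continuous_const.mul (hn.log h0)
  continuous_invFun := by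
    refine Continuous.subtype_mk (continuous_unpolar.comp ?_) _
    fun_prop

lemma isOpen_annulus (L : ℝ) : IsOpen (annulus L) := by
  have h : ContinuousOn axial {x : E 4 | x ≠ 0} := by
    intro x hx
    have : ‖x‖ ≠ 0 := norm_ne_zero_iff.2 hx
    unfold axial
    exact (continuousAt_const.mul (continuous_norm.continuousAt.log this)).continuousWithinAt
  exact h.isOpen_inter_preimage isOpen_ne isOpen_Ioo

lemma isPreconnected_annulus (L : ℝ) : IsPreconnected (annulus L) := by
  have : PreconnectedSpace S3 := by
    apply isPreconnected_iff_preconnectedSpace.1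
    apply isPreconnected_sphere
    rw [← Module.finrank_eq_rank]
    simp
  have : PreconnectedSpace (Ioo (-L) L) :=
    isPreconnected_iff_preconnectedSpace.1 isPreconnected_Ioo
  have h := isPreconnected_range
    (continuous_subtype_val.comp (polarHomeo L).symm.continuous)
  rwa [(polarHomeo L).symm.surjective.range_comp, Subtype.range_val] at h

lemma isOpenMap_sphere_mk (Γ : Subgroup O4) :
    IsOpenMap (Quotient.mk (sphereSetoid Γ)) := by
  intro V hV
  rw [← isQuotientMap_quotient_mk'.isOpen_preimage]
  have : Quotient.mk (sphereSetoid Γ) ⁻¹' (Quotient.mk (sphereSetoid Γ) '' V)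
      = ⋃ γ : Γ, {p : S3 | ∃ q ∈ V, (q : E 4) = (γ : O4) p} := by
    ext p
    simp only [mem_preimage, mem_image, mem_iUnion, mem_ofPred_eq]
    constructor
    · rintro ⟨q, hq, h⟩
      obtain ⟨γ, hγ, h'⟩ := (sphereSetoid Γ).symm (Quotient.exact h)
      exact ⟨⟨γ, hγ⟩, q, hq, h'.symm⟩
    · rintro ⟨γ, q, hq, h⟩
      exact ⟨q, hq, Quotient.sound ((sphereSetoid Γ).symm ⟨γ, γ.2, h.symm⟩)⟩
  change IsOpen (Quotient.mk (sphereSetoid Γ) ⁻¹' _)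
  rw [this]
  refine isOpen_iUnion fun γ => ?_
  have hc : Continuous fun p : S3 => (⟨(γ : O4) p, by simp⟩ : S3) :=
    Continuous.subtype_mk ((γ : O4).continuous.comp continuous_subtype_val) _
  convert hV.preimage hc using 1
  ext p
  constructor
  · rintro ⟨q, hq, h⟩
    have : q = ⟨(γ : O4) p, by simp⟩ := Subtype.ext h
    rw [this] at hq; exact hq
  · intro h
    exact ⟨_, h, rfl⟩

lemma norm_O4 (γ : O4) (x : E 4) : ‖γ x‖ = ‖x‖ := γ.norm_map x

lemma mem_annulus_O4 {L : ℝ} (γ : O4) {x : E 4} (hx : x ∈ annulus L) : γ x ∈ annulus L := by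
  refine ⟨?_, ?_⟩
  · rw [← norm_ne_zero_iff, norm_O4]; exact norm_ne_zero_iff.2 hx.1
  · rw [axial, norm_O4]; exact hx.2

/-- Polar coordinates on `𝕊³//Γ × (-L, L)`: the annulus with the linear action of `Γ` and the map
`x ↦ ([radial x], axial x)` is a uniformizing chart of the whole orbifold. -/
def cylinderChart (Γ : Subgroup O4) [Finite Γ] (L : ℝ) : OrbifoldChart 4 (Cylinder Γ L) where
  dom := annulus L
  isOpen_dom := isOpen_annulus L
  isPreconnected_dom := isPreconnected_annulus L
  Grp := Γ
  act γ x := (γ : O4) x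
  act_mem γ x hx := mem_annulus_O4 γ hx
  act_one x _ := rfl
  act_mul γ δ x _ := rfl
  act_smooth γ := ((γ : O4).toContinuousLinearEquiv.contDiff).contDiffOn
  act_effective := by
    rintro γ h ⟨w, hw⟩
    have hLpos : 0 < L := by
      have := hw.2
      rw [mem_Ioo] at this
      linarith
    apply Subtype.ext
    apply LinearIsometryEquiv.ext
    intro x
    by_cases hx : x = 0
    · simp [hx]
    have hn : ‖x‖ ≠ 0 := norm_ne_zero_iff.2 hx
    have hr : radial x ∈ annulus L := by
      have h1 : ‖radial x‖ = 1 := by simpa using radial_mem hx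
      refine ⟨by rw [← norm_ne_zero_iff, h1]; exact one_ne_zero, ?_⟩
      rw [axial, h1]
      simpa using hLpos
    have key := h _ hr
    simp only [radial, map_smul] at key
    exact smul_right_injective _ (inv_ne_zero hn) key
  toFun x := (Quotient.mk _ ⟨radial x, radial_mem x.2.1⟩, ⟨axial x, x.2.2⟩)
  continuous_toFun :=
    (continuous_quot_mk.prodMap continuous_id).comp (polarHomeo L).continuous
  isOpenMap_toFun :=
    ((isOpenMap_sphere_mk Γ).prodMap IsOpenMap.id).comp (polarHomeo L).isOpenMap
  toFun_eq_iff := by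
    intro w z
    constructor
    · intro h
      obtain ⟨h1, h2⟩ := Prod.ext_iff.1 h
      obtain ⟨γ, hγ, h3⟩ := Quotient.exact h1
      have h2 : axial w = axial z := congrArg Subtype.val h2
      refine ⟨⟨γ, hγ⟩, ?_⟩
      have h4 := unpolar_polar w.2.1
      have h5 := unpolar_polar z.2.1
      simp only at h3
      rw [← h4, ← h5]
      simp only [unpolar, map_smul, h2, h3]
    · rintro ⟨γ, h⟩
      have hn : ‖(w : E 4)‖ = ‖(z : E 4)‖ := by rw [← h, norm_O4]
      refine Prod.ext (Quotient.sound ⟨γ, γ.2, ?_⟩) (Subtype.ext ?_)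
      · simp only [radial, map_smul, hn, h]
      · simp only [axial, hn]

/-- The orbifold `𝕊³//Γ × (-L, L)`. -/
def cylinderAtlas (Γ : Subgroup O4) [Finite Γ] (L : ℝ) : OrbifoldAtlas 4 (Cylinder Γ L) where
  charts := {cylinderChart Γ L}
  covers := by
    rintro ⟨q, s⟩
    refine ⟨_, rfl, ?_⟩
    obtain ⟨p, rfl⟩ := Quotient.exists_rep q
    refine ⟨(polarHomeo L).symm (p, s), ?_⟩
    have := (polarHomeo L).apply_symm_apply (p, s)
    exact congrArg (Prod.map (Quotient.mk (sphereSetoid Γ)) id) this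
  compatible := by
    rintro c rfl d rfl w z h
    obtain ⟨γ, hγ⟩ := ((cylinderChart Γ L).toFun_eq_iff w z).1 h
    let δ : O4 := (show Γ from γ : O4)
    let e := δ.toHomeomorph.toOpenPartialHomeomorph.restrOpen (annulus L) (isOpen_annulus L)
    have hs : e.source = annulus L := by simp [e]
    have ht : e.target ⊆ annulus L := by
      intro y hy
      have := e.map_target hy
      rw [hs] at this
      have h2 := mem_annulus_O4 δ this
      have h3 : e (e.symm y) = y := e.right_inv hy
      have h4 : δ (e.symm y) = e (e.symm y) := rfl
      rwa [h4, h3] at h2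
    refine ⟨e, ⟨hs.le, ht, ?_, ?_, ?_⟩, ?_, hγ⟩
    · exact δ.toContinuousLinearEquiv.contDiff.contDiffOn
    · exact δ.symm.toContinuousLinearEquiv.contDiff.contDiffOn
    · intro x hx
      exact (((cylinderChart Γ L).toFun_eq_iff _ _).2 ⟨γ, rfl⟩).symm
    · rw [hs]; exact w.2

/-- The Euclidean inner product of `ℝⁿ`, as a continuous bilinear form. -/
def euclideanForm (n : ℕ) : E n →L[ℝ] E n →L[ℝ] ℝ := innerSL ℝ

/-- The standard metric `6 g_{𝕊³} + ds²` of `𝕊³ × ℝ` (the product metric of scalar curvature `1`: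
the sphere has radius `√6`), in polar coordinates. -/
def cylinderMetric : BilinField 4 := fun x =>
  (6 : ℝ) • (euclideanForm 4).bilinearComp (fderiv ℝ radial x) (fderiv ℝ radial x)
    + (ContinuousLinearMap.mul ℝ ℝ).bilinearComp (fderiv ℝ axial x) (fderiv ℝ axial x)

/-- `ψ : 𝕊³//Γ × (-ε⁻¹, ε⁻¹) → X` is (the parametrization of) an `ε`-neck in the Riemannian
4-orbifold `X`: it is a diffeomorphism onto an open subset, and for some point
`x₀ ∈ ψ(𝕊³//Γ × {0})` (a centre of the neck) the pulled back metric `ψ^* g`, scaled with the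
factor `R(x₀)`, is `ε`-close in `C^{[ε⁻¹]}` to the standard metric of scalar curvature `1`. -/
def IsNeck {X : Type u} [TopologicalSpace X] {A : OrbifoldAtlas 4 X} (g : OrbifoldMetric A)
    (ε : ℝ) (Γ : Subgroup O4) [Finite Γ] (ψ : Cylinder Γ ε⁻¹ → X) : Prop :=
  IsOrbifoldOpenEmbedding (cylinderAtlas Γ ε⁻¹) A ψ ∧
  ∃ p₀ : Cylinder Γ ε⁻¹, (p₀.2 : ℝ) = 0 ∧
    ∃ h : OrbifoldMetric (cylinderAtlas Γ ε⁻¹), IsPullbackMetric ψ g h ∧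
      IsCkClose ⌊ε⁻¹⌋₊ ε (annulus ε⁻¹)
        (fun x => g.scalarCurvatureAt (ψ p₀) • h.form (cylinderChart Γ ε⁻¹) x) cylinderMetric

end NeckOrbifold

end

noncomputable section
namespace NeckOrbifold

open Filter Topology

/-! ### The cylinder metric -/

/-! Polar coordinates turn each neck into the quotient of an annulus of ℝ⁴ by its group, and the
overlap of the two necks into a relation `rel` between annuli (`IsOverlap`). Locally `rel` is the
graph of a diffeomorphism that stretches the cylinder metric by at most `κ * μ`, with inverse
stretching by at most `κ * μ⁻¹`; here `μ = √(R₂ / R₁)` compares the scales and `κ = √((1 + ε) / (1 -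
ε))` is nearly 1. The aim is to patch these germs to a map `F` that intertwines the groups, and then
to replace `F` by an orthogonal map.

Sliding the common point along the axis of the second neck moves it away from the ends of both
necks, and exchanging the necks if necessary gives `μ ≤ 1`. A curve starting in the overlap stays
there until its image could reach an end (`IsOverlap.exists_rel_of_curve`), so a long slab lies in
the overlap. Lifts on a connected open set are unique up to the second group
(`IsLiftOn.exists_eqOn`), and a slab is simply connected, so `F` exists on it (`exists_lift_slab`).

On a slab much longer than the diameter of the sphere, distances to two points far out on either
side pin down the axial coordinate up to O(1/T), so `F` almost maps slices to slices
(`IsOverlap.exists_axial_near`). As `F` hardly expands, it hardly increases angles; the same bound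
at a preimage of the antipode of `F x` shows that it hardly decreases them
(`abs_angle_sub_angle_le`).

Uniqueness of lifts gives `F ∘ γ = γ' ∘ F`, and the pairs `(γ, γ')` project onto both groups. The
almost isometric equivariant map of 𝕊³ induced by `F` is interpolated linearly and averaged over
these pairs; this gives an invertible linear intertwiner, whose orthogonal polar factor conjugates
one group to the other (`exists_conj_of_almost_isometry`). -/

lemma hasFDerivAt_norm_of_ne {x : E 4} (hx : x ≠ 0) :
    HasFDerivAt (fun y : E 4 => ‖y‖) (‖x‖⁻¹ • innerSL ℝ x) x := by
  have h1 : HasFDerivAt (fun y : E 4 => ‖y‖ ^ 2) (2 • innerSL ℝ x) x :=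
    (hasStrictFDerivAt_norm_sq x).hasFDerivAt
  have hn : ‖x‖ ≠ 0 := norm_ne_zero_iff.2 hx
  have h2 := h1.sqrt (pow_ne_zero 2 hn)
  have h3 : (fun y : E 4 => √(‖y‖ ^ 2)) = fun y => ‖y‖ := by
    funext y; exact Real.sqrt_sq (norm_nonneg y)
  rw [h3, Real.sqrt_sq (norm_nonneg x)] at h2
  refine h2.congr_fderiv ?_
  ext v
  simp
  field_simp

lemma hasFDerivAt_axial {x : E 4} (hx : x ≠ 0) :
    HasFDerivAt axial ((√6 * (‖x‖ ^ 2)⁻¹) • innerSL ℝ x) x := by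
  have hn : ‖x‖ ≠ 0 := norm_ne_zero_iff.2 hx
  have h := ((hasFDerivAt_norm_of_ne hx).log hn).const_mul √6
  refine h.congr_fderiv ?_
  ext v
  simp
  field_simp

lemma hasFDerivAt_radial {x : E 4} (hx : x ≠ 0) :
    HasFDerivAt radial (‖x‖⁻¹ • ContinuousLinearMap.id ℝ (E 4)
      - ((‖x‖ ^ 3)⁻¹ • innerSL ℝ x).smulRight x) x := by
  have hn : ‖x‖ ≠ 0 := norm_ne_zero_iff.2 hx
  have h1 : HasFDerivAt (fun y : E 4 => ‖y‖⁻¹) (-(‖x‖ ^ 2)⁻¹ • (‖x‖⁻¹ • innerSL ℝ x)) x :=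
    (hasDerivAt_inv hn).comp_hasFDerivAt x (hasFDerivAt_norm_of_ne hx)
  have h := h1.smul (hasFDerivAt_id x)
  refine h.congr_fderiv ?_
  ext v i
  simp
  field_simp
  ring

/-- Logarithmic polar coordinates are conformal. Hence lengths on the cylinder are `√6 * (‖v‖ /
‖x‖)`, the form in which speeds appear throughout. -/
lemma cylinderMetric_apply {x : E 4} (hx : x ≠ 0) (a b : E 4) :
    cylinderMetric x a b = 6 / ‖x‖ ^ 2 * inner ℝ a b := by
  have hn : ‖x‖ ≠ 0 := norm_ne_zero_iff.2 hx
  have h6 : √6 * √6 = (6 : ℝ) := Real.mul_self_sqrt (by norm_num)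
  have h1 : inner ℝ (fderiv ℝ radial x a) (fderiv ℝ radial x b)
      = (‖x‖ ^ 2)⁻¹ * inner ℝ a b - (‖x‖ ^ 4)⁻¹ * (inner ℝ x a * inner ℝ x b) := by
    rw [(hasFDerivAt_radial hx).fderiv]
    simp only [sub_apply, smul_apply, ContinuousLinearMap.smulRight_apply, innerSL_apply_apply,
      ContinuousLinearMap.id_apply, smul_eq_mul]
    rw [inner_sub_left, inner_sub_right, inner_sub_right]
    simp only [real_inner_smul_left, real_inner_smul_right, real_inner_self_eq_norm_sq]
    rw [real_inner_comm x a]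
    field_simp
    ring
  have h2 : cylinderMetric x a b = 6 * inner ℝ (fderiv ℝ radial x a) (fderiv ℝ radial x b)
      + fderiv ℝ axial x a * fderiv ℝ axial x b := rfl
  rw [h2, h1, (hasFDerivAt_axial hx).fderiv]
  simp only [smul_apply, innerSL_apply_apply, smul_eq_mul]
  field_simp
  rw [pow_two √6, h6]
  ring

lemma metricMatrix_cylinderMetric {x : E 4} (hx : x ≠ 0) :
    metricMatrix cylinderMetric x = (6 / ‖x‖ ^ 2) • (1 : Matrix (Fin 4) (Fin 4) ℝ) := by
  ext i j
  simp [metricMatrix, cylinderMetric_apply hx, basisVec, Matrix.one_apply,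
    EuclideanSpace.inner_single_left]

lemma invMetric_cylinderMetric {x : E 4} (hx : x ≠ 0) :
    invMetric cylinderMetric x = (‖x‖ ^ 2 / 6) • (1 : Matrix (Fin 4) (Fin 4) ℝ) := by
  have hn : ‖x‖ ≠ 0 := norm_ne_zero_iff.2 hx
  rw [invMetric, metricMatrix_cylinderMetric hx]
  apply Matrix.inv_eq_right_inv
  rw [smul_mul_smul_comm, one_mul]
  field_simp
  simp

lemma tensorNorm_cylinderMetric {r : ℕ} (T : CoordTensor 4 r) {x : E 4} (hx : x ≠ 0) :
    tensorNorm cylinderMetric T x = √((‖x‖ ^ 2 / 6) ^ r * ∑ I, T x I ^ 2) := by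
  rw [tensorNorm, Finset.mul_sum]
  congr 1
  refine Finset.sum_congr rfl fun I _ => ?_
  rw [Finset.sum_eq_single I]
  · simp only [invMetric_cylinderMetric hx, Matrix.smul_apply, Matrix.one_apply_eq, smul_eq_mul,
      mul_one, Finset.prod_const, Finset.card_univ, Fintype.card_fin]
    ring
  · intro J _ hJ
    obtain ⟨s, hs⟩ : ∃ s, I s ≠ J s := by
      by_contra h; push Not at h; exact hJ (funext fun s => (h s).symm)
    have : ∏ s, invMetric cylinderMetric x (I s) (J s) = 0 := by
      refine Finset.prod_eq_zero (Finset.mem_univ s) ?_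
      simp [invMetric_cylinderMetric hx, hs]
    rw [this]; simp
  · simp

/-- A bilinear form is dominated by its Hilbert-Schmidt norm. -/
lemma abs_bilin_le (h : E 4 →L[ℝ] E 4 →L[ℝ] ℝ) (v : E 4) :
    |h v v| ≤ √(∑ I : Fin 2 → Fin 4, h (basisVec (I 0)) (basisVec (I 1)) ^ 2) * ‖v‖ ^ 2 := by
  have hv : v = ∑ i, v i • basisVec i := by
    ext j
    simp [basisVec, Finset.sum_apply, Pi.single_apply]
  have h1 : h v v = ∑ I : Fin 2 → Fin 4,
      h (basisVec (I 0)) (basisVec (I 1)) * (v (I 0) * v (I 1)) := by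
    conv_lhs => rw [hv]
    simp only [map_sum, sum_apply, map_smul, smul_apply,
      smul_eq_mul, Finset.mul_sum]
    rw [← (finTwoArrowEquiv (Fin 4)).symm.sum_comp, Fintype.sum_prod_type, Finset.sum_comm]
    refine Finset.sum_congr rfl fun i _ => Finset.sum_congr rfl fun j _ => ?_
    simp [finTwoArrowEquiv]
    ring
  have h2 : ∑ I : Fin 2 → Fin 4, (v (I 0) * v (I 1)) ^ 2 = (‖v‖ ^ 2) ^ 2 := by
    rw [EuclideanSpace.real_norm_sq_eq, pow_two, Finset.sum_mul_sum,
      ← (finTwoArrowEquiv (Fin 4)).symm.sum_comp, Fintype.sum_prod_type]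
    refine Finset.sum_congr rfl fun i _ => Finset.sum_congr rfl fun j _ => ?_
    simp [finTwoArrowEquiv]
    ring
  have h3 := Finset.sum_mul_sq_le_sq_mul_sq Finset.univ
    (fun I : Fin 2 → Fin 4 => h (basisVec (I 0)) (basisVec (I 1)))
    (fun I => v (I 0) * v (I 1))
  rw [← h1, h2] at h3
  have h4 := Real.sqrt_le_sqrt h3
  rwa [Real.sqrt_sq_eq_abs, Real.sqrt_mul (Finset.sum_nonneg fun _ _ => sq_nonneg _),
    Real.sqrt_sq (by positivity)] at h4

/-- Closeness at order `j = 0`, turned into a comparison of quadratic forms: `6 * (‖v‖ / ‖x‖) ^ 2`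
is the cylinder metric on `v`, and the tensor norm dominates the operator norm. -/
lemma abs_sub_le_of_isCkClose {k : ℕ} {ε : ℝ} {D : Set (E 4)} {h : BilinField 4}
    (hc : IsCkClose k ε D h cylinderMetric) {x : E 4} (hx : x ∈ D) (h0 : x ≠ 0) (v : E 4) :
    |h x v v - 6 * (‖v‖ / ‖x‖) ^ 2| ≤ ε * (6 * (‖v‖ / ‖x‖) ^ 2) := by
  have hn : 0 < ‖x‖ := norm_pos_iff.2 h0
  have h1 : tensorNorm cylinderMetric (bilinTensor h - bilinTensor cylinderMetric) x < ε :=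
    hc 0 (Nat.zero_le _) x hx
  rw [tensorNorm_cylinderMetric _ h0, Real.sqrt_mul (by positivity),
    Real.sqrt_sq (by positivity)] at h1
  have h2 := abs_bilin_le (h x - cylinderMetric x) v
  have h3 : (h x - cylinderMetric x) v v = h x v v - 6 * (‖v‖ / ‖x‖) ^ 2 := by
    simp only [sub_apply, cylinderMetric_apply h0, real_inner_self_eq_norm_sq]
    ring
  rw [h3] at h2
  refine h2.trans ?_
  have h4 : √(∑ I : Fin 2 → Fin 4, (h x - cylinderMetric x) (basisVec (I 0)) (basisVec (I 1)) ^ 2)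
      = √(∑ I, (bilinTensor h - bilinTensor cylinderMetric) x I ^ 2) := by
    simp [bilinTensor]
  rw [h4]
  calc _ = (‖x‖ ^ 2 / 6 * √(∑ I, (bilinTensor h - bilinTensor cylinderMetric) x I ^ 2))
        * (6 * (‖v‖ / ‖x‖) ^ 2) := by field_simp
    _ ≤ _ := by gcongr

/-! ### Curves on the cylinder -/

open InnerProductGeometry in
lemma two_mul_sin_half_angle {V : Type*} [NormedAddCommGroup V] [InnerProductSpace ℝ V]
    {u v : V} (hu : ‖u‖ = 1) (hv : ‖v‖ = 1) : 2 * Real.sin (angle u v / 2) = ‖u - v‖ := by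
  have h1 : Real.cos (angle u v) = inner ℝ u v := by
    rw [cos_angle, hu, hv]; simp
  have h2 : ‖u - v‖ ^ 2 = 2 - 2 * inner ℝ u v := by
    rw [norm_sub_sq_real, hu, hv]; ring
  have h3 : (2 * Real.sin (angle u v / 2)) ^ 2 = ‖u - v‖ ^ 2 := by
    rw [h2, ← h1, mul_pow, Real.sin_sq_eq_half_sub]
    ring_nf
  refine (pow_left_inj₀ ?_ (norm_nonneg _) two_ne_zero).1 h3
  have := Real.sin_nonneg_of_nonneg_of_le_pi (x := angle u v / 2)
    (by linarith [angle_nonneg u v]) (by linarith [angle_le_pi u v, Real.pi_pos])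
  linarith

open InnerProductGeometry in
/-- The length of a curve in the unit sphere bounds the angle between its endpoints. -/
lemma angle_le_of_lipschitz {V : Type*} [NormedAddCommGroup V] [InnerProductSpace ℝ V]
    {u : ℝ → V} {s : Set ℝ} (hs : Convex ℝ s) (h1 : ∀ t ∈ s, ‖u t‖ = 1) {N : ℝ}
    (hN : ∀ t ∈ s, ∀ t' ∈ s, ‖u t - u t'‖ ≤ N * |t - t'|) {a b : ℝ} (ha : a ∈ s) (hb : b ∈ s) :
    angle (u a) (u b) ≤ N * |a - b| := by
  set d := N * |a - b| with hd
  have hd0 : 0 ≤ d := (norm_nonneg _).trans (hN a ha b hb)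
  -- The chord is `2 sin (θ / 2)`, so arc and chord differ by a cubic error. Jordan's inequality
  -- with π < 4 first gives `θ ≤ 2 * chord`, which bounds that error by the chord.
  have hstep : ∀ t ∈ s, ∀ t' ∈ s, angle (u t) (u t')
      ≤ N * |t - t'| + (2 * (N * |t - t'|)) ^ 3 / 16 := by
    intro t ht t' ht'
    set θ := angle (u t) (u t') with hθ
    have e1 := two_mul_sin_half_angle (h1 t ht) (h1 t' ht')
    rw [← hθ] at e1
    have e2 := hN t ht t' ht'
    have hθ0 : 0 ≤ θ := angle_nonneg _ _
    have hθπ : θ ≤ Real.pi := angle_le_pi _ _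
    have e3 : θ ≤ 2 * (N * |t - t'|) := by
      have := Real.mul_le_sin (x := θ / 2) (by linarith) (by linarith)
      have hp : 2 / Real.pi * (θ / 2) = θ / Real.pi := by ring
      rw [hp] at this
      have h5 : θ / 4 ≤ θ / Real.pi := by
        apply div_le_div_of_nonneg_left hθ0 Real.pi_pos
        linarith [Real.pi_lt_four]
      linarith
    have e4 : θ / 2 - (θ / 2) ^ 3 / 4 ≤ Real.sin (θ / 2) := by
      rcases hθ0.eq_or_lt with h | h
      · rw [← h]; simp
      · have := Real.sin_gt_sub_cube (x := θ / 2) (by linarith)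
        nlinarith [pow_pos h 3]
    have e5 : θ ^ 3 ≤ (2 * (N * |t - t'|)) ^ 3 := pow_le_pow_left₀ hθ0 e3 3
    nlinarith
  -- With `n` equal subdivisions the cubic errors add up to O(1/n²) and vanish in the limit.
  have hmain : ∀ n : ℕ, 0 < n → angle (u a) (u b) ≤ d + (2 * d) ^ 3 / 16 / n := by
    intro n hn
    have hn' : (0 : ℝ) < n := by exact_mod_cast hn
    set p : ℕ → ℝ := fun k => a + (k / n) * (b - a) with hp
    have hps : ∀ k ≤ n, p k ∈ s := by
      intro k hk
      have hk' : (k : ℝ) ≤ n := by exact_mod_cast hk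
      have := hs.add_smul_sub_mem ha hb (t := k / n) ⟨by positivity, by
        rw [div_le_one hn']; exact hk'⟩
      simpa [hp] using this
    have hind : ∀ k ≤ n, angle (u a) (u (p k)) ≤ k * (d / n + (2 * (d / n)) ^ 3 / 16) := by
      intro k
      induction k with
      | zero =>
        intro _
        have : p 0 = a := by simp [hp]
        rw [this, angle_self]
        · simp
        · rw [← norm_ne_zero_iff, h1 a ha]; exact one_ne_zero
      | succ k ih =>
        intro hk
        have t1 := angle_le_angle_add_angle (u a) (u (p k)) (u (p (k + 1)))
        have t2 := hstep _ (hps k (by omega)) _ (hps (k + 1) hk)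
        have t3 : N * |p k - p (k + 1)| = d / n := by
          have : p k - p (k + 1) = (a - b) / n := by
            simp only [hp]; push_cast; field_simp; ring
          rw [this, abs_div, abs_of_pos hn', hd]; ring
        rw [t3] at t2
        have := ih (by omega)
        push_cast
        linarith
    have h2 := hind n le_rfl
    have hpn : p n = b := by
      simp only [hp]; rw [div_self hn'.ne']; ring
    rw [hpn] at h2
    have h3 : n * (d / n + (2 * (d / n)) ^ 3 / 16) = d + (2 * d) ^ 3 / 16 / n ^ 2 := by
      field_simp
    rw [h3] at h2
    have h4 : (2 * d) ^ 3 / 16 / (n : ℝ) ^ 2 ≤ (2 * d) ^ 3 / 16 / n := by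
      have : (1 : ℝ) ≤ n := by exact_mod_cast hn
      apply div_le_div_of_nonneg_left (by positivity) hn'
      nlinarith
    linarith
  have hlim : Tendsto (fun n : ℕ => d + (2 * d) ^ 3 / 16 / (n : ℝ)) atTop (𝓝 (d + 0)) :=
    tendsto_const_nhds.add (tendsto_const_div_atTop_nhds_zero_nat _)
  rw [add_zero] at hlim
  refine ge_of_tendsto hlim ?_
  filter_upwards [eventually_gt_atTop 0] with n hn using hmain n hn

lemma norm_fderiv_radial_le {x : E 4} (hx : x ≠ 0) (v : E 4) :
    ‖fderiv ℝ radial x v‖ ≤ ‖v‖ / ‖x‖ := by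
  have hn : 0 < ‖x‖ := norm_pos_iff.2 hx
  have h : ‖fderiv ℝ radial x v‖ ^ 2 ≤ (‖v‖ / ‖x‖) ^ 2 := by
    have h1 := cylinderMetric_apply hx v v
    have h2 : cylinderMetric x v v = 6 * inner ℝ (fderiv ℝ radial x v) (fderiv ℝ radial x v)
      + fderiv ℝ axial x v * fderiv ℝ axial x v := rfl
    rw [h2, real_inner_self_eq_norm_sq, real_inner_self_eq_norm_sq] at h1
    have h3 : (‖v‖ / ‖x‖) ^ 2 = 6 / ‖x‖ ^ 2 * ‖v‖ ^ 2 / 6 := by field_simp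
    rw [h3]
    nlinarith [mul_self_nonneg (fderiv ℝ axial x v)]
  exact (pow_le_pow_iff_left₀ (norm_nonneg _) (by positivity) two_ne_zero).1 h

lemma abs_fderiv_axial_le {x : E 4} (hx : x ≠ 0) (v : E 4) :
    |fderiv ℝ axial x v| ≤ √6 * (‖v‖ / ‖x‖) := by
  have hn : 0 < ‖x‖ := norm_pos_iff.2 hx
  rw [(hasFDerivAt_axial hx).fderiv]
  simp only [smul_apply, innerSL_apply_apply, smul_eq_mul, abs_mul]
  rw [abs_of_nonneg (by positivity : 0 ≤ √6), abs_of_nonneg (by positivity : 0 ≤ (‖x‖ ^ 2)⁻¹)]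
  calc √6 * (‖x‖ ^ 2)⁻¹ * |inner ℝ x v| ≤ √6 * (‖x‖ ^ 2)⁻¹ * (‖x‖ * ‖v‖) := by
        gcongr; exact abs_real_inner_le_norm x v
    _ = _ := by field_simp

section curve

variable {c c' : ℝ → E 4} {s : Set ℝ} {M : ℝ}

lemma abs_axial_sub_le (hs : Convex ℝ s) (hc : ∀ t ∈ s, HasDerivWithinAt c (c' t) s t)
    (h0 : ∀ t ∈ s, c t ≠ 0) (hb : ∀ t ∈ s, √6 * (‖c' t‖ / ‖c t‖) ≤ M) {a b : ℝ}
    (ha : a ∈ s) (hb' : b ∈ s) : |axial (c b) - axial (c a)| ≤ M * |b - a| := by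
  have h := hs.norm_image_sub_le_of_norm_hasDerivWithin_le (f := fun t => axial (c t))
    (f' := fun t => fderiv ℝ axial (c t) (c' t)) (C := M) (fun t ht => by
      have := (hasFDerivAt_axial (h0 t ht)).differentiableAt.hasFDerivAt
      exact this.comp_hasDerivWithinAt t (hc t ht)) (fun t ht =>
        (abs_fderiv_axial_le (h0 t ht) _).trans (hb t ht)) ha hb'
  simpa [Real.norm_eq_abs] using h

/-- The radial projection of the curve moves on the unit sphere at speed at most `M / √6`, because
the sphere factor of the cylinder has radius √6. -/
lemma angle_curve_le (hs : Convex ℝ s) (hc : ∀ t ∈ s, HasDerivWithinAt c (c' t) s t)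
    (h0 : ∀ t ∈ s, c t ≠ 0) (hb : ∀ t ∈ s, √6 * (‖c' t‖ / ‖c t‖) ≤ M) {a b : ℝ}
    (ha : a ∈ s) (hb' : b ∈ s) :
    √6 * InnerProductGeometry.angle (c a) (c b) ≤ M * |a - b| := by
  have h6 : 0 < √6 := by positivity
  have h := fun (x : ℝ) (hx : x ∈ s) (y : ℝ) (hy : y ∈ s) =>
    hs.norm_image_sub_le_of_norm_hasDerivWithin_le (f := fun t => radial (c t))
    (f' := fun t => fderiv ℝ radial (c t) (c' t)) (C := M / √6) (fun t ht => by
      have := (hasFDerivAt_radial (h0 t ht)).differentiableAt.hasFDerivAt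
      exact this.comp_hasDerivWithinAt t (hc t ht)) (fun t ht => by
        refine (norm_fderiv_radial_le (h0 t ht) _).trans ?_
        rw [le_div_iff₀ h6, mul_comm]
        exact hb t ht) hy hx
  have h2 := angle_le_of_lipschitz (u := fun t => radial (c t)) hs (fun t ht => by
    simpa using radial_mem (h0 t ht)) h ha hb'
  have h3 : ∀ t ∈ s, 0 < ‖c t‖⁻¹ := fun t ht => inv_pos.2 (norm_pos_iff.2 (h0 t ht))
  simp only [radial] at h2
  rw [InnerProductGeometry.angle_smul_left_of_pos _ _ (h3 a ha),
    InnerProductGeometry.angle_smul_right_of_pos _ _ (h3 b hb')] at h2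
  calc _ ≤ √6 * (M / √6 * |a - b|) := by gcongr
    _ = _ := by field_simp

end curve

/-! ### Geodesics of the cylinder -/

/-- The distance of the standard metric of the cylinder. -/
def cylinderDist (x y : E 4) : ℝ :=
  √(6 * InnerProductGeometry.angle x y ^ 2 + (axial y - axial x) ^ 2)

lemma cylinderDist_nonneg (x y : E 4) : 0 ≤ cylinderDist x y := Real.sqrt_nonneg _

lemma exists_norm_eq_one_inner_eq_zero (u : E 4) : ∃ w : E 4, ‖w‖ = 1 ∧ inner ℝ u w = 0 := by
  have : Nontrivial (ℝ ∙ u)ᗮ := by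
    rw [Submodule.nontrivial_iff_ne_bot, Ne, Submodule.orthogonal_eq_bot_iff]
    intro h
    have h1 := finrank_span_le_card (R := ℝ) ({u} : Set (E 4))
    rw [h, finrank_top] at h1
    simp at h1
  obtain ⟨w, hw⟩ := exists_norm_eq (ℝ ∙ u)ᗮ (zero_le_one' ℝ)
  exact ⟨w, hw, Submodule.mem_orthogonal_singleton_iff_inner_right.1 w.2⟩

open InnerProductGeometry in
lemma exists_orthonormal_angle {u v : E 4} (hu : ‖u‖ = 1) (hv : ‖v‖ = 1) :
    ∃ w : E 4, ‖w‖ = 1 ∧ inner ℝ u w = 0 ∧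
      v = Real.cos (angle u v) • u + Real.sin (angle u v) • w := by
  have h1 : inner ℝ u v = Real.cos (angle u v) := by rw [cos_angle, hu, hv]; simp
  have h2 : ‖v - Real.cos (angle u v) • u‖ ^ 2 = Real.sin (angle u v) ^ 2 := by
    rw [norm_sub_sq_real, norm_smul, inner_smul_right, real_inner_comm, h1, hu, hv,
      Real.sin_sq, Real.norm_eq_abs, mul_one, sq_abs]
    ring
  have h3 := sin_angle_nonneg u v
  rw [pow_left_inj₀ (norm_nonneg _) h3 two_ne_zero] at h2
  rcases h3.eq_or_lt with h | h
  · obtain ⟨w, hw1, hw2⟩ := exists_norm_eq_one_inner_eq_zero u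
    refine ⟨w, hw1, hw2, ?_⟩
    rw [← h, norm_eq_zero, sub_eq_zero] at h2
    rw [← h, zero_smul, add_zero]
    exact h2
  · refine ⟨(Real.sin (angle u v))⁻¹ • (v - Real.cos (angle u v) • u), ?_, ?_, ?_⟩
    · rw [norm_smul, h2, Real.norm_eq_abs, abs_of_pos (inv_pos.2 h), inv_mul_cancel₀ h.ne']
    · rw [inner_smul_right, inner_sub_right, inner_smul_right, h1, real_inner_self_eq_norm_sq, hu]
      simp
    · rw [smul_smul, mul_inv_cancel₀ h.ne', one_smul]; abel

/-- Two points of the cylinder are joined by a geodesic of length `cylinderDist x y`. -/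
lemma exists_geodesic {x y : E 4} (hx : x ≠ 0) (hy : y ≠ 0) :
    ∃ c c' : ℝ → E 4, (∀ t, HasDerivAt c (c' t) t) ∧ c 0 = x ∧ c 1 = y ∧ (∀ t, c t ≠ 0) ∧
      (∀ t, √6 * (‖c' t‖ / ‖c t‖) = cylinderDist x y) ∧
      ∀ t, axial (c t) = axial x + t * (axial y - axial x) := by
  have hx1 : ‖radial x‖ = 1 := by simpa using radial_mem hx
  have hy1 : ‖radial y‖ = 1 := by simpa using radial_mem hy
  obtain ⟨w, hw, huw, hv⟩ := exists_orthonormal_angle hx1 hy1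
  have h3 : ∀ z : E 4, z ≠ 0 → 0 < ‖z‖⁻¹ := fun z hz => inv_pos.2 (norm_pos_iff.2 hz)
  have hang : InnerProductGeometry.angle (radial x) (radial y) = InnerProductGeometry.angle x y := by
    rw [radial, radial, InnerProductGeometry.angle_smul_left_of_pos _ _ (h3 x hx),
    InnerProductGeometry.angle_smul_right_of_pos _ _ (h3 y hy)]
  rw [hang] at hv
  set θ := InnerProductGeometry.angle x y with hθ
  set Δ := axial y - axial x with hΔ
  set u := radial x with hu
  -- The geodesic is `σ t • p t`: the logarithm of the radius is affine in `t`, while `p` runs along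
  -- a great circle at constant speed `θ`, with `q` its unit tangent.
  set σ : ℝ → ℝ := fun t => Real.exp ((axial x + t * Δ) / √6) with hσ
  set p : ℝ → E 4 := fun t => Real.cos (θ * t) • u + Real.sin (θ * t) • w with hp
  set q : ℝ → E 4 := fun t => Real.cos (θ * t) • w - Real.sin (θ * t) • u with hq
  have h6 : 0 < √6 := by positivity
  have hwu : inner ℝ w u = 0 := by rw [real_inner_comm, huw]
  have hpn : ∀ t, ‖p t‖ ^ 2 = 1 := by
    intro t
    simp only [hp]
    rw [norm_add_sq_real, norm_smul, norm_smul, inner_smul_left, inner_smul_right, huw, hx1, hw]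
    simp
  have hpq : ∀ t, inner ℝ (p t) (q t) = 0 := by
    intro t
    simp only [hp, hq]
    simp only [inner_add_left, inner_sub_right, inner_smul_left, inner_smul_right, huw, hwu,
      real_inner_self_eq_norm_sq, hx1, hw]
    simp; ring
  have hqn : ∀ t, ‖q t‖ ^ 2 = 1 := by
    intro t
    simp only [hq]
    rw [norm_sub_sq_real, norm_smul, norm_smul, inner_smul_left, inner_smul_right, hwu, hx1, hw]
    simp
  have hp1 : ∀ t, ‖p t‖ = 1 := fun t => by
    rw [← pow_left_inj₀ (norm_nonneg _) zero_le_one two_ne_zero, hpn, one_pow]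
  have hσ0 : ∀ t, 0 < σ t := fun t => Real.exp_pos _
  have hpd : ∀ t, HasDerivAt p (θ • q t) t := by
    intro t
    have e0 : HasDerivAt (fun t : ℝ => θ * t) θ t := by
      simpa using (hasDerivAt_id t).const_mul θ
    have e1 := (e0.cos.smul_const u).add (e0.sin.smul_const w)
    refine e1.congr_deriv ?_
    simp only [hq]
    module
  have hσd : ∀ t, HasDerivAt σ (σ t * (Δ / √6)) t := by
    intro t
    have e0 : HasDerivAt (fun t : ℝ => (axial x + t * Δ) / √6) (Δ / √6) t := by
      simpa using (((hasDerivAt_id t).mul_const Δ).const_add (axial x)).div_const √6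
    exact e0.exp
  have hcn : ∀ t, ‖σ t • p t‖ = σ t := fun t => by
    rw [norm_smul, hp1, mul_one, Real.norm_eq_abs, abs_of_pos (hσ0 t)]
  have hax : ∀ t, axial (σ t • p t) = axial x + t * Δ := fun t => by
    rw [axial, hcn, hσ, Real.log_exp]; field_simp
  have hpolar : ∀ {z : E 4}, z ≠ 0 → Real.exp (axial z / √6) • radial z = z :=
    fun hz => unpolar_polar hz
  refine ⟨fun t => σ t • p t, fun t => σ t • ((Δ / √6) • p t + θ • q t), ?_, ?_, ?_, ?_, ?_, hax⟩
  · intro t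
    refine ((hσd t).smul (hpd t)).congr_deriv ?_
    module
  · have : p 0 = u := by simp [hp]
    simp only [this, hσ, zero_mul, add_zero]
    exact hpolar hx
  · have : p 1 = radial y := by simp only [hp, mul_one]; exact hv.symm
    simp only [this, hσ, one_mul, hΔ]
    rw [add_sub_cancel]
    exact hpolar hy
  · intro t
    rw [← norm_ne_zero_iff, hcn]; exact (hσ0 t).ne'
  · intro t
    have e1 : ‖(Δ / √6) • p t + θ • q t‖ ^ 2 = (Δ / √6) ^ 2 + θ ^ 2 := by
      rw [norm_add_sq_real, norm_smul, norm_smul, inner_smul_left, inner_smul_right, hpq,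
        mul_pow, mul_pow, hpn, hqn, Real.norm_eq_abs, Real.norm_eq_abs, sq_abs, sq_abs]
      simp
    rw [hcn, norm_smul, Real.norm_eq_abs, abs_of_pos (hσ0 t), mul_div_cancel_left₀ _ (hσ0 t).ne',
      cylinderDist, ← Real.sqrt_sq (norm_nonneg ((Δ / √6) • p t + θ • q t)), e1,
      ← Real.sqrt_mul (by norm_num)]
    congr 1
    rw [div_pow, Real.sq_sqrt (by norm_num)]
    ring

/-! ### Overlapping necks -/

/-- A local diffeomorphism of `ℝ⁴ ∖ {0}` whose graph lies in the relation `rel`, and which stretches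
the cylinder metric by a factor at most `ρ`, while its inverse stretches it by at most `ρ'`. -/
structure IsCylinderLift (rel : E 4 → E 4 → Prop) (ρ ρ' : ℝ)
    (e : OpenPartialHomeomorph (E 4) (E 4)) : Prop where
  rel_map : ∀ w ∈ e.source, rel w (e w)
  smooth : ContDiffOn ℝ 1 e e.source
  smooth_symm : ContDiffOn ℝ 1 e.symm e.target
  bound : ∀ w ∈ e.source, ∀ v, ‖fderiv ℝ e w v‖ / ‖e w‖ ≤ ρ * (‖v‖ / ‖w‖)
  bound_symm : ∀ w ∈ e.target, ∀ v, ‖fderiv ℝ e.symm w v‖ / ‖e.symm w‖ ≤ ρ' * (‖v‖ / ‖w‖)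

/-- The relation "`x` and `y` parametrize the same point" between the uniformizing annuli of two
cylinders over spherical space forms that are embedded in the same orbifold. -/
structure IsOverlap (Γ Γ' : Subgroup O4) (L ρ ρ' : ℝ) (rel : E 4 → E 4 → Prop) : Prop where
  left_mem : ∀ {x y}, rel x y → x ∈ annulus L
  right_mem : ∀ {x y}, rel x y → y ∈ annulus L
  smul_left : ∀ {x y}, rel x y → ∀ γ ∈ Γ, rel (γ x) y
  smul_right : ∀ {x y}, rel x y → ∀ γ ∈ Γ', rel x (γ y)
  orbit_left : ∀ {x x' y}, rel x y → rel x' y → ∃ γ ∈ Γ, γ x = x'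
  orbit_right : ∀ {x y y'}, rel x y → rel x y' → ∃ γ ∈ Γ', γ y = y'
  closed : ∀ x ∈ annulus L, ∀ y ∈ annulus L,
    (x, y) ∈ closure {p : E 4 × E 4 | rel p.1 p.2} → rel x y
  exists_lift : ∀ {x y}, rel x y → ∃ e, IsCylinderLift rel ρ ρ' e ∧ x ∈ e.source ∧ e x = y

lemma IsCylinderLift.symm {rel : E 4 → E 4 → Prop} {ρ ρ' : ℝ}
    {e : OpenPartialHomeomorph (E 4) (E 4)} (he : IsCylinderLift rel ρ ρ' e) :
    IsCylinderLift (fun x y => rel y x) ρ' ρ e.symm where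
  rel_map w hw := by
    have := he.rel_map _ (e.map_target hw)
    rwa [e.right_inv hw] at this
  smooth := he.smooth_symm
  smooth_symm := he.smooth
  bound := he.bound_symm
  bound_symm := he.bound

lemma IsOverlap.symm {Γ Γ' : Subgroup O4} {L ρ ρ' : ℝ} {rel : E 4 → E 4 → Prop}
    (h : IsOverlap Γ Γ' L ρ ρ' rel) : IsOverlap Γ' Γ L ρ' ρ (fun x y => rel y x) where
  left_mem := h.right_mem
  right_mem := h.left_mem
  smul_left := h.smul_right
  smul_right := h.smul_left
  orbit_left := h.orbit_right
  orbit_right := h.orbit_left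
  closed x hx y hy hxy := by
    refine h.closed y hy x hx ?_
    exact map_mem_closure (f := Prod.swap) (t := {p : E 4 × E 4 | rel p.1 p.2})
      continuous_swap hxy (fun p hp => hp)
  exists_lift {x y} hxy := by
    obtain ⟨e, he, hx, hey⟩ := h.exists_lift hxy
    refine ⟨e.symm, he.symm, ?_, ?_⟩
    · rw [← hey]; exact e.map_source hx
    · rw [← hey]; exact e.left_inv hx

lemma cylinderChart_eq_iff (Γ : Subgroup O4) [Finite Γ] {L : ℝ} (x y : annulus L) :
    (cylinderChart Γ L).toFun x = (cylinderChart Γ L).toFun y ↔ ∃ γ ∈ Γ, γ (x : E 4) = y := by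
  rw [(cylinderChart Γ L).toFun_eq_iff x y]
  constructor
  · rintro ⟨γ, h⟩
    exact ⟨(show Γ from γ), (show Γ from γ).2, h⟩
  · rintro ⟨γ, hγ, h⟩
    exact ⟨(⟨γ, hγ⟩ : Γ), h⟩

lemma fderiv_trans_symm_apply {e₁ e₂ : OpenPartialHomeomorph (E 4) (E 4)}
    (h₁ : ContDiffOn ℝ 1 e₁ e₁.source) (h₂ : ContDiffOn ℝ 1 e₂ e₂.source)
    (h₂' : ContDiffOn ℝ 1 e₂.symm e₂.target) {w : E 4} (hw : w ∈ (e₁.trans e₂.symm).source)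
    (v : E 4) : fderiv ℝ e₂ (e₁.trans e₂.symm w) (fderiv ℝ (e₁.trans e₂.symm) w v)
      = fderiv ℝ e₁ w v := by
  have hw' : w ∈ e₁.source ∧ e₁ w ∈ e₂.target := by simpa using hw
  have hm : e₁.trans e₂.symm w ∈ e₂.source := e₂.map_target hw'.2
  have hd1 : DifferentiableAt ℝ e₁ w :=
    (h₁.contDiffAt (e₁.open_source.mem_nhds hw'.1)).differentiableAt one_ne_zero
  have hd2 : DifferentiableAt ℝ e₂ (e₁.trans e₂.symm w) :=
    (h₂.contDiffAt (e₂.open_source.mem_nhds hm)).differentiableAt one_ne_zero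
  have hd2' : DifferentiableAt ℝ e₂.symm (e₁ w) :=
    (h₂'.contDiffAt (e₂.open_target.mem_nhds hw'.2)).differentiableAt one_ne_zero
  have hd : DifferentiableAt ℝ (e₁.trans e₂.symm) w := hd2'.comp w hd1
  have hc : (e₂ ∘ (e₁.trans e₂.symm)) =ᶠ[𝓝 w] e₁ := by
    filter_upwards [(e₁.trans e₂.symm).open_source.mem_nhds hw] with z hz
    have hz' : z ∈ e₁.source ∧ e₁ z ∈ e₂.target := by simpa using hz
    exact e₂.right_inv hz'.2
  rw [← hc.fderiv_eq, fderiv_comp w hd2 hd]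
  rfl

/-- `ψ₂⁻¹ ∘ ψ₁` distorts the standard metric by about `R₂ / R₁`. -/
lemma norm_fderiv_trans_le {X : Type*} [TopologicalSpace X] {A : OrbifoldAtlas 4 X}
    {g : OrbifoldMetric A} {Γ₁ Γ₂ : Subgroup O4} [Finite Γ₁] [Finite Γ₂] {L ε R₁ R₂ : ℝ}
    (hε0 : 0 < ε) (hε : ε < 1) (hR₁ : 0 < R₁) (hR₂ : 0 < R₂)
    {ψ₁ : Cylinder Γ₁ L → X} {ψ₂ : Cylinder Γ₂ L → X}
    {h₁ : OrbifoldMetric (cylinderAtlas Γ₁ L)} {h₂ : OrbifoldMetric (cylinderAtlas Γ₂ L)}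
    (hp₁ : IsPullbackMetric ψ₁ g h₁) (hp₂ : IsPullbackMetric ψ₂ g h₂)
    (hb₁ : ∀ x ∈ annulus L, ∀ v, |R₁ * h₁.form (cylinderChart Γ₁ L) x v v
      - 6 * (‖v‖ / ‖x‖) ^ 2| ≤ ε * (6 * (‖v‖ / ‖x‖) ^ 2))
    (hb₂ : ∀ x ∈ annulus L, ∀ v, |R₂ * h₂.form (cylinderChart Γ₂ L) x v v
      - 6 * (‖v‖ / ‖x‖) ^ 2| ≤ ε * (6 * (‖v‖ / ‖x‖) ^ 2))
    {d : OrbifoldChart 4 X} (hd : d ∈ A.charts) {e₁ e₂ : OpenPartialHomeomorph (E 4) (E 4)}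
    (he₁ : IsLocalLift (cylinderChart Γ₁ L) d ψ₁ e₁)
    (he₂ : IsLocalLift (cylinderChart Γ₂ L) d ψ₂ e₂)
    {w : E 4} (hw : w ∈ (e₁.trans e₂.symm).source) (v : E 4) :
    ‖fderiv ℝ (e₁.trans e₂.symm) w v‖ / ‖e₁.trans e₂.symm w‖
      ≤ √((1 + ε) / (1 - ε)) * √(R₂ / R₁) * (‖v‖ / ‖w‖) := by
  have hw' : w ∈ e₁.source ∧ e₁ w ∈ e₂.target := by simpa using hw
  have hm : e₁.trans e₂.symm w ∈ e₂.source := e₂.map_target hw'.2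
  have key := fderiv_trans_symm_apply (he₁.smooth.of_le (by norm_num))
    (he₂.smooth.of_le (by norm_num)) (he₂.smooth_symm.of_le (by norm_num)) hw v
  have hwa : w ∈ annulus L := he₁.source_subset hw'.1
  have hma : e₁.trans e₂.symm w ∈ annulus L := he₂.source_subset hm
  have q₁ := hp₁ (cylinderChart Γ₁ L) rfl d hd e₁ he₁ w hw'.1 v v
  have q₂ := hp₂ (cylinderChart Γ₂ L) rfl d hd e₂ he₂ _ hm
    (fderiv ℝ (e₁.trans e₂.symm) w v) (fderiv ℝ (e₁.trans e₂.symm) w v)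
  have hinv : e₂ (e₁.trans e₂.symm w) = e₁ w := e₂.right_inv hw'.2
  -- Both pulled back metrics now express the length of the same vector in the chart `d`, so the two
  -- closeness estimates can be compared through the number `a`.
  rw [key, hinv, ← q₁] at q₂
  have b₁ := (abs_le.1 (hb₁ w hwa v)).2
  have b₂ := (abs_le.1 (hb₂ _ hma (fderiv ℝ (e₁.trans e₂.symm) w v))).1
  rw [q₂] at b₂
  set a := h₁.form (cylinderChart Γ₁ L) w v v
  set p := ‖fderiv ℝ (e₁.trans e₂.symm) w v‖ / ‖e₁.trans e₂.symm w‖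
  set q := ‖v‖ / ‖w‖
  have hp : 0 ≤ p := by positivity
  have hq : 0 ≤ q := by positivity
  have h1ε : 0 < 1 - ε := by linarith
  rw [← pow_le_pow_iff_left₀ hp (by positivity) two_ne_zero, mul_pow, mul_pow,
    Real.sq_sqrt (by positivity), Real.sq_sqrt (by positivity), div_mul_div_comm,
    div_mul_eq_mul_div, le_div_iff₀ (by positivity)]
  have c₁ : R₂ * (R₁ * a) ≤ R₂ * ((1 + ε) * (6 * q ^ 2)) :=
    mul_le_mul_of_nonneg_left (by linarith) hR₂.le
  have c₂ : R₁ * ((1 - ε) * (6 * p ^ 2)) ≤ R₁ * (R₂ * a) :=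
    mul_le_mul_of_nonneg_left (by linarith) hR₁.le
  linarith

/-- Positivity of the scalar curvature at the centre is forced: otherwise `R • h` would be
nonpositive, yet it is within a factor `1 - ε > 0` of a positive metric. -/
lemma pos_of_isCkClose {Γ : Subgroup O4} [Finite Γ] {L R ε : ℝ} (hL : 0 < L) (hε : ε < 1)
    {h : OrbifoldMetric (cylinderAtlas Γ L)}
    (hb : ∀ x ∈ annulus L, ∀ v, |R * h.form (cylinderChart Γ L) x v v
      - 6 * (‖v‖ / ‖x‖) ^ 2| ≤ ε * (6 * (‖v‖ / ‖x‖) ^ 2)) : 0 < R := by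
  have hx : ∃ x : E 4, ‖x‖ = 1 := ⟨basisVec 0, by simp [basisVec]⟩
  obtain ⟨x, hx⟩ := hx
  have hx0 : x ≠ 0 := by rw [← norm_ne_zero_iff, hx]; exact one_ne_zero
  have hxa : x ∈ annulus L := ⟨hx0, by rw [axial, hx]; simpa using hL⟩
  have h1 := (abs_le.1 (hb x hxa x)).1
  have h2 := h.pos (cylinderChart Γ L) rfl x hxa x hx0
  rw [hx] at h1
  by_contra hR
  have : R * h.form (cylinderChart Γ L) x x x ≤ 0 :=
    mul_nonpos_of_nonpos_of_nonneg (not_lt.1 hR) h2.le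
  norm_num at h1
  linarith

/-- Passage from orbifolds to ℝ⁴. Injectivity of the two embeddings gives the orbit properties, and
local lifts of `ψ₂⁻¹ ∘ ψ₁` are obtained by composing lifts of `ψ₁` and `ψ₂` to a common chart of the
orbifold. -/
theorem exists_isOverlap_of_isNeck {X : Type*} [TopologicalSpace X] [T2Space X]
    {A : OrbifoldAtlas 4 X} {g : OrbifoldMetric A} {ε : ℝ} (hε0 : 0 < ε) (hε : ε < 1)
    {Γ₁ Γ₂ : Subgroup O4} [Finite Γ₁] [Finite Γ₂]
    {ψ₁ : Cylinder Γ₁ ε⁻¹ → X} {ψ₂ : Cylinder Γ₂ ε⁻¹ → X}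
    (H₁ : IsNeck g ε Γ₁ ψ₁) (H₂ : IsNeck g ε Γ₂ ψ₂) :
    ∃ μ : ℝ, 0 < μ ∧ IsOverlap Γ₁ Γ₂ ε⁻¹ (√((1 + ε) / (1 - ε)) * μ) (√((1 + ε) / (1 - ε)) * μ⁻¹)
      (fun x y => ∃ (hx : x ∈ annulus ε⁻¹) (hy : y ∈ annulus ε⁻¹),
        ψ₁ ((cylinderChart Γ₁ ε⁻¹).toFun ⟨x, hx⟩) = ψ₂ ((cylinderChart Γ₂ ε⁻¹).toFun ⟨y, hy⟩)) := by
  obtain ⟨emb₁, q₁, -, h₁, hp₁, hc₁⟩ := H₁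
  obtain ⟨emb₂, q₂, -, h₂, hp₂, hc₂⟩ := H₂
  set R₁ := g.scalarCurvatureAt (ψ₁ q₁)
  set R₂ := g.scalarCurvatureAt (ψ₂ q₂)
  have hb₁ : ∀ x ∈ annulus ε⁻¹, ∀ v, |R₁ * h₁.form (cylinderChart Γ₁ ε⁻¹) x v v
      - 6 * (‖v‖ / ‖x‖) ^ 2| ≤ ε * (6 * (‖v‖ / ‖x‖) ^ 2) :=
    fun x hx v => abs_sub_le_of_isCkClose hc₁ hx hx.1 v
  have hb₂ : ∀ x ∈ annulus ε⁻¹, ∀ v, |R₂ * h₂.form (cylinderChart Γ₂ ε⁻¹) x v v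
      - 6 * (‖v‖ / ‖x‖) ^ 2| ≤ ε * (6 * (‖v‖ / ‖x‖) ^ 2) :=
    fun x hx v => abs_sub_le_of_isCkClose hc₂ hx hx.1 v
  have hR₁ : 0 < R₁ := pos_of_isCkClose (inv_pos.2 hε0) hε hb₁
  have hR₂ : 0 < R₂ := pos_of_isCkClose (inv_pos.2 hε0) hε hb₂
  -- The metric `g` is about `R₁⁻¹` times the first cylinder metric and `R₂⁻¹` times the second, so
  -- lengths scale by `√(R₂ / R₁)`.
  refine ⟨√(R₂ / R₁), Real.sqrt_pos.2 (div_pos hR₂ hR₁), ?_⟩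
  constructor
  · exact fun h => h.1
  · exact fun h => h.2.1
  · rintro x y ⟨hx, hy, h⟩ γ hγ
    refine ⟨mem_annulus_O4 γ hx, hy, ?_⟩
    rw [← h]
    exact congrArg ψ₁ ((cylinderChart_eq_iff Γ₁ _ _).2 ⟨γ, hγ, rfl⟩).symm
  · rintro x y ⟨hx, hy, h⟩ γ hγ
    refine ⟨hx, mem_annulus_O4 γ hy, ?_⟩
    rw [h]
    exact congrArg ψ₂ ((cylinderChart_eq_iff Γ₂ _ _).2 ⟨γ, hγ, rfl⟩)
  · rintro x x' y ⟨hx, hy, h⟩ ⟨hx', _, h'⟩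
    exact (cylinderChart_eq_iff Γ₁ _ _).1 (emb₁.isOpenEmbedding.injective (h.trans h'.symm))
  · rintro x y y' ⟨hx, hy, h⟩ ⟨_, hy', h'⟩
    exact (cylinderChart_eq_iff Γ₂ _ _).1 (emb₂.isOpenEmbedding.injective (h.symm.trans h'))
  · intro x hx y hy hxy
    refine ⟨hx, hy, ?_⟩
    let f : annulus ε⁻¹ × annulus ε⁻¹ → E 4 × E 4 := Prod.map Subtype.val Subtype.val
    have hf : IsInducing f := IsInducing.subtypeVal.prodMap IsInducing.subtypeVal
    let Z : Set (annulus ε⁻¹ × annulus ε⁻¹) :=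
      {p | ψ₁ ((cylinderChart Γ₁ ε⁻¹).toFun p.1) = ψ₂ ((cylinderChart Γ₂ ε⁻¹).toFun p.2)}
    -- Here the Hausdorff property of the orbifold enters.
    have hZ : IsClosed Z := by
      refine isClosed_eq ?_ ?_
      · exact (emb₁.isOpenEmbedding.continuous.comp (cylinderChart Γ₁ ε⁻¹).continuous_toFun).comp
          continuous_fst
      · exact (emb₂.isOpenEmbedding.continuous.comp (cylinderChart Γ₂ ε⁻¹).continuous_toFun).comp
          continuous_snd
    have hm : ((⟨x, hx⟩, ⟨y, hy⟩) : annulus ε⁻¹ × annulus ε⁻¹) ∈ closure Z := by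
      rw [hf.closure_eq_preimage_closure_image]
      refine closure_mono ?_ hxy
      rintro ⟨a, b⟩ ⟨ha, hb, hab⟩
      exact ⟨(⟨a, ha⟩, ⟨b, hb⟩), hab, rfl⟩
    rw [hZ.closure_eq] at hm
    exact hm
  · rintro x y ⟨hx, hy, h⟩
    obtain ⟨d, hd, z, hz⟩ := A.covers (ψ₁ ((cylinderChart Γ₁ ε⁻¹).toFun ⟨x, hx⟩))
    obtain ⟨e₁, he₁, hx₁, hz₁⟩ := emb₁.lifts (cylinderChart Γ₁ ε⁻¹) rfl d hd ⟨x, hx⟩ z hz.symm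
    obtain ⟨e₂, he₂, hx₂, hz₂⟩ := emb₂.lifts (cylinderChart Γ₂ ε⁻¹) rfl d hd ⟨y, hy⟩ z
      (h.symm.trans hz.symm)
    simp only at hx₁ hz₁ hx₂ hz₂
    have hsrc : ∀ {w}, w ∈ (e₁.trans e₂.symm).source ↔ w ∈ e₁.source ∧ e₁ w ∈ e₂.target := by
      intro w; simp
    have hsymm : (e₁.trans e₂.symm).symm = e₂.trans e₁.symm := by
      rw [OpenPartialHomeomorph.trans_symm_eq_symm_trans_symm, OpenPartialHomeomorph.symm_symm]
    have hsrc' : ∀ {w}, w ∈ (e₁.trans e₂.symm).target ↔ w ∈ e₂.source ∧ e₂ w ∈ e₁.target := by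
      intro w
      rw [← OpenPartialHomeomorph.symm_source, hsymm]; simp
    have hle : (1 : ℕ∞ω) ≤ ∞ := by norm_num
    refine ⟨e₁.trans e₂.symm, ⟨?_, ?_, ?_, ?_, ?_⟩, ?_, ?_⟩
    · intro w hw
      have hm : e₁.trans e₂.symm w ∈ e₂.source := e₂.map_target (hsrc.1 hw).2
      refine ⟨he₁.source_subset (hsrc.1 hw).1, he₂.source_subset hm, ?_⟩
      rw [← he₁.comm w (hsrc.1 hw).1, ← he₂.comm _ hm]
      congr 1
      exact Subtype.ext (e₂.right_inv (hsrc.1 hw).2).symm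
    · exact (he₂.smooth_symm.of_le hle).comp ((he₁.smooth.of_le hle).mono
        fun w hw => (hsrc.1 hw).1) fun w hw => (hsrc.1 hw).2
    · rw [hsymm]
      exact (he₁.smooth_symm.of_le hle).comp ((he₂.smooth.of_le hle).mono
        fun w hw => (hsrc'.1 hw).1) fun w hw => (hsrc'.1 hw).2
    · intro w hw v
      exact norm_fderiv_trans_le hε0 hε hR₁ hR₂ hp₁ hp₂ hb₁ hb₂ hd he₁ he₂ hw v
    · intro w hw v
      rw [hsymm, ← Real.sqrt_inv, inv_div]
      refine norm_fderiv_trans_le hε0 hε hR₂ hR₁ hp₂ hp₁ hb₂ hb₁ hd he₂ he₁ ?_ v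
      rw [← hsymm]; exact hw
    · rw [hsrc, hz₁, ← hz₂]; exact ⟨hx₁, e₂.map_source hx₂⟩
    · change e₂.symm (e₁ x) = y
      rw [hz₁, ← hz₂]; exact e₂.left_inv hx₂

/-! ### Continuation of the overlap along curves -/

lemma isCompact_axial_Icc (α β : ℝ) : IsCompact {y : E 4 | y ≠ 0 ∧ axial y ∈ Icc α β} := by
  have h6 : 0 < √6 := by positivity
  have h : {y : E 4 | y ≠ 0 ∧ axial y ∈ Icc α β}
      = {y : E 4 | Real.exp (α / √6) ≤ ‖y‖} ∩ {y : E 4 | ‖y‖ ≤ Real.exp (β / √6)} := by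
    ext y
    have key : ∀ hy : 0 < ‖y‖, axial y ∈ Icc α β ↔
        Real.exp (α / √6) ≤ ‖y‖ ∧ ‖y‖ ≤ Real.exp (β / √6) := by
      intro hy
      rw [← Real.le_log_iff_exp_le hy, ← Real.log_le_iff_le_exp hy, div_le_iff₀' h6,
        le_div_iff₀' h6]
      rfl
    constructor
    · rintro ⟨h0, h1⟩
      exact (key (norm_pos_iff.2 h0)).1 h1
    · rintro ⟨h1, h2⟩
      have hy : 0 < ‖y‖ := (Real.exp_pos _).trans_le h1
      exact ⟨norm_pos_iff.1 hy, (key hy).2 ⟨h1, h2⟩⟩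
  rw [h]
  refine Metric.isCompact_of_isClosed_isBounded ?_ ?_
  · exact (isClosed_le continuous_const continuous_norm).inter
      (isClosed_le continuous_norm continuous_const)
  · refine (Metric.isBounded_closedBall (x := (0 : E 4)) (r := Real.exp (β / √6))).subset ?_
    intro y hy
    simpa using hy.2

lemma continuousAt_axial {x : E 4} (hx : x ≠ 0) : ContinuousAt axial x :=
  (hasFDerivAt_axial hx).continuousAt

section

variable {Γ Γ' : Subgroup O4} {L ρ ρ' : ℝ} {rel : E 4 → E 4 → Prop}

lemma IsCylinderLift.speed_le {e : OpenPartialHomeomorph (E 4) (E 4)}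
    (he : IsCylinderLift rel ρ ρ' e) (hρ : 0 ≤ ρ) {c : ℝ → E 4} {v : E 4} {t ℓ : ℝ}
    (hc : HasDerivAt c v t) (hv : √6 * (‖v‖ / ‖c t‖) ≤ ℓ) (hs : c t ∈ e.source) :
    HasDerivAt (fun t => e (c t)) (fderiv ℝ e (c t) v) t ∧
      √6 * (‖fderiv ℝ e (c t) v‖ / ‖e (c t)‖) ≤ ρ * ℓ := by
  have hd : DifferentiableAt ℝ e (c t) :=
    (he.smooth.contDiffAt (e.open_source.mem_nhds hs)).differentiableAt one_ne_zero
  refine ⟨hd.hasFDerivAt.comp_hasDerivAt t hc, ?_⟩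
  calc √6 * (‖fderiv ℝ e (c t) v‖ / ‖e (c t)‖) ≤ √6 * (ρ * (‖v‖ / ‖c t‖)) := by
        gcongr; exact he.bound _ hs v
    _ = ρ * (√6 * (‖v‖ / ‖c t‖)) := by ring
    _ ≤ ρ * ℓ := by gcongr

/-- A curve that starts in the overlap of two necks stays there as long as its length does not
allow it to reach an end of the second neck. -/
theorem IsOverlap.exists_rel_of_curve (h : IsOverlap Γ Γ' L ρ ρ' rel) (hρ : 0 ≤ ρ)
    {c c' : ℝ → E 4} {ℓ : ℝ} (hc : ∀ t, HasDerivAt c (c' t) t) (h0 : ∀ t, c t ≠ 0)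
    (hv : ∀ t, √6 * (‖c' t‖ / ‖c t‖) ≤ ℓ) (hin : ∀ t ∈ Icc (0 : ℝ) 1, axial (c t) ∈ Ioo (-L) L)
    {y₀ : E 4} (hy₀ : rel (c 0) y₀) (hlo : -L < axial y₀ - ρ * ℓ) (hhi : axial y₀ + ρ * ℓ < L) :
    ∃ y, rel (c 1) y ∧ |axial y - axial y₀| ≤ ρ * ℓ := by
  have hℓ : 0 ≤ ℓ := le_trans (by positivity) (hv 0)
  have hρℓ : 0 ≤ ρ * ℓ := mul_nonneg hρ hℓ
  have hcc : Continuous c := continuous_iff_continuousAt.2 fun t => (hc t).continuousAt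
  -- Times together with admissible partners. The linear bound on the axial drift keeps the partners
  -- in the compact set `K`, strictly inside the second neck, so the set of reachable times is
  -- closed.
  set Z : Set (ℝ × E 4) := {p | p.1 ∈ Icc (0 : ℝ) 1 ∧ rel (c p.1) p.2 ∧
    |axial p.2 - axial y₀| ≤ ρ * ℓ * p.1} with hZ
  set K : Set (E 4) := {y | y ≠ 0 ∧ axial y ∈ Icc (axial y₀ - ρ * ℓ) (axial y₀ + ρ * ℓ)} with hK
  have hZK : Z ⊆ Icc (0 : ℝ) 1 ×ˢ K := by
    rintro ⟨t, y⟩ ⟨ht, hr, hb⟩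
    have := abs_le.1 hb
    have h1 : ρ * ℓ * t ≤ ρ * ℓ := mul_le_of_le_one_right hρℓ ht.2
    exact ⟨ht, (h.right_mem hr).1, by simp only at this; constructor <;> linarith⟩
  have hcomp : IsCompact (Icc (0 : ℝ) 1 ×ˢ K) := isCompact_Icc.prod (isCompact_axial_Icc _ _)
  have hZc : IsClosed Z := by
    refine isClosed_of_closure_subset ?_
    rintro ⟨t, y⟩ hty
    have hm := closure_minimal hZK hcomp.isClosed hty
    obtain ⟨ht, hy, hyK⟩ := hm
    simp only at ht hy hyK
    refine ⟨ht, ?_, ?_⟩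
    · refine h.closed _ ⟨h0 t, hin t ht⟩ _ ⟨hy, by
        rw [mem_Icc] at hyK; constructor <;> linarith⟩ ?_
      exact map_mem_closure (f := fun p : ℝ × E 4 => (c p.1, p.2))
        (t := {p : E 4 × E 4 | rel p.1 p.2}) (by fun_prop) hty fun p hp => hp.2.1
    · have hca : ContinuousAt (fun p : ℝ × E 4 => axial p.2) (t, y) :=
        ContinuousAt.comp (f := fun p : ℝ × E 4 => p.2) (g := axial) (continuousAt_axial hy)
          continuousAt_snd
      exact ContinuousWithinAt.closure_le (f := fun p : ℝ × E 4 => |axial p.2 - axial y₀|)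
        (g := fun p : ℝ × E 4 => ρ * ℓ * p.1) hty
        (hca.sub continuousAt_const).abs.continuousWithinAt (by fun_prop) fun p hp => hp.2.2
  have hSc : IsClosed (Prod.fst '' Z) :=
    ((hcomp.of_isClosed_subset hZc hZK).image continuous_fst).isClosed
  -- Continuous induction: a local lift at the last reachable point carries a further piece of the
  -- curve across, with the same drift rate.
  have hS : Icc (0 : ℝ) 1 ⊆ Prod.fst '' Z := by
    refine (hSc.inter isClosed_Icc).Icc_subset_of_forall_exists_gt ?_ ?_
    · exact ⟨(0, y₀), ⟨by simp, hy₀, by simp⟩, rfl⟩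
    · rintro t ⟨⟨⟨t', y⟩, ⟨ht, hr, hb⟩, rfl⟩, -, ht1⟩ t₁ ht₁
      simp only [mem_Ioi] at ht hr hb ht1 ht₁ ⊢
      obtain ⟨e, he, hs, hey⟩ := h.exists_lift hr
      obtain ⟨δ, hδ, hball⟩ := Metric.isOpen_iff.1 (e.open_source.preimage hcc) t' hs
      set b := min (t' + δ / 2) (min t₁ 1) with hbdef
      have hb1 : t' < b := by
        rw [hbdef, lt_min_iff, lt_min_iff]; exact ⟨by linarith, ht₁, ht1⟩
      have hb2 : b ≤ t' + δ / 2 := min_le_left _ _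
      have hb3 : b ≤ t₁ := (min_le_right _ _).trans (min_le_left _ _)
      have hb4 : b ≤ 1 := (min_le_right _ _).trans (min_le_right _ _)
      have hsrc : ∀ s ∈ Icc t' b, c s ∈ e.source := by
        intro s hs'
        refine hball ?_
        rw [Metric.mem_ball, Real.dist_eq, abs_lt]
        rw [mem_Icc] at hs'
        constructor <;> linarith
      have hax := abs_axial_sub_le (c := fun t => e (c t))
        (c' := fun t => fderiv ℝ e (c t) (c' t)) (M := ρ * ℓ) (convex_Icc t' b)
        (fun s hs' => (he.speed_le hρ (hc s) (hv s) (hsrc s hs')).1.hasDerivWithinAt)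
        (fun s hs' => (h.right_mem (he.rel_map _ (hsrc s hs'))).1)
        (fun s hs' => (he.speed_le hρ (hc s) (hv s) (hsrc s hs')).2)
        (left_mem_Icc.2 hb1.le) (right_mem_Icc.2 hb1.le)
      rw [hey, abs_of_pos (sub_pos.2 hb1)] at hax
      refine ⟨b, ⟨(b, e (c b)), ⟨⟨by linarith [ht.1], hb4⟩,
        he.rel_map _ (hsrc b (right_mem_Icc.2 hb1.le)), ?_⟩, rfl⟩, hb1, hb3⟩
      simp only
      calc |axial (e (c b)) - axial y₀| ≤ |axial (e (c b)) - axial y| + |axial y - axial y₀| :=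
            abs_sub_le _ _ _
        _ ≤ ρ * ℓ * (b - t') + ρ * ℓ * t' := add_le_add hax hb
        _ = ρ * ℓ * b := by ring
  obtain ⟨⟨t, y⟩, ⟨-, hr, hb⟩, h1⟩ := hS (right_mem_Icc.2 zero_le_one)
  simp only at hr hb h1
  subst h1
  exact ⟨y, hr, by simpa using hb⟩

/-! ### Lifts of the transition map -/

/-- `F` is a lift of the transition map between the two necks on the set `V`. -/
def IsLiftOn (rel : E 4 → E 4 → Prop) (ρ ρ' : ℝ) (F : E 4 → E 4) (V : Set (E 4)) : Prop :=
  ∀ x ∈ V, ∃ e, IsCylinderLift rel ρ ρ' e ∧ x ∈ e.source ∧ F =ᶠ[𝓝 x] e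

variable {F F₁ F₂ : E 4 → E 4} {V W : Set (E 4)} {x : E 4}

lemma IsCylinderLift.isLiftOn {e : OpenPartialHomeomorph (E 4) (E 4)}
    (he : IsCylinderLift rel ρ ρ' e) : IsLiftOn rel ρ ρ' e e.source :=
  fun _ hx => ⟨e, he, hx, EventuallyEq.rfl⟩

lemma IsLiftOn.mono (hF : IsLiftOn rel ρ ρ' F V) (h : W ⊆ V) : IsLiftOn rel ρ ρ' F W :=
  fun x hx => hF x (h hx)

lemma IsLiftOn.congr (hF : IsLiftOn rel ρ ρ' F₁ V) (hV : IsOpen V) (h : EqOn F₂ F₁ V) :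
    IsLiftOn rel ρ ρ' F₂ V := by
  intro x hx
  obtain ⟨e, he, hxe, hFe⟩ := hF x hx
  exact ⟨e, he, hxe, (h.eventuallyEq_of_mem (hV.mem_nhds hx)).trans hFe⟩

lemma IsLiftOn.rel_map (hF : IsLiftOn rel ρ ρ' F V) (hx : x ∈ V) : rel x (F x) := by
  obtain ⟨e, he, hxe, hFe⟩ := hF x hx
  rw [hFe.self_of_nhds]
  exact he.rel_map x hxe

lemma IsLiftOn.contDiffAt (hF : IsLiftOn rel ρ ρ' F V) (hx : x ∈ V) : ContDiffAt ℝ 1 F x := by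
  obtain ⟨e, he, hxe, hFe⟩ := hF x hx
  exact (he.smooth.contDiffAt (e.open_source.mem_nhds hxe)).congr_of_eventuallyEq hFe

lemma IsLiftOn.differentiableAt (hF : IsLiftOn rel ρ ρ' F V) (hx : x ∈ V) :
    DifferentiableAt ℝ F x :=
  (hF.contDiffAt hx).differentiableAt one_ne_zero

lemma IsLiftOn.bound (hF : IsLiftOn rel ρ ρ' F V) (hx : x ∈ V) (v : E 4) :
    ‖fderiv ℝ F x v‖ / ‖F x‖ ≤ ρ * (‖v‖ / ‖x‖) := by
  obtain ⟨e, he, hxe, hFe⟩ := hF x hx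
  rw [hFe.self_of_nhds, hFe.fderiv_eq]
  exact he.bound x hxe v

lemma IsLiftOn.map_nhds_eq (hF : IsLiftOn rel ρ ρ' F V) (hx : x ∈ V) :
    map F (𝓝 x) = 𝓝 (F x) := by
  obtain ⟨e, he, hxe, hFe⟩ := hF x hx
  rw [hFe.self_of_nhds, map_congr hFe]
  exact e.map_nhds_eq hxe

lemma IsLiftOn.surjective_fderiv (hF : IsLiftOn rel ρ ρ' F V) (hx : x ∈ V) :
    Function.Surjective (fderiv ℝ F x) := by
  obtain ⟨e, he, hxe, hFe⟩ := hF x hx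
  rw [hFe.fderiv_eq]
  have hd : DifferentiableAt ℝ e x :=
    (he.smooth.contDiffAt (e.open_source.mem_nhds hxe)).differentiableAt one_ne_zero
  have hd' : DifferentiableAt ℝ e.symm (e x) := (he.smooth_symm.contDiffAt
    (e.open_target.mem_nhds (e.map_source hxe))).differentiableAt one_ne_zero
  have hid : (e.symm ∘ e) =ᶠ[𝓝 x] id := by
    filter_upwards [e.open_source.mem_nhds hxe] with z hz using e.left_inv hz
  have h1 := fderiv_comp x hd' hd
  rw [hid.fderiv_eq, fderiv_id] at h1
  have hinj : Function.Injective (fderiv ℝ e x : E 4 →ₗ[ℝ] E 4) := by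
    refine Function.LeftInverse.injective (g := fderiv ℝ e.symm (e x)) fun v => ?_
    exact (DFunLike.congr_fun h1 v).symm
  exact LinearMap.injective_iff_surjective.1 hinj

lemma norm_O4_fderiv {γ : O4} {f : E 4 → E 4} (hf : DifferentiableAt ℝ f x) (v : E 4) :
    fderiv ℝ (fun z => γ (f z)) x v = γ (fderiv ℝ f x v) := by
  have := (γ.toContinuousLinearEquiv.hasFDerivAt (x := f x)).comp x hf.hasFDerivAt
  have h2 : HasFDerivAt (fun z => γ (f z)) _ x := this
  rw [h2.fderiv]
  rfl

lemma IsLiftOn.smul (h : IsOverlap Γ Γ' L ρ ρ' rel) (hF : IsLiftOn rel ρ ρ' F V) {γ : O4}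
    (hγ : γ ∈ Γ') : IsLiftOn rel ρ ρ' (fun x => γ (F x)) V := by
  intro x hx
  obtain ⟨e, he, hxe, hFe⟩ := hF x hx
  refine ⟨e.transHomeomorph γ.toHomeomorph, ⟨?_, ?_, ?_, ?_, ?_⟩, hxe, ?_⟩
  · intro w hw
    exact h.smul_right (he.rel_map w hw) γ hγ
  · exact γ.toContinuousLinearEquiv.contDiff.comp_contDiffOn he.smooth
  · exact he.smooth_symm.comp γ.symm.toContinuousLinearEquiv.contDiff.contDiffOn fun w hw => hw
  · intro w hw v
    have hd : DifferentiableAt ℝ e w :=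
      (he.smooth.contDiffAt (e.open_source.mem_nhds hw)).differentiableAt one_ne_zero
    have h1 := norm_O4_fderiv (γ := γ) hd v
    change ‖fderiv ℝ (fun z => γ (e z)) w v‖ / ‖γ (e w)‖ ≤ _
    rw [h1, norm_O4, norm_O4]
    exact he.bound w hw v
  · intro w hw v
    have hw' : γ.symm w ∈ e.target := hw
    have hd : DifferentiableAt ℝ e.symm (γ.symm w) :=
      (he.smooth_symm.contDiffAt (e.open_target.mem_nhds hw')).differentiableAt one_ne_zero
    have h1 := hd.hasFDerivAt.comp w (γ.symm.toContinuousLinearEquiv.hasFDerivAt (x := w))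
    have h2 := he.bound_symm _ hw' (γ.symm v)
    rw [norm_O4, norm_O4] at h2
    change ‖fderiv ℝ (e.symm ∘ γ.symm) w v‖ / ‖e.symm (γ.symm w)‖ ≤ _
    have h3 : HasFDerivAt (e.symm ∘ γ.symm) _ w := h1
    rw [h3.fderiv]
    exact h2
  · exact hFe.fun_comp γ

lemma IsLiftOn.comp_smul (h : IsOverlap Γ Γ' L ρ ρ' rel) (hF : IsLiftOn rel ρ ρ' F V) {γ : O4}
    (hγ : γ ∈ Γ) (hV : ∀ x ∈ W, γ x ∈ V) : IsLiftOn rel ρ ρ' (fun x => F (γ x)) W := by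
  intro x hx
  obtain ⟨e, he, hxe, hFe⟩ := hF (γ x) (hV x hx)
  refine ⟨γ.toHomeomorph.transOpenPartialHomeomorph e, ⟨?_, ?_, ?_, ?_, ?_⟩, hxe, ?_⟩
  · intro w hw
    have := h.smul_left (he.rel_map (γ w) hw) γ⁻¹ (Γ.inv_mem hγ)
    have h2 : γ⁻¹ (γ w) = w := γ.symm_apply_apply w
    rwa [h2] at this
  · exact he.smooth.comp γ.toContinuousLinearEquiv.contDiff.contDiffOn fun w hw => hw
  · exact γ.symm.toContinuousLinearEquiv.contDiff.comp_contDiffOn he.smooth_symm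
  · intro w hw v
    have hw' : γ w ∈ e.source := hw
    have hd : DifferentiableAt ℝ e (γ w) :=
      (he.smooth.contDiffAt (e.open_source.mem_nhds hw')).differentiableAt one_ne_zero
    have h1 := hd.hasFDerivAt.comp w (γ.toContinuousLinearEquiv.hasFDerivAt (x := w))
    have h2 := he.bound _ hw' (γ v)
    rw [norm_O4 γ v, norm_O4 γ w] at h2
    change ‖fderiv ℝ (e ∘ γ) w v‖ / ‖e (γ w)‖ ≤ _
    have h3 : HasFDerivAt (e ∘ γ) _ w := h1
    rw [h3.fderiv]
    exact h2
  · intro w hw v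
    have hd : DifferentiableAt ℝ e.symm w :=
      (he.smooth_symm.contDiffAt (e.open_target.mem_nhds hw)).differentiableAt one_ne_zero
    have h1 := norm_O4_fderiv (γ := γ.symm) hd v
    change ‖fderiv ℝ (fun z => γ.symm (e.symm z)) w v‖ / ‖γ.symm (e.symm w)‖ ≤ _
    rw [h1, norm_O4, norm_O4]
    exact he.bound_symm w hw v
  · exact (γ.continuous.tendsto x).eventually hFe

/-- The 1-jets of two lifts at a point differ by an element of the group. -/
lemma IsLiftOn.exists_jet_eq [Finite Γ'] (h : IsOverlap Γ Γ' L ρ ρ' rel) (hV : IsOpen V)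
    (h₁ : IsLiftOn rel ρ ρ' F₁ V) (h₂ : IsLiftOn rel ρ ρ' F₂ V) (hx : x ∈ V) :
    ∃ γ : Γ', F₂ x = (γ : O4) (F₁ x) ∧
      ∀ v, fderiv ℝ F₂ x v = (γ : O4) (fderiv ℝ F₁ x v) := by
  have hd₁ := h₁.differentiableAt hx
  have hd₂ := h₂.differentiableAt hx
  -- Along a line the finitely many group elements share the parameters near 0, so one of them
  -- occurs at parameters accumulating at 0; this fixes the value and the derivative in direction
  -- `v`.
  have hdir : ∀ v : E 4, ∃ γ : Γ', F₂ x = (γ : O4) (F₁ x) ∧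
      fderiv ℝ F₂ x v = (γ : O4) (fderiv ℝ F₁ x v) := by
    intro v
    have hline : HasDerivAt (fun t : ℝ => x + t • v) v 0 := by
      simpa using ((hasDerivAt_id (0 : ℝ)).smul_const v).const_add x
    have hx0 : x + (0 : ℝ) • v = x := by simp
    have hev : ∀ᶠ t in 𝓝[≠] (0 : ℝ), x + t • v ∈ V := by
      refine (hline.continuousAt.eventually_mem ?_).filter_mono nhdsWithin_le_nhds
      rw [hx0]; exact hV.mem_nhds hx
    have hex : ∀ᶠ t in 𝓝[≠] (0 : ℝ), ∃ γ : Γ',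
        F₂ (x + t • v) = (γ : O4) (F₁ (x + t • v)) := by
      filter_upwards [hev] with t ht
      obtain ⟨γ, hγ, hγ'⟩ := h.orbit_right (h₁.rel_map ht) (h₂.rel_map ht)
      exact ⟨⟨γ, hγ⟩, hγ'.symm⟩
    have hfreq : ∃ γ : Γ', ∃ᶠ t in 𝓝[≠] (0 : ℝ), F₂ (x + t • v) = (γ : O4) (F₁ (x + t • v)) := by
      by_contra hcon
      rw [not_exists] at hcon
      have := eventually_all.2 fun γ => not_frequently.1 (hcon γ)
      obtain ⟨t, ⟨γ, h1⟩, h2⟩ := (hex.and this).exists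
      exact h2 γ h1
    obtain ⟨γ, hγ⟩ := hfreq
    refine ⟨γ, ?_⟩
    have hD : HasDerivAt (fun t : ℝ => F₂ (x + t • v) - (γ : O4) (F₁ (x + t • v)))
        (fderiv ℝ F₂ x v - (γ : O4) (fderiv ℝ F₁ x v)) 0 := by
      have e₂ : HasFDerivAt F₂ (fderiv ℝ F₂ x) (x + (0 : ℝ) • v) := by
        rw [hx0]; exact hd₂.hasFDerivAt
      have e₁ : HasFDerivAt F₁ (fderiv ℝ F₁ x) (x + (0 : ℝ) • v) := by
        rw [hx0]; exact hd₁.hasFDerivAt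
      have e₁' := e₁.comp_hasDerivAt (0 : ℝ) hline
      have e₃ := ((γ : O4).toContinuousLinearEquiv.hasFDerivAt
        (x := F₁ (x + (0 : ℝ) • v))).comp_hasDerivAt (0 : ℝ) e₁'
      exact (e₂.comp_hasDerivAt (0 : ℝ) hline).sub e₃
    have hz : ∃ᶠ t in 𝓝[≠] (0 : ℝ), F₂ (x + t • v) - (γ : O4) (F₁ (x + t • v)) = 0 :=
      hγ.mono fun t ht => sub_eq_zero.2 ht
    constructor
    · have h0 : F₂ (x + (0 : ℝ) • v) - (γ : O4) (F₁ (x + (0 : ℝ) • v)) = 0 := by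
        by_contra hne
        exact hz ((hD.continuousAt.eventually_ne hne).filter_mono nhdsWithin_le_nhds)
      rw [hx0] at h0
      exact sub_eq_zero.1 h0
    · by_contra hne
      exact hz (hD.eventually_ne (sub_ne_zero.2 hne))
  by_contra hcon
  push Not at hcon
  -- The directions served by a given `γ` form a subspace. These finitely many subspaces cover ℝ⁴,
  -- so one of them is everything and a single `γ` serves all directions.
  let p : Γ' → Submodule ℝ (E 4) := fun γ => if F₂ x = (γ : O4) (F₁ x) then
    LinearMap.ker ((fderiv ℝ F₂ x : E 4 →ₗ[ℝ] E 4)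
      - ((γ : O4).toLinearEquiv : E 4 →ₗ[ℝ] E 4) ∘ₗ (fderiv ℝ F₁ x : E 4 →ₗ[ℝ] E 4)) else ⊥
  have hfin := Fintype.ofFinite Γ'
  refine Subspace.biUnion_ne_univ_of_top_notMem (s := Finset.univ.image p) ?_ ?_
  · simp only [Finset.mem_image, Finset.mem_univ, true_and, not_exists]
    intro γ hγ
    simp only [p] at hγ
    split_ifs at hγ with hif
    · obtain ⟨v, hv⟩ := hcon γ hif
      have : v ∈ (⊤ : Submodule ℝ (E 4)) := trivial
      rw [← hγ, LinearMap.mem_ker] at this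
      exact hv (sub_eq_zero.1 this)
    · exact absurd hγ bot_ne_top
  · rw [eq_univ_iff_forall]
    intro v
    obtain ⟨γ, hγ, hγv⟩ := hdir v
    simp only [mem_iUnion]
    refine ⟨p γ, Finset.mem_image_of_mem p (Finset.mem_univ γ), ?_⟩
    simp only [p, if_pos hγ]
    exact sub_eq_zero.2 hγv

/-- Values alone do not determine the group element at points with isotropy; first derivatives do,
being surjective. -/
lemma IsLiftOn.eq_of_fderiv_eq (hF : IsLiftOn rel ρ ρ' F V) (hx : x ∈ V) {γ γ' : O4}
    (hγ : ∀ v, γ (fderiv ℝ F x v) = γ' (fderiv ℝ F x v)) : γ = γ' := by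
  refine LinearIsometryEquiv.ext fun v => ?_
  obtain ⟨u, rfl⟩ := hF.surjective_fderiv hx v
  exact hγ u

lemma IsLiftOn.eq_of_eventuallyEq (hF : IsLiftOn rel ρ ρ' F V) (hx : x ∈ V) {γ γ' : O4}
    (hγ : (fun z => γ (F z)) =ᶠ[𝓝 x] fun z => γ' (F z)) : γ = γ' := by
  refine hF.eq_of_fderiv_eq hx fun v => ?_
  have hd := hF.differentiableAt hx
  rw [← norm_O4_fderiv hd, ← norm_O4_fderiv hd, hγ.fderiv_eq]

/-- Two lifts on a connected open set differ by an element of the group. -/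
theorem IsLiftOn.exists_eqOn [Finite Γ'] (h : IsOverlap Γ Γ' L ρ ρ' rel) (hV : IsOpen V)
    (hVc : IsPreconnected V) (h₁ : IsLiftOn rel ρ ρ' F₁ V) (h₂ : IsLiftOn rel ρ ρ' F₂ V) :
    ∃ γ ∈ Γ', EqOn F₂ (fun x => γ (F₁ x)) V := by
  choose! γ hγ hγ' using fun x (hx : x ∈ V) => h₁.exists_jet_eq h hV h₂ hx
  let : TopologicalSpace Γ' := ⊥
  have : DiscreteTopology Γ' := ⟨rfl⟩
  -- The derivatives are continuous and the group is finite, so every wrong element stays wrong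
  -- nearby and `γ` is locally constant.
  have hcont : ContinuousOn γ V := by
    intro x hx
    have hev : ∀ δ : Γ', δ ≠ γ x → ∀ᶠ z in 𝓝 x, γ z ≠ δ := by
      intro δ hδ
      obtain ⟨v, hv⟩ : ∃ v, (δ : O4) (fderiv ℝ F₁ x v) ≠ (γ x : O4) (fderiv ℝ F₁ x v) := by
        by_contra hcon
        push Not at hcon
        exact hδ (Subtype.ext (h₁.eq_of_fderiv_eq hx hcon))
      have c₁ : ContinuousAt (fun z => (δ : O4) (fderiv ℝ F₁ z v)) x :=
        (δ : O4).continuous.continuousAt.comp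
          (((h₁.contDiffAt hx).continuousAt_fderiv one_ne_zero).clm_apply continuousAt_const)
      have c₂ : ContinuousAt (fun z => fderiv ℝ F₂ z v) x :=
        ((h₂.contDiffAt hx).continuousAt_fderiv one_ne_zero).clm_apply continuousAt_const
      have hne : (δ : O4) (fderiv ℝ F₁ x v) ≠ fderiv ℝ F₂ x v := by
        rw [hγ' x hx]; exact hv
      have hev' : ∀ᶠ z in 𝓝 x, (δ : O4) (fderiv ℝ F₁ z v) ≠ fderiv ℝ F₂ z v :=
        (c₁.prodMk c₂).eventually (isOpen_ne_fun continuous_fst continuous_snd |>.mem_nhds hne)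
      filter_upwards [hev', hV.mem_nhds hx] with z hz hzV hzδ
      exact hz (by rw [hγ' z hzV, hzδ])
    have hall : ∀ᶠ z in 𝓝 x, γ z = γ x := by
      have := eventually_all.2 fun δ : Γ' => (show ∀ᶠ z in 𝓝 x, δ ≠ γ x → γ z ≠ δ by
        by_cases hδ : δ = γ x
        · exact Eventually.of_forall fun z hz => absurd hδ hz
        · exact (hev δ hδ).mono fun z hz _ => hz)
      filter_upwards [this] with z hz
      by_contra hne
      exact hz (γ z) hne rfl
    exact ContinuousAt.continuousWithinAt (continuousAt_const.congr (hall.mono fun z hz => hz.symm))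
  rcases V.eq_empty_or_nonempty with rfl | ⟨x₀, hx₀⟩
  · exact ⟨1, Γ'.one_mem, eqOn_empty _ _⟩
  · refine ⟨γ x₀, (γ x₀).2, fun x hx => ?_⟩
    rw [hγ x hx, hVc.constant hcont hx hx₀]

/-- Lifts on two open sets with connected intersection can be glued. -/
lemma IsLiftOn.exists_union [Finite Γ'] (h : IsOverlap Γ Γ' L ρ ρ' rel) (hV : IsOpen V)
    (hW : IsOpen W) (hVW : IsPreconnected (V ∩ W)) (h₁ : IsLiftOn rel ρ ρ' F₁ V)
    (h₂ : IsLiftOn rel ρ ρ' F₂ W) : ∃ F, IsLiftOn rel ρ ρ' F (V ∪ W) := by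
  classical
  obtain ⟨γ, hγ, heq⟩ := (h₂.mono inter_subset_right).exists_eqOn h (hV.inter hW) hVW
    (h₁.mono inter_subset_left)
  have hV' : EqOn (fun x => if x ∈ V then F₁ x else γ (F₂ x)) F₁ V := fun x hx => if_pos hx
  have hW' : EqOn (fun x => if x ∈ V then F₁ x else γ (F₂ x)) (fun x => γ (F₂ x)) W := by
    intro x hx
    by_cases hxV : x ∈ V
    · simp only [if_pos hxV]; exact heq ⟨hxV, hx⟩
    · simp only [if_neg hxV]
  refine ⟨fun x => if x ∈ V then F₁ x else γ (F₂ x), ?_⟩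
  rintro x (hx | hx)
  · exact h₁.congr hV hV' x hx
  · exact (h₂.smul h hγ).congr hW hW' x hx

end

section

variable {Γ Γ' : Subgroup O4} {L ρ ρ' : ℝ} {rel : E 4 → E 4 → Prop}

/-! ### Lifts on slabs -/

section growth

variable {W : Type*} [NormedAddCommGroup W] [NormedSpace ℝ W] {Φ : W → E 4} {F₀ : E 4 → E 4}

/-- Each local lift is corrected by a group element to agree with `F₀` where both live; balls are
convex, so all intersections are connected. The corrected lifts then agree with each other and glue.
-/
lemma exists_lift_ball_add [Finite Γ'] (h : IsOverlap Γ Γ' L ρ ρ' rel) (hΦ : IsOpenEmbedding Φ)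
    {r η : ℝ} (hr : 0 < r) (hη : 0 < η) (h₀ : IsLiftOn rel ρ ρ' F₀ (Φ '' Metric.ball 0 r))
    (hloc : ∀ x ∈ Metric.ball (0 : W) r, ∃ F, IsLiftOn rel ρ ρ' F (Φ '' Metric.ball x η)) :
    ∃ F, IsLiftOn rel ρ ρ' F (Φ '' Metric.ball 0 (r + η)) := by
  classical
  have hopen : ∀ {U : Set W}, IsOpen U → IsOpen (Φ '' U) := fun hU => hΦ.isOpenMap _ hU
  have hconn : ∀ {U : Set W}, Convex ℝ U → IsPreconnected (Φ '' U) := fun hU =>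
    hU.isPreconnected.image _ hΦ.continuous.continuousOn
  have hloc' : ∀ x ∈ Metric.ball (0 : W) r, ∃ F, IsLiftOn rel ρ ρ' F (Φ '' Metric.ball x η) ∧
      EqOn F F₀ (Φ '' (Metric.ball x η ∩ Metric.ball 0 r)) := by
    intro x hx
    obtain ⟨F, hF⟩ := hloc x hx
    obtain ⟨γ, hγ, heq⟩ := (hF.mono (image_mono inter_subset_left)).exists_eqOn h
      (hopen (Metric.isOpen_ball.inter Metric.isOpen_ball))
      (hconn ((convex_ball x η).inter (convex_ball 0 r)))
      (h₀.mono (image_mono inter_subset_right))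
    exact ⟨_, hF.smul h hγ, fun z hz => (heq hz).symm⟩
  choose! G hG hGeq using hloc'
  have hcons : ∀ x ∈ Metric.ball (0 : W) r, ∀ y ∈ Metric.ball (0 : W) r,
      EqOn (G y) (G x) (Φ '' (Metric.ball x η ∩ Metric.ball y η)) := by
    intro x hx y hy
    obtain ⟨γ, hγ, heq⟩ := ((hG x hx).mono (image_mono inter_subset_left)).exists_eqOn h
      (hopen (Metric.isOpen_ball.inter Metric.isOpen_ball))
      (hconn ((convex_ball x η).inter (convex_ball y η)))
      ((hG y hy).mono (image_mono inter_subset_right))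
    rcases (Metric.ball x η ∩ Metric.ball y η).eq_empty_or_nonempty with hem | ⟨z, hzx, hzy⟩
    · rw [hem, image_empty]; exact eqOn_empty _ _
    -- If two of the balls meet, the midpoint of their centres lies in both and, by convexity, in
    -- the old ball. Near it both lifts equal `F₀`, so the group element relating them is 1.
    set m : W := (1 / 2 : ℝ) • x + (1 / 2 : ℝ) • y with hm
    have hmr : m ∈ Metric.ball (0 : W) r :=
      (convex_ball (0 : W) r) hx hy (by norm_num) (by norm_num) (by norm_num)
    have hxy : dist x y < η + η := by
      have := dist_triangle_right x y z
      rw [Metric.mem_ball, dist_comm] at hzx hzy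
      linarith
    have hmx : m ∈ Metric.ball x η := by
      have : m - x = (1 / 2 : ℝ) • (y - x) := by rw [hm]; module
      rw [Metric.mem_ball, dist_eq_norm, this, norm_smul, ← dist_eq_norm, dist_comm]
      norm_num; linarith
    have hmy : m ∈ Metric.ball y η := by
      have : m - y = (1 / 2 : ℝ) • (x - y) := by rw [hm]; module
      rw [Metric.mem_ball, dist_eq_norm, this, norm_smul, ← dist_eq_norm]
      norm_num; linarith
    have hN : Φ '' (Metric.ball x η ∩ Metric.ball y η ∩ Metric.ball 0 r) ∈ 𝓝 (Φ m) :=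
      (hopen ((Metric.isOpen_ball.inter Metric.isOpen_ball).inter Metric.isOpen_ball)).mem_nhds
        ⟨m, ⟨⟨hmx, hmy⟩, hmr⟩, rfl⟩
    have hγ1 : (1 : O4) = γ := by
      refine h₀.eq_of_eventuallyEq (x := Φ m) ⟨m, hmr, rfl⟩ ?_
      filter_upwards [hN] with z hz
      obtain ⟨w, ⟨⟨hwx, hwy⟩, hwr⟩, rfl⟩ := hz
      have e1 := heq ⟨w, ⟨hwx, hwy⟩, rfl⟩
      have e2 := hGeq x hx ⟨w, ⟨hwx, hwr⟩, rfl⟩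
      have e3 := hGeq y hy ⟨w, ⟨hwy, hwr⟩, rfl⟩
      simp only at e1
      rw [← e2, ← e1, e3, e2]
      rfl
    intro z hz
    rw [heq hz, ← hγ1]
    rfl
  have hcov : ∀ z ∈ Metric.ball (0 : W) (r + η),
      ∃ x ∈ Metric.ball (0 : W) r, z ∈ Metric.ball x η := by
    intro z hz
    rw [mem_ball_zero_iff] at hz
    -- Shrinking `z` radially moves it by `η / (r + η) * ‖z‖ < η`.
    refine ⟨(r / (r + η)) • z, ?_, ?_⟩
    · rw [mem_ball_zero_iff, norm_smul, Real.norm_eq_abs, abs_of_pos (by positivity),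
        div_mul_eq_mul_div, div_lt_iff₀ (by positivity)]
      gcongr
    · have : z - (r / (r + η)) • z = (η / (r + η)) • z := by
        have h1 : η / (r + η) = 1 - r / (r + η) := by field_simp; ring
        rw [h1]; module
      rw [Metric.mem_ball, dist_eq_norm, this, norm_smul, Real.norm_eq_abs,
        abs_of_pos (by positivity), div_mul_eq_mul_div, div_lt_iff₀ (by positivity)]
      gcongr
  choose! p hp hp' using hcov
  let q : E 4 → W := Function.invFun Φ
  have hq : ∀ w, q (Φ w) = w := Function.leftInverse_invFun hΦ.injective
  refine ⟨fun z => G (p (q z)) z, ?_⟩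
  rintro _ ⟨w, hw, rfl⟩
  refine ((hG _ (hp w hw)).mono (W := Φ '' (Metric.ball (p w) η ∩ Metric.ball 0 (r + η)))
    (image_mono inter_subset_left)).congr
    (hopen (Metric.isOpen_ball.inter Metric.isOpen_ball)) ?_ _ ⟨w, ⟨hp' w hw, hw⟩, rfl⟩
  rintro _ ⟨z, ⟨hz, hz'⟩, rfl⟩
  simp only [hq]
  exact hcons _ (hp w hw) _ (hp z hz') ⟨z, ⟨hz, hp' z hz'⟩, rfl⟩

/-- A Lebesgue number of the cover by local lifts serves as a uniform step; the radius grows by it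
finitely often. -/
theorem exists_lift_ball [ProperSpace W] [Finite Γ'] (h : IsOverlap Γ Γ' L ρ ρ' rel)
    (hΦ : IsOpenEmbedding Φ) {R : ℝ} (hR : 0 < R)
    (hrel : ∀ x ∈ Metric.closedBall (0 : W) R, ∃ y, rel (Φ x) y) :
    ∃ F, IsLiftOn rel ρ ρ' F (Φ '' Metric.ball 0 R) := by
  have hex : ∀ x : Metric.closedBall (0 : W) R, ∃ e : OpenPartialHomeomorph (E 4) (E 4),
      IsCylinderLift rel ρ ρ' e ∧ Φ x ∈ e.source := by
    intro x
    obtain ⟨y, hy⟩ := hrel x x.2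
    obtain ⟨e, he, hx, -⟩ := h.exists_lift hy
    exact ⟨e, he, hx⟩
  choose e he hxe using hex
  obtain ⟨δ, hδ, hball⟩ := lebesgue_number_lemma_of_metric (isCompact_closedBall (0 : W) R)
    (c := fun i => Φ ⁻¹' (e i).source) (fun i => (e i).open_source.preimage hΦ.continuous)
    (fun x hx => mem_iUnion.2 ⟨⟨x, hx⟩, hxe ⟨x, hx⟩⟩)
  have hloc : ∀ x ∈ Metric.closedBall (0 : W) R,
      ∃ F, IsLiftOn rel ρ ρ' F (Φ '' Metric.ball x δ) := by
    intro x hx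
    obtain ⟨i, hi⟩ := hball x hx
    exact ⟨e i, (he i).isLiftOn.mono (image_subset_iff.2 hi)⟩
  have hind : ∀ n : ℕ, ∃ F, IsLiftOn rel ρ ρ' F (Φ '' Metric.ball 0 (min R ((n + 1) * δ))) := by
    intro n
    induction n with
    | zero =>
      obtain ⟨F, hF⟩ := hloc 0 (Metric.mem_closedBall_self hR.le)
      refine ⟨F, hF.mono (image_mono (Metric.ball_subset_ball ?_))⟩
      simp
    | succ n ih =>
      obtain ⟨F₀, h₀⟩ := ih
      have hpos : 0 < min R ((n + 1) * δ) := lt_min hR (by positivity)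
      obtain ⟨F, hF⟩ := exists_lift_ball_add h hΦ hpos hδ h₀ fun x hx => hloc x
        (Metric.ball_subset_closedBall (Metric.ball_subset_ball (min_le_left _ _) hx))
      refine ⟨F, hF.mono (image_mono (Metric.ball_subset_ball ?_))⟩
      rcases le_total R ((n + 1) * δ) with hc | hc
      · rw [min_eq_left hc]; exact (min_le_left _ _).trans (by linarith)
      · rw [min_eq_right hc]; refine (min_le_right _ _).trans ?_
        push_cast; linarith
  obtain ⟨n, hn⟩ := exists_nat_gt (R / δ)
  obtain ⟨F, hF⟩ := hind n
  rw [div_lt_iff₀ hδ] at hn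
  rw [min_eq_left (by linarith)] at hF
  exact ⟨F, hF⟩

end growth

/-! ### Covering a slab by two stereographic caps -/

/-- Polar coordinates on `ℝ⁴ ∖ {0}`. -/
def unpolarHomeo : S3 × ℝ ≃ₜ {x : E 4 // x ≠ 0} where
  toFun p := ⟨unpolar p, unpolar_ne p⟩
  invFun x := (⟨radial x, radial_mem x.2⟩, axial x)
  left_inv p := Prod.ext (Subtype.ext (radial_unpolar p)) (axial_unpolar p)
  right_inv x := Subtype.ext (unpolar_polar x.2)
  continuous_toFun := continuous_unpolar.subtype_mk _
  continuous_invFun := by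
    refine Continuous.prodMk (Continuous.subtype_mk ?_ _) ?_
    · exact continuous_iff_continuousAt.2 fun x =>
        (hasFDerivAt_radial x.2).continuousAt.comp continuous_subtype_val.continuousAt
    · exact continuous_iff_continuousAt.2 fun x =>
        (continuousAt_axial x.2).comp continuous_subtype_val.continuousAt

lemma isOpenEmbedding_unpolar : IsOpenEmbedding unpolar :=
  (isOpen_ne (x := (0 : E 4))).isOpenEmbedding_subtypeVal.comp unpolarHomeo.isOpenEmbedding

/-- The part `(s - K, s + K)` of the cylinder. -/
def slab (s K : ℝ) : Set (E 4) := {x | x ≠ 0 ∧ |axial x - s| < K}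

lemma isOpen_slab (s K : ℝ) : IsOpen (slab s K) := by
  have h : ContinuousOn (fun x => |axial x - s|) {x : E 4 | x ≠ 0} := fun x hx =>
    (((continuousAt_axial hx).sub continuousAt_const).abs).continuousWithinAt
  exact h.isOpen_inter_preimage isOpen_ne isOpen_Iio

/-- The part of a slab over the complement of a spherical cap around `v`. -/
def slabCap (s K : ℝ) (v : E 4) : Set (E 4) := {x | x ∈ slab s K ∧ inner ℝ (radial x) v < 3 / 5}

/-- A stereographic parametrization of the cylinder. -/
def stereoCylinder {v : E 4} (hv : ‖v‖ = 1) (s K : ℝ) (p : (ℝ ∙ v)ᗮ × ℝ) : E 4 :=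
  unpolar ((stereographic hv).symm ((4 : ℝ) • p.1), s + K * p.2)

lemma isOpenEmbedding_stereoCylinder {v : E 4} (hv : ‖v‖ = 1) (s : ℝ) {K : ℝ} (hK : 0 < K) :
    IsOpenEmbedding (stereoCylinder hv s K) := by
  have h1 : IsOpenEmbedding fun w : (ℝ ∙ v)ᗮ => (stereographic hv).symm ((4 : ℝ) • w) :=
    (isOpenEmbedding_stereographic_symm hv).comp
      (Homeomorph.smulOfNeZero (4 : ℝ) (by norm_num)).isOpenEmbedding
  have h2 : IsOpenEmbedding fun t : ℝ => s + K * t :=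
    ((Homeomorph.mulLeft₀ K hK.ne').trans (Homeomorph.addLeft s)).isOpenEmbedding
  exact isOpenEmbedding_unpolar.comp (h1.prodMap h2)

lemma inner_stereographic_symm {v : E 4} (hv : ‖v‖ = 1) (w : (ℝ ∙ v)ᗮ) :
    inner ℝ ((stereographic hv).symm w : E 4) v = (‖w‖ ^ 2 - 4) / (‖w‖ ^ 2 + 4) := by
  have h1 : ((stereographic hv).symm w : E 4)
      = (‖w‖ ^ 2 + 4)⁻¹ • ((4 : ℝ) • (w : E 4) + (‖w‖ ^ 2 - 4) • v) :=
    stereoInvFunAux_apply (w : E 4)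
  have h2 : inner ℝ (w : E 4) v = 0 := by
    rw [real_inner_comm]
    exact Submodule.mem_orthogonal_singleton_iff_inner_right.1 w.2
  rw [h1, inner_smul_left, inner_add_left, inner_smul_left, inner_smul_left, h2,
    real_inner_self_eq_norm_sq, hv]
  simp
  ring

/-- The height `(‖w‖² - 4) / (‖w‖² + 4)` increases with `‖w‖` and equals 3/5 at `‖w‖ = 4`; this
links the scaling by 4 to the threshold 3/5. The sup norm makes the unit ball of the product a
product of balls. -/
lemma image_stereoCylinder {v : E 4} (hv : ‖v‖ = 1) (s : ℝ) {K : ℝ} (hK : 0 < K) :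
    stereoCylinder hv s K '' Metric.ball 0 1 = slabCap s K v := by
  have key : ∀ (w : (ℝ ∙ v)ᗮ) (t : ℝ), (w, t) ∈ Metric.ball (0 : (ℝ ∙ v)ᗮ × ℝ) 1 ↔
      stereoCylinder hv s K (w, t) ∈ slabCap s K v := by
    intro w t
    have h1 : inner ℝ (radial (stereoCylinder hv s K (w, t))) v < 3 / 5 ↔ ‖w‖ < 1 := by
      rw [stereoCylinder, radial_unpolar, inner_stereographic_symm, norm_smul,
        div_lt_iff₀ (by positivity), Real.norm_eq_abs, abs_of_pos (by norm_num : (0 : ℝ) < 4)]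
      have hn := norm_nonneg w
      constructor <;> intro h <;> nlinarith
    have h2 : |axial (stereoCylinder hv s K (w, t)) - s| < K ↔ |t| < 1 := by
      rw [stereoCylinder, axial_unpolar, add_sub_cancel_left, abs_mul, abs_of_pos hK]
      constructor <;> intro h <;> nlinarith
    rw [mem_ball_zero_iff, Prod.norm_def, max_lt_iff, Real.norm_eq_abs]
    constructor
    · rintro ⟨ha, hb⟩
      exact ⟨⟨unpolar_ne _, h2.2 hb⟩, h1.2 ha⟩
    · rintro ⟨⟨-, hb⟩, ha⟩
      exact ⟨h1.1 ha, h2.1 hb⟩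
  ext x
  constructor
  · rintro ⟨⟨w, t⟩, hwt, rfl⟩
    exact (key w t).1 hwt
  · intro hx
    have hx0 : x ≠ 0 := hx.1.1
    have hne : (⟨radial x, radial_mem hx0⟩ : S3) ∈ (stereographic hv).source := by
      rw [stereographic_source, mem_compl_singleton_iff]
      intro heq
      have h1 : radial x = v := congrArg Subtype.val heq
      have h2 := hx.2
      rw [h1, real_inner_self_eq_norm_sq, hv] at h2
      norm_num at h2
    have heq : stereoCylinder hv s K ((4 : ℝ)⁻¹ • stereographic hv ⟨radial x, radial_mem hx0⟩,
        (axial x - s) / K) = x := by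
      rw [stereoCylinder]
      simp only
      rw [smul_inv_smul₀ (by norm_num), (stereographic hv).left_inv hne, mul_div_cancel₀ _ hK.ne',
        add_sub_cancel]
      exact unpolar_polar hx0
    refine ⟨_, ?_, heq⟩
    rw [key, heq]
    exact hx

/-- The two caps meet in 𝕊² times a square, which is connected. This is the van Kampen condition
behind the simple connectedness of 𝕊³. -/
lemma isPreconnected_slabCap_inter {v : E 4} (hv : ‖v‖ = 1) (s K : ℝ) :
    IsPreconnected (slabCap s K v ∩ slabCap s K (-v)) := by
  have hfact : Fact (Module.finrank ℝ (E 4) = 3 + 1) := ⟨by simp⟩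
  have hv0 : v ≠ 0 := by rw [← norm_ne_zero_iff, hv]; exact one_ne_zero
  have hfin : Module.finrank ℝ (ℝ ∙ v)ᗮ = 3 := Submodule.finrank_orthogonal_span_singleton hv0
  have hsph : IsPreconnected (Metric.sphere (0 : (ℝ ∙ v)ᗮ) 1) := by
    apply isPreconnected_sphere
    rw [← Module.finrank_eq_rank, hfin]
    norm_num
  have hprod := hsph.prod ((isPreconnected_Ioo (a := (-(3 / 5) : ℝ)) (b := 3 / 5)).prod
    (isPreconnected_Ioo (a := s - K) (b := s + K)))
  set f : (ℝ ∙ v)ᗮ × ℝ × ℝ → E 4 := fun p =>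
    Real.exp (p.2.2 / √6) • (p.2.1 • v + √(1 - p.2.1 ^ 2) • (p.1 : E 4)) with hf
  have hfc : Continuous f := by rw [hf]; fun_prop
  have hor : ∀ w : (ℝ ∙ v)ᗮ, inner ℝ (w : E 4) v = 0 := fun w => by
    rw [real_inner_comm]
    exact Submodule.mem_orthogonal_singleton_iff_inner_right.1 w.2
  have himg : f '' (Metric.sphere (0 : (ℝ ∙ v)ᗮ) 1 ×ˢ Ioo (-(3 / 5) : ℝ) (3 / 5) ×ˢ
      Ioo (s - K) (s + K)) = slabCap s K v ∩ slabCap s K (-v) := by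
    ext x
    constructor
    · rintro ⟨⟨w, c, t⟩, ⟨hw, hc, ht⟩, rfl⟩
      simp only [mem_sphere_zero_iff_norm, mem_Ioo] at hw hc ht
      have hc1 : 0 ≤ 1 - c ^ 2 := by nlinarith
      have hn : ‖c • v + √(1 - c ^ 2) • (w : E 4)‖ = 1 := by
        have : ‖c • v + √(1 - c ^ 2) • (w : E 4)‖ ^ 2 = 1 := by
          rw [norm_add_sq_real, norm_smul, norm_smul, inner_smul_left, inner_smul_right,
            real_inner_comm, hor, mul_pow, mul_pow, Real.norm_eq_abs, Real.norm_eq_abs, sq_abs,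
            sq_abs, Real.sq_sqrt hc1, hv, Submodule.norm_coe, hw]
          ring
        rwa [← pow_left_inj₀ (norm_nonneg _) zero_le_one two_ne_zero, one_pow]
      have hun : f (w, c, t) = unpolar (⟨c • v + √(1 - c ^ 2) • (w : E 4), by simpa using hn⟩, t) :=
        rfl
      have hin : inner ℝ (c • v + √(1 - c ^ 2) • (w : E 4)) v = c := by
        rw [inner_add_left, inner_smul_left, inner_smul_left, hor, real_inner_self_eq_norm_sq, hv]
        simp
      have hsl : f (w, c, t) ∈ slab s K := by
        refine ⟨by rw [hun]; exact unpolar_ne _, ?_⟩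
        rw [hun, axial_unpolar, abs_lt]
        constructor <;> simp only <;> linarith
      refine ⟨⟨hsl, ?_⟩, hsl, ?_⟩
      · rw [hun, radial_unpolar, hin]; exact hc.2
      · rw [hun, radial_unpolar, inner_neg_right, hin]; linarith [hc.1]
    · rintro ⟨⟨⟨hx0, hxs⟩, h1⟩, -, h2⟩
      rw [inner_neg_right] at h2
      set c := inner ℝ (radial x) v with hc
      have hrn : ‖radial x‖ = 1 := by simpa using radial_mem hx0
      have hcp : 0 < 1 - c ^ 2 := by nlinarith
      have hsq : 0 < √(1 - c ^ 2) := Real.sqrt_pos.2 hcp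
      have hmem : (√(1 - c ^ 2))⁻¹ • (radial x - c • v) ∈ (ℝ ∙ v)ᗮ := by
        rw [Submodule.mem_orthogonal_singleton_iff_inner_right, inner_smul_right, inner_sub_right,
          inner_smul_right, real_inner_comm, ← hc, real_inner_self_eq_norm_sq, hv]
        simp
      rw [abs_lt] at hxs
      refine ⟨(⟨_, hmem⟩, c, axial x), ⟨?_, ⟨by linarith, h1⟩, by linarith, by linarith⟩, ?_⟩
      · rw [mem_sphere_zero_iff_norm, Submodule.coe_norm, norm_smul, Real.norm_eq_abs,
          abs_of_pos (inv_pos.2 hsq)]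
        have : ‖radial x - c • v‖ = √(1 - c ^ 2) := by
          rw [← Real.sqrt_sq (norm_nonneg (radial x - c • v)), norm_sub_sq_real, hrn,
            inner_smul_right, ← hc, norm_smul, hv, Real.norm_eq_abs, mul_one, sq_abs]
          congr 1; ring
        rw [this, inv_mul_cancel₀ hsq.ne']
      · simp only [hf]
        rw [smul_smul, mul_inv_cancel₀ hsq.ne', one_smul, add_sub_cancel]
        exact unpolar_polar hx0
  rw [← himg]
  exact hprod.image f hfc.continuousOn

/-- The transition map lifts to every slab that lies in the overlap: slabs are simply connected. -/
theorem exists_lift_slab [Finite Γ'] (h : IsOverlap Γ Γ' L ρ ρ' rel) {s K : ℝ} (hK : 0 < K)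
    (hrel : ∀ x, x ≠ 0 → |axial x - s| ≤ K → ∃ y, rel x y) :
    ∃ F, IsLiftOn rel ρ ρ' F (slab s K) := by
  have hcap : ∀ {v : E 4}, ‖v‖ = 1 → ∃ F, IsLiftOn rel ρ ρ' F (slabCap s K v) := by
    intro v hv
    rw [← image_stereoCylinder hv s hK]
    refine exists_lift_ball h (isOpenEmbedding_stereoCylinder hv s hK) one_pos fun p hp => ?_
    refine hrel _ (unpolar_ne _) ?_
    rw [mem_closedBall_zero_iff, Prod.norm_def, max_le_iff, Real.norm_eq_abs] at hp
    rw [stereoCylinder, axial_unpolar, add_sub_cancel_left, abs_mul, abs_of_pos hK]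
    exact mul_le_of_le_one_right hK.le hp.2
  have hopen : ∀ {v : E 4}, ‖v‖ = 1 → IsOpen (slabCap s K v) := by
    intro v hv
    rw [← image_stereoCylinder hv s hK]
    exact (isOpenEmbedding_stereoCylinder hv s hK).isOpenMap _ Metric.isOpen_ball
  have hv : ‖(basisVec 0 : E 4)‖ = 1 := by simp [basisVec]
  have hv' : ‖-(basisVec 0 : E 4)‖ = 1 := by rw [norm_neg, hv]
  obtain ⟨F₁, h₁⟩ := hcap hv
  obtain ⟨F₂, h₂⟩ := hcap hv'
  obtain ⟨F, hF⟩ := h₁.exists_union h (hopen hv) (hopen hv') (isPreconnected_slabCap_inter hv s K) h₂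
  refine ⟨F, hF.mono fun x hx => ?_⟩
  rcases lt_or_ge (inner ℝ (radial x) (basisVec 0 : E 4)) (3 / 5) with hc | hc
  · exact Or.inl ⟨hx, hc⟩
  · refine Or.inr ⟨hx, ?_⟩
    rw [inner_neg_right]; linarith

lemma isPreconnected_slab {s K : ℝ} : IsPreconnected (slab s K) := by
  have : PreconnectedSpace S3 := by
    apply isPreconnected_iff_preconnectedSpace.1
    apply isPreconnected_sphere
    rw [← Module.finrank_eq_rank]
    simp
  have h := ((isPreconnected_univ (α := S3)).prod (isPreconnected_Ioo (a := s - K)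
    (b := s + K))).image unpolar continuous_unpolar.continuousOn
  convert h using 1
  ext x
  constructor
  · rintro ⟨hx, hxs⟩
    rw [abs_lt] at hxs
    exact ⟨_, ⟨trivial, by simp only; linarith, by simp only; linarith⟩, unpolar_polar hx⟩
  · rintro ⟨p, ⟨-, h1, h2⟩, rfl⟩
    refine ⟨unpolar_ne _, ?_⟩
    rw [axial_unpolar, abs_lt]
    constructor <;> linarith

end

/-! ### Almost isometric equivariant maps of the sphere -/

lemma commute_aeval {V : Type*} [AddCommGroup V] [Module ℝ V] {S q : Module.End ℝ V}
    (h : Commute q S) (p : Polynomial ℝ) : Commute q (Polynomial.aeval S p) := by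
  induction p using Polynomial.induction_on' with
  | add p r hp hr => rw [map_add]; exact hp.add_right hr
  | monomial n a =>
    rw [Polynomial.aeval_monomial]
    exact (Algebra.commute_algebraMap_right a q).mul_right (h.pow_right n)

/-- An injective operator that intertwines two orthogonal representations can be replaced by its
orthogonal part. -/
lemma exists_isometry_intertwining {T : E 4 →ₗ[ℝ] E 4} (hT : Function.Injective T)
    (H : Subgroup (O4 × O4)) (hH : ∀ p ∈ H, ∀ u, T (p.1 u) = p.2 (T u)) :
    ∃ a : O4, ∀ p ∈ H, p.2 = a * p.1 * a⁻¹ := by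
  set S : E 4 →ₗ[ℝ] E 4 := LinearMap.adjoint T ∘ₗ T with hS
  have hSi : ∀ x y, inner ℝ (S x) y = inner ℝ (T x) (T y) := fun x y => by
    rw [hS, LinearMap.comp_apply, LinearMap.adjoint_inner_left]
  have hsymm : S.IsSymmetric := fun x y => by
    rw [hSi, real_inner_comm, ← hSi, real_inner_comm]
  set b := hsymm.eigenvectorBasis (n := 4) (by simp) with hb
  set μ := hsymm.eigenvalues (n := 4) (by simp) with hμ
  have hbS : ∀ i, S (b i) = μ i • b i := fun i => hsymm.apply_eigenvectorBasis _ i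
  have hμpos : ∀ i, 0 < μ i := by
    intro i
    have h1 : inner ℝ (S (b i)) (b i) = μ i := by
      rw [hbS, inner_smul_left, real_inner_self_eq_norm_sq, b.norm_eq_one]; simp
    rw [← h1, hSi, real_inner_self_eq_norm_sq]
    have : T (b i) ≠ 0 := by
      rw [Ne, map_eq_zero_iff T hT, ← norm_eq_zero, b.norm_eq_one]; exact one_ne_zero
    have := norm_pos_iff.2 this
    positivity
  classical
  -- `p` interpolates `t ↦ t^(-1/2)` on the spectrum, so `R = (T*T)^(-1/2)` is a polynomial in `S`,
  -- and commutes with all that commutes with `S`. The isometry sought is the polar factor `T ∘ R`.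
  set p : Polynomial ℝ := Lagrange.interpolate (Finset.univ.image μ) id
    (fun t => (√t)⁻¹) with hp
  have hpμ : ∀ i, p.eval (μ i) = (√(μ i))⁻¹ := fun i =>
    Lagrange.eval_interpolate_at_node (s := Finset.univ.image μ) (v := id) (r := fun t => (√t)⁻¹)
      (fun _ _ _ _ h => h) (Finset.mem_image_of_mem μ (Finset.mem_univ i))
  set R : E 4 →ₗ[ℝ] E 4 := Polynomial.aeval (R := ℝ) (A := Module.End ℝ (E 4)) S p with hR
  have hbR : ∀ i, R (b i) = (√(μ i))⁻¹ • b i := by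
    intro i
    have hv : Module.End.HasEigenvector S (μ i) (b i) := by
      refine ⟨Module.End.mem_eigenspace_iff.2 (hbS i), ?_⟩
      rw [← norm_ne_zero_iff, b.norm_eq_one]; exact one_ne_zero
    rw [← hpμ]
    exact Module.End.aeval_apply_of_hasEigenvector hv
  have hon : Orthonormal ℝ ((T ∘ₗ R) ∘ b.toBasis) := by
    rw [orthonormal_iff_ite]
    intro i j
    simp only [Function.comp_apply, LinearMap.comp_apply, OrthonormalBasis.coe_toBasis]
    rw [← hSi, hbR, hbR, map_smul, hbS, inner_smul_left, inner_smul_left, inner_smul_right,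
      orthonormal_iff_ite.1 b.orthonormal]
    split_ifs with hij
    · subst hij
      have h1 := Real.sqrt_pos.2 (hμpos i)
      have h2 := Real.mul_self_sqrt (hμpos i).le
      simp only [RCLike.conj_to_real]
      field_simp
      linarith
    · simp
  let O : E 4 →ₗᵢ[ℝ] E 4 := (T ∘ₗ R).isometryOfOrthonormal (v := b.toBasis)
    (by simp [b.orthonormal]) hon
  let a : O4 := O.toLinearIsometryEquiv rfl
  have ha : ∀ x, a x = T (R x) := fun x => rfl
  refine ⟨a, fun q hq => ?_⟩
  -- `T` intertwines orthogonal maps, hence `T*T` commutes with the first representation.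
  have hcomm : Commute (q.1.toLinearEquiv : Module.End ℝ (E 4)) S := by
    refine LinearMap.ext fun x => ?_
    refine ext_inner_right ℝ fun y => ?_
    have e1 : T (q.1 x) = q.2 (T x) := hH q hq x
    have e2 : T (q.1⁻¹ y) = q.2⁻¹ (T y) := hH q⁻¹ (H.inv_mem hq) y
    have e3 : inner ℝ (q.1 (S x)) y = inner ℝ (S x) (q.1⁻¹ y) :=
      q.1.inner_map_eq_flip (S x) y
    have e4 : inner ℝ (q.2 (T x)) (T y) = inner ℝ (T x) (q.2⁻¹ (T y)) :=
      q.2.inner_map_eq_flip (T x) (T y)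
    change inner ℝ (q.1 (S x)) y = inner ℝ (S (q.1 x)) y
    rw [e3, hSi, e2, hSi, e1, e4]
  have hRc : ∀ x, R (q.1 x) = q.1 (R x) := fun x =>
    (LinearMap.congr_fun (commute_aeval hcomm p).eq x).symm
  rw [eq_mul_inv_iff_mul_eq]
  refine LinearIsometryEquiv.ext fun x => ?_
  change q.2 (a x) = a (q.1 x)
  rw [ha, ha, hRc, hH q hq]

/-- Expanding the square gives at most `1 - 2 * (1 - 2η) + (1 + 4η) = 8η`; the factors come from `∑
|u i| ≤ 2`, which is Cauchy–Schwarz in dimension 4. -/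
lemma norm_sub_sum_sq_le {η : ℝ} {φ : E 4 → E 4} (h1 : ∀ u, ‖u‖ = 1 → ‖φ u‖ = 1)
    (hφ : ∀ u v, ‖u‖ = 1 → ‖v‖ = 1 → |inner ℝ (φ u) (φ v) - inner ℝ u v| ≤ η)
    {u : E 4} (hu : ‖u‖ = 1) : ‖φ u - ∑ i, u i • φ (basisVec i)‖ ^ 2 ≤ 8 * η := by
  have hη : 0 ≤ η := (abs_nonneg _).trans (hφ u u hu hu)
  have he : ∀ i, ‖(basisVec i : E 4)‖ = 1 := fun i => by simp [basisVec]
  have hu2 : ∑ i, u i ^ 2 = 1 := by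
    rw [← EuclideanSpace.real_norm_sq_eq, hu, one_pow]
  have huabs : ∑ i, |u i| ≤ 2 := by
    have h := sq_sum_le_card_mul_sum_sq (s := Finset.univ) (f := fun i => |u i|)
    simp only [sq_abs, hu2, Finset.card_univ, Fintype.card_fin] at h
    have h0 : 0 ≤ ∑ i, |u i| := Finset.sum_nonneg fun i _ => abs_nonneg _
    norm_num at h
    nlinarith
  have e1 : inner ℝ (φ u) (∑ i, u i • φ (basisVec i)) ≥ 1 - 2 * η := by
    rw [inner_sum]
    have : ∀ i ∈ Finset.univ, u i ^ 2 - |u i| * η ≤ inner ℝ (φ u) (u i • φ (basisVec i)) := by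
      intro i _
      rw [inner_smul_right]
      have h2 := hφ u (basisVec i) hu (he i)
      have h3 : inner ℝ u (basisVec i) = u i := by simp [basisVec, EuclideanSpace.inner_single_right]
      rw [h3] at h2
      have h4 : |u i * (inner ℝ (φ u) (φ (basisVec i)) - u i)| ≤ |u i| * η := by
        rw [abs_mul]; gcongr
      have := (abs_le.1 h4).1
      nlinarith
    have h5 := Finset.sum_le_sum this
    rw [Finset.sum_sub_distrib, hu2, ← Finset.sum_mul] at h5
    nlinarith
  have e2 : ‖∑ i, u i • φ (basisVec i)‖ ^ 2 ≤ 1 + 4 * η := by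
    rw [← real_inner_self_eq_norm_sq, sum_inner]
    have : ∀ i ∈ Finset.univ, inner ℝ (u i • φ (basisVec i)) (∑ j, u j • φ (basisVec j))
        ≤ u i ^ 2 + |u i| * (η * ∑ j, |u j|) := by
      intro i _
      rw [inner_sum]
      have : ∀ j ∈ Finset.univ, inner ℝ (u i • φ (basisVec i)) (u j • φ (basisVec j))
          ≤ (if i = j then u i * u j else 0) + |u i| * (η * |u j|) := by
        intro j _
        rw [inner_smul_left, inner_smul_right]
        have h2 := hφ (basisVec i) (basisVec j) (he i) (he j)
        have h3 : inner ℝ (basisVec i : E 4) (basisVec j) = if i = j then 1 else 0 := by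
          simp [basisVec, EuclideanSpace.inner_single_left]
        rw [h3] at h2
        have h4 : |u i * u j * (inner ℝ (φ (basisVec i)) (φ (basisVec j)) - if i = j then 1 else 0)|
            ≤ |u i| * |u j| * η := by
          rw [abs_mul, abs_mul]; gcongr
        have h5 := (abs_le.1 h4).2
        simp only [RCLike.conj_to_real]
        split_ifs at h5 ⊢ <;> nlinarith
      refine (Finset.sum_le_sum this).trans (le_of_eq ?_)
      rw [Finset.sum_add_distrib, Finset.sum_ite_eq, if_pos (Finset.mem_univ i), ← Finset.mul_sum,
        ← Finset.mul_sum, pow_two]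
    refine (Finset.sum_le_sum this).trans ?_
    rw [Finset.sum_add_distrib, hu2, ← Finset.sum_mul]
    have h0 : 0 ≤ ∑ i, |u i| := Finset.sum_nonneg fun i _ => abs_nonneg _
    nlinarith [mul_nonneg hη (mul_nonneg h0 (sub_nonneg.2 huabs)), mul_nonneg hη (sub_nonneg.2 huabs)]
  rw [norm_sub_sq_real, h1 u hu]
  linarith

/-- If an equivariant map between spheres almost preserves inner products, then the two actions are
conjugate by an orthogonal map. -/
theorem exists_conj_of_almost_isometry (H : Subgroup (O4 × O4)) [Finite H] {φ : E 4 → E 4}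
    (h1 : ∀ u, ‖u‖ = 1 → ‖φ u‖ = 1)
    (hφ : ∀ u v, ‖u‖ = 1 → ‖v‖ = 1 → |inner ℝ (φ u) (φ v) - inner ℝ u v| ≤ 1 / 10)
    (hH : ∀ p ∈ H, ∀ u, ‖u‖ = 1 → φ (p.1 u) = p.2 (φ u)) :
    ∃ a : O4, ∀ p ∈ H, p.2 = a * p.1 * a⁻¹ := by
  have := Fintype.ofFinite H
  let B : E 4 →ₗ[ℝ] E 4 :=
    { toFun := fun u => ∑ i, u i • φ (basisVec i)
      map_add' := fun u v => by simp [add_smul, Finset.sum_add_distrib]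
      map_smul' := fun c u => by simp [Finset.smul_sum, mul_smul] }
  -- With `η = 1/10` the squared error is at most 8/10.
  have hB : ∀ u, ‖u‖ = 1 → ‖B u - φ u‖ < 1 := by
    intro u hu
    have h := norm_sub_sum_sq_le h1 hφ hu
    rw [norm_sub_rev, ← sq_lt_one_iff₀ (norm_nonneg _)]
    exact h.trans_lt (by norm_num)
  -- Summing over `H` makes the linear map `B` equivariant. Since `φ` already is, every summand
  -- stays within distance 1 of the unit vector `φ u`.
  let T : E 4 →ₗ[ℝ] E 4 := ∑ p : H,
    ((p : O4 × O4).2⁻¹.toLinearEquiv : E 4 →ₗ[ℝ] E 4) ∘ₗ B ∘ₗ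
      ((p : O4 × O4).1.toLinearEquiv : E 4 →ₗ[ℝ] E 4)
  have hTapp : ∀ u, T u = ∑ p : H, (p : O4 × O4).2⁻¹ (B ((p : O4 × O4).1 u)) := fun u => by
    simp only [T, LinearMap.sum_apply]; rfl
  refine exists_isometry_intertwining (T := T) ?_ H ?_
  · rw [injective_iff_map_eq_zero]
    intro x hx
    by_contra hx0
    have hn : 0 < ‖x‖ := norm_pos_iff.2 hx0
    set u := ‖x‖⁻¹ • x with hu
    have hu1 : ‖u‖ = 1 := by rw [hu, norm_smul, norm_inv, norm_norm, inv_mul_cancel₀ hn.ne']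
    have hTu : T u = 0 := by rw [hu, map_smul, hx, smul_zero]
    have hlt : ∀ p : H, ‖(p : O4 × O4).2⁻¹ (B ((p : O4 × O4).1 u)) - φ u‖ < 1 := by
      intro p
      have e1 : (p : O4 × O4).2⁻¹ (φ ((p : O4 × O4).1 u)) = φ u := by
        rw [hH p p.2 u hu1]
        exact (p : O4 × O4).2.symm_apply_apply _
      rw [← e1, ← map_sub, norm_O4]
      exact hB _ (by rw [norm_O4, hu1])
    -- If `T u = 0`, these differences add up to a vector of norm `|H|`, although each has norm
    -- below 1.
    have hsum : ∑ p : H, ((p : O4 × O4).2⁻¹ (B ((p : O4 × O4).1 u)) - φ u)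
        = -((Fintype.card H : ℝ) • φ u) := by
      rw [Finset.sum_sub_distrib, ← hTapp, hTu, Finset.sum_const, Finset.card_univ, zero_sub,
        Nat.cast_smul_eq_nsmul]
    have h2 : ‖∑ p : H, ((p : O4 × O4).2⁻¹ (B ((p : O4 × O4).1 u)) - φ u)‖ < Fintype.card H := by
      refine (norm_sum_le _ _).trans_lt ?_
      have := Finset.sum_lt_sum_of_nonempty (s := (Finset.univ : Finset H))
        ⟨1, Finset.mem_univ _⟩ fun p _ => hlt p
      simpa using this
    rw [hsum, norm_neg, norm_smul, h1 u hu1] at h2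
    simp at h2
  · intro q hq u
    rw [hTapp, hTapp, map_sum, ← Equiv.sum_comp (Equiv.mulRight (⟨q, hq⟩ : H))
      fun p : H => q.2 ((p : O4 × O4).2⁻¹ (B ((p : O4 × O4).1 u)))]
    refine Finset.sum_congr rfl fun p _ => ?_
    change _ = q.2 (((p : O4 × O4).2 * q.2)⁻¹ (B ((p : O4 × O4).1 (q.1 u))))
    rw [mul_inv_rev]
    exact (q.2.apply_symm_apply _).symm

open InnerProductGeometry

/-! ### Coarse geometry of the overlap -/

/-- The sphere of radius √6 has diameter √6 π, and 6π² < 60. -/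
lemma cylinderDist_le (x y : E 4) : cylinderDist x y ≤ √(60 + (axial y - axial x) ^ 2) := by
  refine Real.sqrt_le_sqrt ?_
  have h1 := angle_nonneg x y
  have h2 := angle_le_pi x y
  have h3 := Real.pi_lt_d2
  have : angle x y ^ 2 ≤ 3.15 ^ 2 := pow_le_pow_left₀ h1 (by linarith) 2
  norm_num at this
  linarith

lemma cylinderDist_le_add (x y : E 4) :
    cylinderDist x y ≤ √6 * angle x y + |axial y - axial x| := by
  have h0 : 0 ≤ √6 * angle x y := mul_nonneg (Real.sqrt_nonneg _) (angle_nonneg x y)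
  have h6 : √6 ^ 2 = 6 := Real.sq_sqrt (by norm_num)
  refine Real.sqrt_le_iff.2 ⟨by positivity, ?_⟩
  rw [add_sq, mul_pow, h6, sq_abs]
  have := mul_nonneg h0 (abs_nonneg (axial y - axial x))
  linarith

section

variable {Γ Γ' : Subgroup O4} {L ρ ρ' : ℝ} {rel : E 4 → E 4 → Prop}

/-- Continuation along the geodesic; its axial coordinate is affine in time, so it cannot leave the
first neck. -/
lemma IsOverlap.exists_rel_of_dist (h : IsOverlap Γ Γ' L ρ ρ' rel) (hρ : 0 ≤ ρ) {x y x' : E 4}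
    (hxy : rel x y) (hx' : x' ∈ annulus L) {d : ℝ} (hd : cylinderDist x x' ≤ d)
    (hy : |axial y| + ρ * d < L) : ∃ y', rel x' y' ∧ |axial y' - axial y| ≤ ρ * d := by
  have hx := h.left_mem hxy
  obtain ⟨c, c', hc, h0, h1, hne, hsp, hax⟩ := exists_geodesic hx.1 hx'.1
  have ha := abs_lt.1 (show |axial y| < L - ρ * d by linarith)
  have := h.exists_rel_of_curve hρ hc hne (ℓ := d) (fun t => (hsp t).trans_le hd) ?_
    (y₀ := y) (by rwa [h0]) (by linarith) (by linarith)
  · rwa [h1] at this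
  · intro t ht
    rw [hax]
    have hm := (convex_Ioo (-L) L).add_smul_sub_mem hx.2 hx'.2 ht
    simpa using hm

lemma IsOverlap.axial_eq (h : IsOverlap Γ Γ' L ρ ρ' rel) {x y y' : E 4} (hy : rel x y)
    (hy' : rel x y') : axial y' = axial y := by
  obtain ⟨γ, -, rfl⟩ := h.orbit_right hy hy'
  rw [axial, norm_O4]; rfl

lemma IsOverlap.abs_axial_sub_le_of_rel (h : IsOverlap Γ Γ' L ρ ρ' rel) (hρ : 0 ≤ ρ)
    {x y x' y' : E 4} (hxy : rel x y) (hxy' : rel x' y') {d : ℝ} (hd : cylinderDist x x' ≤ d)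
    (hy : |axial y| + ρ * d < L) : |axial y' - axial y| ≤ ρ * d := by
  obtain ⟨y'', h1, h2⟩ := h.exists_rel_of_dist hρ hxy (h.left_mem hxy') hd hy
  rwa [h.axial_eq h1 hxy']

/-- Moving along the axis of the second neck. -/
lemma IsOverlap.exists_rel_axial_eq (h : IsOverlap Γ Γ' L ρ ρ' rel) (hρ : 0 ≤ ρ') {x y : E 4}
    (hxy : rel x y) {t : ℝ} (ht : t ∈ Ioo (-L) L)
    (hx : |axial x| + ρ' * |t - axial y| < L) :
    ∃ x' y', rel x' y' ∧ axial y' = t ∧ |axial x' - axial x| ≤ ρ' * |t - axial y| := by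
  have hy := (h.right_mem hxy).1
  have hn : 0 < ‖y‖ := norm_pos_iff.2 hy
  set y' : E 4 := unpolar (⟨radial y, radial_mem hy⟩, t) with hy'
  have hax : axial y' = t := axial_unpolar _
  have hang : angle y y' = 0 := by
    have : y' = (Real.exp (t / √6) * ‖y‖⁻¹) • y := by
      rw [hy', unpolar]; simp only [radial]; rw [smul_smul]
    rw [this, angle_smul_right_of_pos _ _ (by positivity), angle_self hy]
  have hd : cylinderDist y y' ≤ |t - axial y| := by
    rw [cylinderDist, hang, hax]
    simp [Real.sqrt_sq_eq_abs]
  obtain ⟨x', h1, h2⟩ := h.symm.exists_rel_of_dist hρ hxy (x' := y')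
    ⟨unpolar_ne _, by rwa [hax]⟩ hd hx
  exact ⟨x', y', h1, hax, h2⟩

end

/-! ### Axial coordinates seen from points far away -/

/-- At axial distance comparable to `T` the sphere directions add only O(1/T) to the length: 60/T
from the square root, as `A ≥ T / 2`, and 2/T from the excess `κ - 1 ≤ 1 / T²`. -/
lemma mul_sqrt_le {T κ A a : ℝ} (hT : 10 ^ 4 ≤ T) (hκ : κ ≤ 1 + 1 / T ^ 2)
    (ha : |a| ≤ A) (h1 : T / 2 ≤ A) (h2 : A + 60 / T ≤ 2 * T) :
    κ * √(60 + a ^ 2) ≤ A + 62 / T := by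
  have hT0 : 0 < T := by linarith
  have e0 : a ^ 2 ≤ A ^ 2 := by rw [← sq_abs a]; exact pow_le_pow_left₀ (abs_nonneg a) ha 2
  have e1 : √(60 + a ^ 2) ≤ A + 60 / T := by
    rw [Real.sqrt_le_iff]
    refine ⟨add_nonneg (by linarith) (by positivity), ?_⟩
    have e2 : 60 ≤ 2 * A * (60 / T) := by
      rw [← mul_div_assoc, le_div_iff₀ hT0]; linarith
    rw [add_sq]
    linarith [sq_nonneg (60 / T)]
  calc κ * √(60 + a ^ 2) ≤ (1 + 1 / T ^ 2) * (A + 60 / T) :=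
        mul_le_mul hκ e1 (Real.sqrt_nonneg _) (by positivity)
    _ = A + 60 / T + 1 / T ^ 2 * (A + 60 / T) := by ring
    _ ≤ A + 60 / T + 1 / T ^ 2 * (2 * T) := by gcongr
    _ = A + 62 / T := by field_simp; ring

/-- If `D < 2T - 40/T`, then `κ² (60 + D²)` is at most about `(1 + 3/T²)(4T² - 100)`, that is 4T² -
88, short of the required 4T². -/
lemma sub_ge_of_far_points {T κ D : ℝ} (hT : 10 ^ 4 ≤ T) (hκ1 : 1 ≤ κ) (hκ : κ ≤ 1 + 1 / T ^ 2)
    (hD : 0 ≤ D) (hfar : 2 * T ≤ κ * √(60 + D ^ 2)) : 2 * T - 40 / T ≤ D := by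
  have hT0 : 0 < T := by linarith
  set j := 1 / T ^ 2 with hj
  have hj0 : 0 < j := by positivity
  have hjT : j * T ^ 2 = 1 := by rw [hj]; field_simp
  have hj1 : j ≤ 1 / 10 ^ 8 := by
    rw [hj]
    exact one_div_le_one_div_of_le (by norm_num)
      (le_trans (by norm_num) (pow_le_pow_left₀ (by norm_num) hT 2))
  by_contra hlt
  push Not at hlt
  have h1 : (2 * T) ^ 2 ≤ κ ^ 2 * (60 + D ^ 2) := by
    have := pow_le_pow_left₀ (by linarith) hfar 2
    rwa [mul_pow κ, Real.sq_sqrt (by positivity)] at this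
  have h2 : D ^ 2 ≤ 4 * T ^ 2 - 160 + 1600 * j := by
    have h3 : (2 * T - 40 / T) ^ 2 = 4 * T ^ 2 - 160 + 1600 * j := by
      rw [hj]; field_simp; ring
    rw [← h3]
    exact pow_le_pow_left₀ hD hlt.le 2
  have h4 : κ ^ 2 ≤ 1 + 3 * j := by
    have h5 : κ ^ 2 ≤ (1 + j) ^ 2 := pow_le_pow_left₀ (by linarith) hκ 2
    have h6 : j ^ 2 ≤ j := by
      rw [pow_two]; exact mul_le_of_le_one_left hj0.le (by linarith)
    linarith [add_sq 1 j]
  have h6 : κ ^ 2 * (60 + D ^ 2) ≤ (1 + 3 * j) * (4 * T ^ 2 - 100 + 1600 * j) :=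
    mul_le_mul h4 (by linarith) (by positivity) (by positivity)
  have h7 : (1 + 3 * j) * (4 * T ^ 2 - 100 + 1600 * j)
      = 4 * T ^ 2 - 88 + 1300 * j + 4800 * (j * j) := by linear_combination 12 * hjT
  have h8 : j * j ≤ 1 * (1 / 10 ^ 8) := mul_le_mul (by linarith) hj1 hj0.le (by norm_num)
  linarith [mul_pow 2 T 2]

/-- A squeeze as for Busemann functions. `p` and `m` are axial positions in the first neck of points
at rescaled heights `T` and `-T` in the second, forced to lie near `±T`. A point at position `s` has
height `g` bounded above through its distance to `m` and below through its distance to `p`. -/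
lemma abs_sub_le_of_far_points {T κ p m s g : ℝ} (hT : 10 ^ 4 ≤ T) (hκ1 : 1 ≤ κ)
    (hκ : κ ≤ 1 + 1 / T ^ 2) (hp : p ≤ κ * T) (hm : -(κ * T) ≤ m) (hmp : m ≤ p)
    (hfar : 2 * T ≤ κ * √(60 + (p - m) ^ 2)) (hs : |s| ≤ T / 2)
    (hgp : T - g ≤ κ * √(60 + (s - p) ^ 2)) (hgm : g + T ≤ κ * √(60 + (s - m) ^ 2)) :
    |g - s| ≤ 64 / T := by
  have hT0 : 0 < T := by linarith
  have hD := sub_ge_of_far_points hT hκ1 hκ (sub_nonneg.2 hmp) hfar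
  have hκT : κ * T ≤ T + 1 / T := by
    calc κ * T ≤ (1 + 1 / T ^ 2) * T := by gcongr
      _ = T + 1 / T := by field_simp
  have hs' := abs_le.1 hs
  have e40 : 40 / T = 40 * (1 / T) := by ring
  have e60 : 60 / T = 60 * (1 / T) := by ring
  have e62 : 62 / T = 62 * (1 / T) := by ring
  have e64 : 64 / T = 64 * (1 / T) := by ring
  have hi0 : 0 < 1 / T := by positivity
  have hi1 : 1 / T ≤ 1 / 10 ^ 4 := one_div_le_one_div_of_le (by norm_num) hT
  rw [e40] at hD
  have k1 := mul_sqrt_le hT hκ (A := T + 1 / T + s) (a := s - m)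
    (by rw [abs_le]; constructor <;> linarith) (by linarith) (by linarith)
  have k2 := mul_sqrt_le hT hκ (A := T + 1 / T - s) (a := s - p)
    (by rw [abs_le]; constructor <;> linarith) (by linarith) (by linarith)
  rw [e62] at k1 k2
  rw [e64, abs_le]
  constructor <;> linarith

section

variable {Γ Γ' : Subgroup O4} {L T κ μ : ℝ} {rel : E 4 → E 4 → Prop}

/-- On the overlap the axial coordinate of the second neck is, up to a small error, an affine
function of the axial coordinate of the first neck. -/
theorem IsOverlap.exists_axial_near (h : IsOverlap Γ Γ' L (κ * μ) (κ * μ⁻¹) rel)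
    (hT : 10 ^ 4 ≤ T) (hκ1 : 1 ≤ κ) (hκ : κ ≤ 1 + 1 / T ^ 2) (hμ : 0 < μ) {xa xb : E 4}
    (hab : rel xa xb) (hxa : |axial xa| ≤ L - 10 * T) (hxb : |axial xb| ≤ L - 10 * T * μ) :
    (∀ x, x ≠ 0 → |axial x - axial xa| ≤ 2 * T → ∃ y, rel x y) ∧
    ∃ σ : ℝ, |σ| = 1 ∧ ∀ x y, rel x y → |axial x - axial xa| ≤ T / 2 →
      |axial y - axial xb - σ * (μ * (axial x - axial xa))| ≤ 64 / T * μ := by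
  have hT0 : 0 < T := by linarith
  have hκμ : 0 ≤ κ * μ := by positivity
  have hκ' : κ ≤ 1 + 1 / 10 ^ 4 := by
    refine hκ.trans ?_
    gcongr
    nlinarith
  -- All points within axial distance 2T are at distance at most 3T; their partners drift by at most
  -- 4Tμ, well within the margin 10Tμ.
  have hrel : ∀ x, x ≠ 0 → |axial x - axial xa| ≤ 2 * T →
      ∃ y, rel x y ∧ |axial y - axial xb| ≤ 4 * T * μ := by
    intro x hx hxs
    have h1 : cylinderDist xa x ≤ 3 * T := by
      refine (cylinderDist_le _ _).trans ?_
      rw [Real.sqrt_le_iff]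
      refine ⟨by linarith, ?_⟩
      have : (axial x - axial xa) ^ 2 ≤ (2 * T) ^ 2 := by
        rw [← sq_abs]; exact pow_le_pow_left₀ (abs_nonneg _) hxs 2
      nlinarith
    have h2 : κ * μ * (3 * T) ≤ 4 * T * μ := by
      have : 0 ≤ T * μ := by positivity
      nlinarith
    have hm : 0 < T * μ := by positivity
    obtain ⟨y, hy, hyd⟩ := h.exists_rel_of_dist hκμ hab (x' := x) ⟨hx, by
      rw [abs_le] at hxa hxs; constructor <;> linarith⟩ h1 (by linarith)
    exact ⟨y, hy, hyd.trans h2⟩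
  have hlip : ∀ x y x' y', rel x y → rel x' y' → |axial x - axial xa| ≤ 2 * T →
      |axial x' - axial xa| ≤ 2 * T →
      |axial y' - axial y| ≤ κ * μ * √(60 + (axial x' - axial x) ^ 2) := by
    intro x y x' y' hxy hxy' hx hx'
    -- `hrel` controls one partner of `x`; all partners of `x` have the same axial coordinate.
    obtain ⟨z, hz, hzd⟩ := hrel x (h.left_mem hxy).1 hx
    rw [← h.axial_eq hxy hz] at *
    rw [h.axial_eq hxy hz] at hzd ⊢
    refine h.abs_axial_sub_le_of_rel hκμ hxy hxy' (cylinderDist_le _ _) ?_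
    have h1 : √(60 + (axial x' - axial x) ^ 2) ≤ 5 * T := by
      rw [Real.sqrt_le_iff]
      refine ⟨by linarith, ?_⟩
      have : |axial x' - axial x| ≤ 4 * T := by
        rw [abs_le] at hx hx' ⊢; constructor <;> linarith
      have : (axial x' - axial x) ^ 2 ≤ (4 * T) ^ 2 := by
        rw [← sq_abs]; exact pow_le_pow_left₀ (abs_nonneg _) this 2
      nlinarith
    have h2 : κ * μ * √(60 + (axial x' - axial x) ^ 2) ≤ κ * μ * (5 * T) := by gcongr
    have hm : 0 < T * μ := by positivity
    have h3 : κ * μ * (5 * T) < 5.5 * (T * μ) := by nlinarith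
    have h4 : |axial y| ≤ |axial xb| + 4 * T * μ := by
      have := abs_sub_abs_le_abs_sub (axial y) (axial xb)
      linarith
    linarith
  -- The far points: heights `±μT` on the axis of the second neck, transported back to the first.
  have hmove : ∀ τ : ℝ, |τ| = 1 → ∃ x y, rel x y ∧ axial y - axial xb = τ * (μ * T) ∧
      |axial x - axial xa| ≤ κ * T := by
    intro τ hτ
    have hd : |axial xb + τ * (μ * T) - axial xb| = μ * T := by
      rw [add_sub_cancel_left, abs_mul, hτ, one_mul, abs_of_pos (by positivity)]
    have hk : κ * μ⁻¹ * (μ * T) = κ * T := by field_simp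
    have hκT : κ * T ≤ 2 * T := by nlinarith
    obtain ⟨x, y, h1, h2, h3⟩ := h.exists_rel_axial_eq (by positivity) hab
      (t := axial xb + τ * (μ * T)) (by
        have e1 : |axial xb + τ * (μ * T)| ≤ |axial xb| + μ * T := by
          refine (abs_add_le _ _).trans ?_
          rw [abs_mul τ, hτ, one_mul, abs_of_pos (by positivity : 0 < μ * T)]
        have hm : 0 < T * μ := by positivity
        have e2 : |axial xb + τ * (μ * T)| < L := by linarith
        exact abs_lt.1 e2) (by rw [hd, hk]; linarith)
    rw [hd, hk] at h3
    exact ⟨x, y, h1, by rw [h2]; ring, h3⟩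
  refine ⟨fun x hx hxs => (hrel x hx hxs).imp fun y hy => hy.1, ?_⟩
  obtain ⟨xp, yp, hrp, hyp, hxp⟩ := hmove 1 (by simp)
  obtain ⟨xm, ym, hrm, hym, hxm⟩ := hmove (-1) (by simp)
  have hκT : κ * T ≤ 2 * T := by nlinarith
  have hxp' := hxp.trans hκT
  have hxm' := hxm.trans hκT
  have hfar : 2 * T ≤ κ * √(60 + (axial xp - axial xm) ^ 2) := by
    have h1 := (le_abs_self _).trans (hlip xm ym xp yp hrm hrp hxm' hxp')
    have h2 : axial yp - axial ym = μ * (2 * T) := by linarith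
    have h3 : μ * (2 * T) ≤ μ * (κ * √(60 + (axial xp - axial xm) ^ 2)) := by linarith
    exact le_of_mul_le_mul_left h3 hμ
  have hgen : ∀ x y, rel x y → |axial x - axial xa| ≤ T / 2 →
      T - (axial y - axial xb) / μ ≤ κ * √(60 + (axial x - axial xp) ^ 2) ∧
      (axial y - axial xb) / μ + T ≤ κ * √(60 + (axial x - axial xm) ^ 2) := by
    intro x y hxy hx
    have hx' : |axial x - axial xa| ≤ 2 * T := by linarith
    have h1 := (abs_le.1 (hlip xp yp x y hrp hxy hxp' hx')).1
    have h2 := (abs_le.1 (hlip xm ym x y hrm hxy hxm' hx')).2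
    constructor
    · have h3 : μ * (T - (axial y - axial xb) / μ)
          ≤ μ * (κ * √(60 + (axial x - axial xp) ^ 2)) := by
        rw [mul_sub, mul_div_cancel₀ _ hμ.ne']; linarith
      exact le_of_mul_le_mul_left h3 hμ
    · have h3 : μ * ((axial y - axial xb) / μ + T)
          ≤ μ * (κ * √(60 + (axial x - axial xm) ^ 2)) := by
        rw [mul_add, mul_div_cancel₀ _ hμ.ne']; linarith
      exact le_of_mul_le_mul_left h3 hμ
  have hscale : ∀ {σ g s : ℝ}, |g / μ - σ * s| ≤ 64 / T → |g - σ * (μ * s)| ≤ 64 / T * μ := by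
    intro σ g s hg
    have : g - σ * (μ * s) = (g / μ - σ * s) * μ := by field_simp
    rw [this, abs_mul, abs_of_pos hμ]
    gcongr
  have hxp2 := abs_le.1 hxp
  have hxm2 := abs_le.1 hxm
  -- The order of the two far points in the first neck tells whether the axes run in the same
  -- direction; the second case reduces to the first by reflection.
  rcases le_total (axial xm) (axial xp) with hle | hle
  · refine ⟨1, by simp, fun x y hxy hx => hscale ?_⟩
    obtain ⟨g1, g2⟩ := hgen x y hxy hx
    rw [one_mul]
    refine abs_sub_le_of_far_points (p := axial xp - axial xa) (m := axial xm - axial xa)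
      hT hκ1 hκ hxp2.2 hxm2.1 (by linarith) ?_ hx ?_ ?_
    · rwa [sub_sub_sub_cancel_right]
    · rwa [sub_sub_sub_cancel_right]
    · rwa [sub_sub_sub_cancel_right]
  · refine ⟨-1, by simp, fun x y hxy hx => hscale ?_⟩
    obtain ⟨g1, g2⟩ := hgen x y hxy hx
    rw [neg_one_mul]
    refine abs_sub_le_of_far_points (p := -(axial xp - axial xa)) (m := -(axial xm - axial xa))
      hT hκ1 hκ (by linarith) (by linarith) (by linarith) ?_ (by rwa [abs_neg]) ?_ ?_
    · have : -(axial xp - axial xa) - -(axial xm - axial xa) = -(axial xp - axial xm) := by ring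
      rwa [this, neg_sq]
    · have : -(axial x - axial xa) - -(axial xp - axial xa) = -(axial x - axial xp) := by ring
      rwa [this, neg_sq]
    · have : -(axial x - axial xa) - -(axial xm - axial xa) = -(axial x - axial xm) := by ring
      rwa [this, neg_sq]

end

/-! ### Conjugacy of the groups of overlapping necks -/

section

variable {Γ Γ' : Subgroup O4} {L ρ ρ' : ℝ} {rel : E 4 → E 4 → Prop} {F : E 4 → E 4} {s K : ℝ}

/-- The geodesic between two points of a slab stays in the slab, and `F` stretches its length by at
most `ρ`. -/
lemma IsLiftOn.angle_le (h : IsOverlap Γ Γ' L ρ ρ' rel)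
    (hF : IsLiftOn rel ρ ρ' F (slab s K)) {x x' : E 4} (hx : x ∈ slab s K) (hx' : x' ∈ slab s K) :
    √6 * angle (F x) (F x') ≤ ρ * cylinderDist x x' := by
  obtain ⟨c, c', hc, h0, h1, hne, hsp, hax⟩ := exists_geodesic hx.1 hx'.1
  have hin : ∀ t ∈ Icc (0 : ℝ) 1, c t ∈ slab s K := by
    intro t ht
    refine ⟨hne t, ?_⟩
    have hm := (convex_ball s K).add_smul_sub_mem (x := axial x) (y := axial x')
      (by rw [Metric.mem_ball, Real.dist_eq]; exact hx.2)
      (by rw [Metric.mem_ball, Real.dist_eq]; exact hx'.2) ht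
    rw [Metric.mem_ball, Real.dist_eq, smul_eq_mul] at hm
    rw [hax]; exact hm
  have h := angle_curve_le (c := fun t => F (c t)) (c' := fun t => fderiv ℝ F (c t) (c' t))
    (M := ρ * cylinderDist x x') (convex_Icc (0 : ℝ) 1)
    (fun t ht => ((hF.differentiableAt (hin t ht)).hasFDerivAt.comp_hasDerivAt t
      (hc t)).hasDerivWithinAt)
    (fun t ht => (h.right_mem (hF.rel_map (hin t ht))).1)
    (fun t ht => by
      calc √6 * (‖fderiv ℝ F (c t) (c' t)‖ / ‖F (c t)‖) ≤ √6 * (ρ * (‖c' t‖ / ‖c t‖)) := by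
            gcongr; exact hF.bound (hin t ht) _
        _ = ρ * (√6 * (‖c' t‖ / ‖c t‖)) := by ring
        _ = ρ * cylinderDist x x' := by rw [hsp])
    (left_mem_Icc.2 zero_le_one) (right_mem_Icc.2 zero_le_one)
  simp only [h0, h1] at h
  simpa using h

lemma IsLiftOn.isOpen_image {V : Set (E 4)} (hF : IsLiftOn rel ρ ρ' F V) (hV : IsOpen V) :
    IsOpen (F '' V) := by
  rw [isOpen_iff_mem_nhds]
  rintro _ ⟨x, hx, rfl⟩
  rw [← hF.map_nhds_eq hx]
  exact image_mem_map (hV.mem_nhds hx)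

lemma mem_slab_O4 (γ : O4) {x : E 4} (hx : x ∈ slab s K) : γ x ∈ slab s K := by
  refine ⟨?_, ?_⟩
  · rw [← norm_ne_zero_iff, norm_O4]; exact norm_ne_zero_iff.2 hx.1
  · rw [axial, norm_O4]; exact hx.2

/-- A finite group of linear isometries acts freely at some point of every sphere. -/
lemma exists_free_point [Finite Γ'] (t : ℝ) :
    ∃ y : E 4, y ≠ 0 ∧ axial y = t ∧ ∀ γ ∈ Γ', γ y = y → γ = 1 := by
  classical
  have hfin := Fintype.ofFinite Γ'
  -- Fixed spaces of nontrivial elements are proper, so finitely many do not cover ℝ⁴. The identity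
  -- contributes `⊥`, which excludes `v = 0`.
  let p : Γ' → Submodule ℝ (E 4) := fun γ => if γ = 1 then ⊥ else
    LinearMap.ker (((γ : O4).toLinearEquiv : E 4 →ₗ[ℝ] E 4) - LinearMap.id)
  have hne : (⋃ q ∈ Finset.univ.image p, (q : Set (E 4))) ≠ univ := by
    refine Subspace.biUnion_ne_univ_of_top_notMem ?_
    simp only [Finset.mem_image, Finset.mem_univ, true_and, not_exists]
    intro γ hγ
    simp only [p] at hγ
    split_ifs at hγ with hif
    · exact bot_ne_top hγ
    · refine hif (Subtype.ext (LinearIsometryEquiv.ext fun v => ?_))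
      have : v ∈ (⊤ : Submodule ℝ (E 4)) := trivial
      rw [← hγ, LinearMap.mem_ker] at this
      exact sub_eq_zero.1 this
  rw [Ne, eq_univ_iff_forall, not_forall] at hne
  obtain ⟨v, hv⟩ := hne
  simp only [Finset.mem_image, Finset.mem_univ, true_and, mem_iUnion, not_exists] at hv
  have hv0 : v ≠ 0 := fun h => hv (p 1) ⟨1, rfl⟩ (by rw [h]; exact (p 1).zero_mem)
  have hn : 0 < ‖v‖ := norm_pos_iff.2 hv0
  refine ⟨unpolar (⟨radial v, radial_mem hv0⟩, t), unpolar_ne _, axial_unpolar _, ?_⟩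
  intro γ hγ hfix
  by_contra hγ1
  refine hv (p ⟨γ, hγ⟩) ⟨⟨γ, hγ⟩, rfl⟩ ?_
  have hne : (⟨γ, hγ⟩ : Γ') ≠ 1 := fun h => hγ1 (congrArg Subtype.val h)
  simp only [p, if_neg hne]
  refine sub_eq_zero.2 ?_
  change γ v = v
  simp only [unpolar, radial, map_smul, smul_smul] at hfix
  exact smul_right_injective _ (by positivity) hfix

end

variable {Γ Γ' : Subgroup O4} {L T κ μ : ℝ} {rel : E 4 → E 4 → Prop} {F : E 4 → E 4}

/-- A lift of the transition map to a long slab maps onto the middle slice of the second neck. -/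
lemma exists_preimage_of_lift {ρ ρ' σ s c : ℝ} (h : IsOverlap Γ Γ' L ρ ρ' rel) (hT : 10 ^ 4 ≤ T)
    (hμ : 0 < μ) (hσ : |σ| = 1) {xa : E 4} (hxa : xa ≠ 0) (hs : axial xa = s)
    (hF : IsLiftOn rel ρ ρ' F (slab s (T / 2)))
    (hax : ∀ x y, rel x y → |axial x - s| ≤ T / 2 →
      |axial y - c - σ * (μ * (axial x - s))| ≤ 64 / T * μ)
    {y : E 4} (hy : y ≠ 0) (hyc : |axial y - c| < 5 * μ) : ∃ x ∈ slab s 10, F x = y := by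
  have hT0 : 0 < T := by linarith
  have h64 : 64 / T ≤ 64 / 10 ^ 4 := by gcongr
  have hsub : slab s 10 ⊆ slab s (T / 2) := fun x hx => ⟨hx.1, hx.2.trans (by linarith)⟩
  have hclosed : IsClosed (F '' {x : E 4 | x ≠ 0 ∧ axial x ∈ Icc (s - 10) (s + 10)}) := by
    refine ((isCompact_axial_Icc _ _).image_of_continuousOn fun x hx => ?_).isClosed
    refine (hF.differentiableAt ⟨hx.1, ?_⟩).continuousAt.continuousWithinAt
    have := hx.2
    rw [mem_Icc] at this
    rw [abs_lt]; constructor <;> linarith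
  -- The image is open, and closed relative to the target slab: a limit point has a preimage in the
  -- closed slab, whose axial offset is at most `5 + 64/T < 10`. Connectedness of the target does
  -- the rest.
  have hsubset : slab c (5 * μ) ⊆ F '' slab s 10 := by
    refine isPreconnected_slab.subset_of_closure_inter_subset
      ((hF.mono hsub).isOpen_image (isOpen_slab _ _)) ?_ ?_
    · have hm : xa ∈ slab s 10 := ⟨hxa, by rw [hs, sub_self, abs_zero]; norm_num⟩
      refine ⟨F xa, ⟨(h.right_mem (hF.rel_map (hsub hm))).1, ?_⟩, xa, hm, rfl⟩
      have h1 := hax xa (F xa) (hF.rel_map (hsub hm)) (by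
        rw [hs, sub_self, abs_zero]; linarith)
      rw [hs, sub_self, mul_zero, mul_zero, sub_zero] at h1
      refine h1.trans_lt ?_
      gcongr
      linarith
    · rintro z ⟨hz, hz0, hzc⟩
      have hz' := closure_minimal (image_mono (f := F) (s := slab s 10)
        (t := {x : E 4 | x ≠ 0 ∧ axial x ∈ Icc (s - 10) (s + 10)}) fun x hx =>
        ⟨hx.1, by
          have := abs_lt.1 hx.2
          constructor <;> linarith⟩) hclosed hz
      obtain ⟨x, ⟨hx0, hxI⟩, rfl⟩ := hz'
      rw [mem_Icc] at hxI
      have hxs : |axial x - s| ≤ T / 2 := by rw [abs_le]; constructor <;> linarith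
      have hxm : x ∈ slab s (T / 2) := ⟨hx0, by rw [abs_lt]; constructor <;> linarith⟩
      have h1 := hax x (F x) (hF.rel_map hxm) hxs
      have h2 : |axial x - s| * μ ≤ (5 + 64 / T) * μ := by
        have e1 : |σ * (μ * (axial x - s))| = |axial x - s| * μ := by
          rw [abs_mul, hσ, abs_mul, abs_of_pos hμ]; ring
        rw [← e1]
        have e2 := abs_sub_abs_le_abs_sub (σ * (μ * (axial x - s))) (axial (F x) - c)
        rw [abs_sub_comm (σ * (μ * (axial x - s)))] at e2
        linarith
      have h3 := le_of_mul_le_mul_right h2 hμ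
      exact ⟨x, ⟨hx0, by linarith⟩, rfl⟩
  exact hsubset ⟨hy, hyc⟩

/-- Such a lift almost preserves the angles between points of the middle slice. -/
lemma abs_angle_sub_angle_le {σ s c : ℝ} (h : IsOverlap Γ Γ' L (κ * μ) (κ * μ⁻¹) rel)
    (hT : 10 ^ 4 ≤ T) (hκ1 : 1 ≤ κ) (hκ : κ ≤ 1 + 1 / T ^ 2) (hμ : 0 < μ) (hμ1 : μ ≤ 1)
    (hσ : |σ| = 1) {xa : E 4} (hxa : xa ≠ 0) (hs : axial xa = s)
    (hF : IsLiftOn rel (κ * μ) (κ * μ⁻¹) F (slab s (T / 2)))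
    (hax : ∀ x y, rel x y → |axial x - s| ≤ T / 2 →
      |axial y - c - σ * (μ * (axial x - s))| ≤ 64 / T * μ)
    {x z : E 4} (hx0 : x ≠ 0) (hx : axial x = s) (hz0 : z ≠ 0) (hz : axial z = s) :
    |angle (F x) (F z) - angle x z| ≤ 1 / 10 := by
  have hT0 : 0 < T := by linarith
  have h64 : 64 / T ≤ 64 / 10 ^ 4 := by gcongr
  have hκ' : κ ≤ 1 + 1 / 10 ^ 4 := by
    refine hκ.trans ?_
    gcongr
    nlinarith
  have hπ := Real.pi_lt_four
  -- This is where `μ ≤ 1` matters: only then does the stretching bound say that angles hardly grow.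
  have hκμ : κ * μ ≤ κ := mul_le_of_le_one_right (by linarith) hμ1
  have h6 : 2 < √6 := by rw [Real.lt_sqrt (by norm_num)]; norm_num
  have hlip : ∀ {u v : E 4}, u ∈ slab s (T / 2) → v ∈ slab s (T / 2) →
      angle (F u) (F v) ≤ κ * (angle u v + |axial v - axial u| / 2) := by
    intro u v hu hv
    have h1 := hF.angle_le h hu hv
    have h2 : κ * μ * cylinderDist u v ≤ κ * (√6 * angle u v + |axial v - axial u|) :=
      mul_le_mul hκμ (cylinderDist_le_add u v) (cylinderDist_nonneg u v) (by linarith)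
    have h3 : √6 * angle u v + |axial v - axial u|
        ≤ √6 * (angle u v + |axial v - axial u| / 2) := by
      nlinarith [abs_nonneg (axial v - axial u)]
    have h4 : √6 * angle (F u) (F v) ≤ √6 * (κ * (angle u v + |axial v - axial u| / 2)) := by
      calc _ ≤ κ * (√6 * angle u v + |axial v - axial u|) := h1.trans h2
        _ ≤ κ * (√6 * (angle u v + |axial v - axial u| / 2)) := by gcongr
        _ = _ := by ring
    exact le_of_mul_le_mul_left h4 (by linarith)
  have hslice : ∀ {u : E 4}, u ≠ 0 → axial u = s → u ∈ slab s (T / 2) := fun hu hus =>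
    ⟨hu, by rw [hus, sub_self, abs_zero]; linarith⟩
  have hxm := hslice hx0 hx
  have hzm := hslice hz0 hz
  have hup := hlip hxm hzm
  rw [hx, hz, sub_self, abs_zero, zero_div, add_zero] at hup
  have hFx0 : F x ≠ 0 := (h.right_mem (hF.rel_map hxm)).1
  have haxneg : axial (-F x) = axial (F x) := by rw [axial, norm_neg]; rfl
  have hFxc := hax x (F x) (hF.rel_map hxm) (by rw [hx, sub_self, abs_zero]; linarith)
  rw [hx, sub_self, mul_zero, mul_zero, sub_zero] at hFxc
  -- `w` is sent to the antipode of `F x`. The angle bound for `x, w` makes `w` nearly antipodal to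
  -- `x`, and an upper bound for the angle of `F w, F z` becomes a lower bound for that of `F x, F
  -- z`.
  obtain ⟨w, hw, hFw⟩ := exists_preimage_of_lift h hT hμ hσ hxa hs hF hax (neg_ne_zero.2 hFx0) (by
    rw [haxneg]
    refine hFxc.trans_lt ?_
    gcongr
    linarith)
  have hwm : w ∈ slab s (T / 2) := ⟨hw.1, hw.2.trans (by linarith)⟩
  have hws : |axial w - s| ≤ 1 / 50 := by
    have h1 := hax w (F w) (hF.rel_map hwm) hwm.2.le
    rw [hFw, haxneg] at h1
    have e1 : |σ * (μ * (axial w - s))| = |axial w - s| * μ := by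
      rw [abs_mul, hσ, abs_mul, abs_of_pos hμ]; ring
    have e2 := abs_sub_abs_le_abs_sub (σ * (μ * (axial w - s))) (axial (F x) - c)
    rw [abs_sub_comm (σ * (μ * (axial w - s))), e1] at e2
    have h2 : |axial w - s| * μ ≤ 128 / T * μ := by
      have : 128 / T * μ = 64 / T * μ + 64 / T * μ := by ring
      linarith
    have h3 := le_of_mul_le_mul_right h2 hμ
    have h4 : 128 / T = 2 * (64 / T) := by ring
    linarith
  have hxw := hlip hxm hwm
  have hwz := hlip hwm hzm
  rw [hFw, angle_self_neg_of_nonzero hFx0, hx] at hxw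
  rw [hFw, angle_neg_left, hz, abs_sub_comm] at hwz
  -- The triangle inequality through `-w` says that the three angles between `x`, `w`, `z` sum to at
  -- most 2π.
  have t1 := angle_le_angle_add_angle x (-w) z
  rw [angle_neg_right, angle_neg_left] at t1
  have p1 := angle_nonneg x w
  have p2 := angle_nonneg w z
  have p3 := angle_nonneg x z
  have q1 := angle_le_pi x w
  have q2 := angle_le_pi w z
  have q3 := angle_le_pi x z
  have a0 := abs_nonneg (axial w - s)
  have m1 : κ * angle x z ≤ (1 + 1 / 10 ^ 4) * angle x z := by gcongr
  have m2 : κ * (angle x w + |axial w - s| / 2)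
      ≤ (1 + 1 / 10 ^ 4) * (angle x w + |axial w - s| / 2) := by gcongr
  have m3 : κ * (angle w z + |axial w - s| / 2)
      ≤ (1 + 1 / 10 ^ 4) * (angle w z + |axial w - s| / 2) := by gcongr
  rw [abs_le]
  constructor <;> linarith

/-- The groups of two overlapping necks are conjugate, provided that the scale of the first neck is
not larger than that of the second, and that the common point is not close to the ends. -/
theorem IsOverlap.exists_conj [Finite Γ] [Finite Γ']
    (h : IsOverlap Γ Γ' L (κ * μ) (κ * μ⁻¹) rel) (hT : 10 ^ 4 ≤ T) (hκ1 : 1 ≤ κ)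
    (hκ : κ ≤ 1 + 1 / T ^ 2) (hμ : 0 < μ) (hμ1 : μ ≤ 1) {xa xb : E 4}
    (hab : rel xa xb) (hxa : |axial xa| ≤ L - 10 * T) (hxb : |axial xb| ≤ L - 10 * T * μ) :
    ∃ a : O4, Γ' = Γ.map (MulAut.conj a).toMonoidHom := by
  have hT0 : 0 < T := by linarith
  obtain ⟨hrel, σ, hσ, hax⟩ := h.exists_axial_near hT hκ1 hκ hμ hab hxa hxb
  have hxa0 : xa ≠ 0 := (h.left_mem hab).1
  set s := axial xa with hs
  obtain ⟨F, hF⟩ := exists_lift_slab h (s := s) (K := T / 2) (by linarith)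
    fun x hx hxs => hrel x hx (by linarith)
  have hsub : slab s 10 ⊆ slab s (T / 2) := fun x hx => ⟨hx.1, hx.2.trans (by linarith)⟩
  -- The graph of the correspondence between the groups. A subgroup of pairs lets the averaging
  -- proceed without showing that it is an isomorphism.
  let H : Subgroup (O4 × O4) :=
    { carrier := {p | p.1 ∈ Γ ∧ p.2 ∈ Γ' ∧ ∀ x ∈ slab s (T / 2), F (p.1 x) = p.2 (F x)}
      one_mem' := ⟨Γ.one_mem, Γ'.one_mem, fun x _ => rfl⟩
      mul_mem' := by
        rintro p q ⟨hp1, hp2, hp⟩ ⟨hq1, hq2, hq⟩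
        refine ⟨Γ.mul_mem hp1 hq1, Γ'.mul_mem hp2 hq2, fun x hx => ?_⟩
        change F (p.1 (q.1 x)) = p.2 (q.2 (F x))
        rw [hp _ (mem_slab_O4 _ hx), hq x hx]
      inv_mem' := by
        rintro p ⟨hp1, hp2, hp⟩
        refine ⟨Γ.inv_mem hp1, Γ'.inv_mem hp2, fun x hx => ?_⟩
        have h1 := hp (p.1⁻¹ x) (mem_slab_O4 _ hx)
        have h2 : p.1 (p.1⁻¹ x) = x := p.1.apply_symm_apply x
        rw [h2] at h1
        rw [Prod.fst_inv, Prod.snd_inv, h1]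
        exact (p.2.symm_apply_apply _).symm }
  have hHfin : Finite H := by
    refine Finite.of_injective (β := Γ × Γ') (fun p => (⟨p.1.1, p.2.1⟩, ⟨p.1.2, p.2.2.1⟩)) ?_
    rintro ⟨p, hp⟩ ⟨q, hq⟩ hpq
    simp only [Prod.mk.injEq, Subtype.mk.injEq] at hpq
    exact Subtype.ext (Prod.ext hpq.1 hpq.2)
  have hleft : ∀ γ ∈ Γ, ∃ γ' ∈ Γ', (γ, γ') ∈ H := by
    intro γ hγ
    obtain ⟨γ', hγ', heq⟩ := hF.exists_eqOn h (isOpen_slab _ _) isPreconnected_slab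
      (hF.comp_smul h hγ fun x hx => mem_slab_O4 γ hx)
    exact ⟨γ', hγ', hγ, hγ', fun x hx => heq hx⟩
  have hright : ∀ γ' ∈ Γ', ∃ γ ∈ Γ, (γ, γ') ∈ H := by
    intro γ' hγ'
    -- At a point with trivial isotropy, an element of `Γ'` is determined by where it sends the
    -- point. Preimages of `y` and `γ' y` lie in one `Γ`-orbit, and the partner `δ` of the
    -- connecting `γ` must be `γ'`.
    obtain ⟨y, hy0, hyc, hfree⟩ := exists_free_point (Γ' := Γ') (axial xb)
    have hyc' : |axial y - axial xb| < 5 * μ := by rw [hyc, sub_self, abs_zero]; positivity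
    have hγy : axial (γ' y) = axial y := by rw [axial, norm_O4]; rfl
    obtain ⟨x, hx, hFx⟩ := exists_preimage_of_lift h hT hμ hσ hxa0 hs.symm hF hax hy0 hyc'
    obtain ⟨x', hx', hFx'⟩ := exists_preimage_of_lift h hT hμ hσ hxa0 hs.symm hF hax
      (y := γ' y) (by rw [← norm_ne_zero_iff, norm_O4]; exact norm_ne_zero_iff.2 hy0)
      (by rwa [hγy])
    have r1 := h.smul_right (hF.rel_map (hsub hx)) γ' hγ'
    have r2 := hF.rel_map (hsub hx')
    rw [hFx] at r1
    rw [hFx'] at r2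
    obtain ⟨γ, hγ, hγx⟩ := h.orbit_left r1 r2
    obtain ⟨δ, hδ, hH⟩ := hleft γ hγ
    have e1 := hH.2.2 x (hsub hx)
    simp only [hγx, hFx', hFx] at e1
    have e2 : δ⁻¹ * γ' = 1 := by
      refine hfree _ (Γ'.mul_mem (Γ'.inv_mem hδ) hγ') ?_
      change δ⁻¹ (γ' y) = y
      rw [e1]
      exact δ.symm_apply_apply y
    rw [inv_mul_eq_one] at e2
    exact ⟨γ, hγ, e2 ▸ hH⟩
  set r := ‖xa‖ with hr
  have hr0 : 0 < r := norm_pos_iff.2 hxa0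
  have hru : ∀ {u : E 4}, ‖u‖ = 1 → r • u ≠ 0 ∧ axial (r • u) = s := by
    intro u hu
    have hn : ‖r • u‖ = r := by rw [norm_smul, hu, mul_one, Real.norm_eq_abs, abs_of_pos hr0]
    exact ⟨by rw [← norm_ne_zero_iff, hn]; exact hr0.ne', by rw [axial, hn]; rfl⟩
  have hrm : ∀ {u : E 4}, ‖u‖ = 1 → r • u ∈ slab s (T / 2) := fun hu =>
    ⟨(hru hu).1, by rw [(hru hu).2, sub_self, abs_zero]; linarith⟩
  have hF0 : ∀ {u : E 4}, ‖u‖ = 1 → F (r • u) ≠ 0 := fun hu =>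
    (h.right_mem (hF.rel_map (hrm hu))).1
  have hφ1 : ∀ u : E 4, ‖u‖ = 1 → ‖radial (F (r • u))‖ = 1 := fun u hu => by
    simpa using radial_mem (hF0 hu)
  obtain ⟨a, ha⟩ := exists_conj_of_almost_isometry H (φ := fun u => radial (F (r • u))) hφ1
    (by
      intro u v hu hv
      have h1 := abs_angle_sub_angle_le h hT hκ1 hκ hμ hμ1 hσ hxa0 hs.symm hF hax
        (hru hu).1 (hru hu).2 (hru hv).1 (hru hv).2
      have e1 : inner ℝ (radial (F (r • u))) (radial (F (r • v)))
          = Real.cos (angle (F (r • u)) (F (r • v))) := by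
        rw [← angle_smul_left_of_pos _ _ (inv_pos.2 (norm_pos_iff.2 (hF0 hu))),
          ← angle_smul_right_of_pos _ _ (inv_pos.2 (norm_pos_iff.2 (hF0 hv)))]
        change _ = Real.cos (angle (radial (F (r • u))) (radial (F (r • v))))
        rw [cos_angle, hφ1 u hu, hφ1 v hv, mul_one, div_one]
      have e2 : inner ℝ u v = Real.cos (angle (r • u) (r • v)) := by
        rw [angle_smul_left_of_pos _ _ hr0, angle_smul_right_of_pos _ _ hr0, cos_angle, hu, hv,
          mul_one, div_one]
      rw [e1, e2]
      exact (Real.abs_cos_sub_cos_le _ _).trans h1)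
    (by
      intro p hp u hu
      have h1 := hp.2.2 (r • u) (hrm hu)
      rw [← map_smul, h1, radial, norm_O4, radial, map_smul])
  refine ⟨a, Subgroup.ext fun γ' => ?_⟩
  rw [Subgroup.mem_map]
  constructor
  · intro hγ'
    obtain ⟨γ, hγ, hH⟩ := hright γ' hγ'
    exact ⟨γ, hγ, (ha _ hH).symm⟩
  · rintro ⟨γ, hγ, rfl⟩
    obtain ⟨γ', hγ', hH⟩ := hleft γ hγ
    have := ha _ hH
    simp only at this
    change a * γ * a⁻¹ ∈ Γ'
    rwa [← this]

/-! ### Moving the common point away from the ends, and the theorem -/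

lemma exists_cylinderChart_eq (Γ : Subgroup O4) [Finite Γ] {L : ℝ} (p : Cylinder Γ L) :
    ∃ x : annulus L, (cylinderChart Γ L).toFun x = p ∧ axial x = p.2 := by
  obtain ⟨c, rfl, x, hx⟩ := (cylinderAtlas Γ L).covers p
  exact ⟨x, hx, congrArg (fun q : Cylinder Γ L => (q.2 : ℝ)) hx⟩

/-- The groups of two overlapping necks are conjugate if some common point is not close to the ends
of the first neck. -/
theorem IsOverlap.exists_conj_of_central [Finite Γ] [Finite Γ']
    (h : IsOverlap Γ Γ' L (κ * μ) (κ * μ⁻¹) rel) (hL : 10 ^ 9 ≤ L) (hκ1 : 1 ≤ κ)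
    (hκ : κ ≤ 1 + 1 / (10 ^ 4) ^ 2) (hμ : 0 < μ) {x y : E 4} (hxy : rel x y)
    (hx : |axial x| ≤ 0.9 * L) : ∃ a : O4, Γ' = Γ.map (MulAut.conj a).toMonoidHom := by
  have hy := (h.right_mem hxy).2
  rw [mem_Ioo] at hy
  -- The partner is moved by `D` along its axis, towards the middle, to gain margin `D` in the
  -- second neck; the point of the first neck moves by at most `κ * μ⁻¹ * D`, which the margin 0.1 L
  -- absorbs.
  have hmove : ∀ D : ℝ, 0 ≤ D → D ≤ 0.05 * L → κ * μ⁻¹ * D ≤ 0.06 * L →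
      ∃ x' y', rel x' y' ∧ |axial x'| ≤ 0.96 * L ∧ |axial y'| ≤ L - D := by
    intro D hD hDL hκD
    obtain ⟨t, ht1, ht2⟩ : ∃ t : ℝ, |t - axial y| = D ∧ |t| ≤ L - D := by
      rcases le_total 0 (axial y) with hc | hc
      · refine ⟨axial y - D, ?_, ?_⟩
        · rw [sub_sub_cancel_left, abs_neg, abs_of_nonneg hD]
        · rw [abs_le]; constructor <;> linarith
      · refine ⟨axial y + D, ?_, ?_⟩
        · rw [add_sub_cancel_left, abs_of_nonneg hD]
        · rw [abs_le]; constructor <;> linarith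
    have hρ' : 0 ≤ κ * μ⁻¹ := by positivity
    rcases hD.eq_or_lt with rfl | hD0
    · exact ⟨x, y, hxy, by linarith, by rw [abs_le]; constructor <;> linarith⟩
    obtain ⟨x', y', h1, h2, h3⟩ := h.exists_rel_axial_eq hρ' hxy (t := t)
      (abs_lt.1 (by linarith)) (by rw [ht1]; linarith)
    refine ⟨x', y', h1, ?_, by rwa [h2]⟩
    rw [ht1] at h3
    have := abs_sub_abs_le_abs_sub (axial x') (axial x)
    linarith
  have hκ2 : κ ≤ 1.1 := hκ.trans (by norm_num)
  -- The neck of smaller scale has to come first, so for `μ ≥ 1` the roles are exchanged. The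
  -- margins 0.04 L and `D` suffice because `10 * T = 10 ^ 5` is tiny compared with `L ≥ 10 ^ 9`.
  rcases le_total μ 1 with hμ1 | hμ1
  · have hμL : 0 < μ * L := by positivity
    have hk : κ * μ⁻¹ * (0.05 * (μ * L)) = κ * (0.05 * L) := by field_simp
    obtain ⟨x', y', h1, h2, h3⟩ := hmove (0.05 * (μ * L)) (by positivity) (by nlinarith)
      (by rw [hk]; nlinarith)
    exact h.exists_conj (T := 10 ^ 4) le_rfl hκ1 hκ hμ hμ1 h1 (by linarith) (by nlinarith)
  · have hμ' : μ⁻¹ ≤ 1 := inv_le_one_of_one_le₀ hμ1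
    have hμ0 : 0 < μ⁻¹ := inv_pos.2 hμ
    obtain ⟨x', y', h1, h2, h3⟩ := hmove (0.05 * L) (by positivity) le_rfl (by
      have : κ * μ⁻¹ ≤ κ := mul_le_of_le_one_right (by linarith) hμ'
      nlinarith)
    have hsymm : IsOverlap Γ' Γ L (κ * μ⁻¹) (κ * μ⁻¹⁻¹) fun x y => rel y x := by
      rw [inv_inv]; exact h.symm
    obtain ⟨a, ha⟩ := hsymm.exists_conj (T := 10 ^ 4) le_rfl hκ1 hκ hμ0 hμ' h1
      (by linarith) (by nlinarith)
    refine ⟨a⁻¹, ?_⟩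
    rw [ha, Subgroup.map_map]
    have : (MulAut.conj a⁻¹).toMonoidHom.comp (MulAut.conj a).toMonoidHom = MonoidHom.id O4 := by
      ext1 γ
      simp [MulAut.conj_apply, mul_assoc]
    rw [this, Subgroup.map_id]

end NeckOrbifold
end

theorem lemmaA2 :
    ∃ ε₀ : ℝ, 0 < ε₀ ∧ ∀ ε : ℝ, 0 < ε → ε ≤ ε₀ →
      ∀ (X : Type*) [TopologicalSpace X] [T2Space X] [SecondCountableTopology X]
        (A : NeckOrbifold.OrbifoldAtlas 4 X) (g : NeckOrbifold.OrbifoldMetric A)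
        (Γ₁ Γ₂ : Subgroup NeckOrbifold.O4) [Finite Γ₁] [Finite Γ₂]
        (ψ₁ : NeckOrbifold.Cylinder Γ₁ ε⁻¹ → X) (ψ₂ : NeckOrbifold.Cylinder Γ₂ ε⁻¹ → X),
        NeckOrbifold.IsNeck g ε Γ₁ ψ₁ → NeckOrbifold.IsNeck g ε Γ₂ ψ₂ →
        ∀ (y : X) (p₁ : NeckOrbifold.Cylinder Γ₁ ε⁻¹) (p₂ : NeckOrbifold.Cylinder Γ₂ ε⁻¹),
          ψ₁ p₁ = y → ψ₂ p₂ = y →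
          -(0.9 * ε⁻¹) ≤ (p₁.2 : ℝ) → (p₁.2 : ℝ) ≤ 0.9 * ε⁻¹ →
          ∃ a : NeckOrbifold.O4, Γ₂ = Γ₁.map (MulAut.conj a).toMonoidHom := by
  -- With this choice the half-length is at least 10⁹, and `√((1 + ε) / (1 - ε))`, roughly `1 + ε`,
  -- is below `1 + 1 / T²` for `T = 10 ^ 4`.
  refine ⟨1 / 10 ^ 9, by norm_num, ?_⟩
  intro ε hε0 hε X _ _ _ A g Γ₁ Γ₂ _ _ ψ₁ ψ₂ H₁ H₂ y p₁ p₂ hy₁ hy₂ hlo hhi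
  have hε1 : ε < 1 := hε.trans_lt (by norm_num)
  have h1ε : 0 < 1 - ε := by linarith
  obtain ⟨μ, hμ, h⟩ := NeckOrbifold.exists_isOverlap_of_isNeck hε0 hε1 H₁ H₂
  obtain ⟨x₁, hx₁, hax₁⟩ := NeckOrbifold.exists_cylinderChart_eq Γ₁ p₁
  obtain ⟨x₂, hx₂, -⟩ := NeckOrbifold.exists_cylinderChart_eq Γ₂ p₂
  refine h.exists_conj_of_central ?_ ?_ ?_ hμ (x := x₁) (y := x₂) ⟨x₁.2, x₂.2, ?_⟩ ?_
  · rw [le_inv_comm₀ (by norm_num) hε0]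
    simpa using hε
  · rw [Real.one_le_sqrt, le_div_iff₀ h1ε]
    linarith
  · rw [Real.sqrt_le_left (by norm_num), div_le_iff₀ h1ε]
    norm_num at hε ⊢
    nlinarith
  · exact (congrArg ψ₁ hx₁).trans (hy₁.trans (hy₂.symm.trans (congrArg ψ₂ hx₂).symm))
  · rw [hax₁, abs_le]
    exact ⟨hlo, hhi⟩
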